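/- Let $d,d'$ be natural numbers, $s\in(0,d)$, $\alpha\in(0,1]$, and let $K:\mathbb{R}^d\setminus\{0\}\to\mathbb{C}^{d'}$ be a homogeneous $s$-dimensional Calderón–Zygmund kernel: $|K(x)|\le |x|^{-s}$, $K(-x)=-K(x)$, $K(\lambda x)=\lambda^{-s}K(x)$ for $\lambda>0$, and $x\mapsto |x|^{s+\alpha}K(x)$ is Hölder continuous of order $\alpha$ on $\mathbb{R}^d\setminus\{0\}$. Measures are non-negative locally finite Borel measures on $\mathbb{R}^d$; write $\operatorname{Lip}_0$ for the compactly supported complex-valued Lipschitz functions on $\mathbb{R}^d$. A measure $\mu$ is $\Lambda$-nice if $\mu(B(x,r))\le\Lambda r^s$ for every ball $B(x,r)$, and nice if it is $\Lambda$-nice for some $\Lambda>0$. For $f,\varphi\in\operatorname{Lip}_0$ put $$\langle T(f\mu),\varphi\rangle_\mu=\iint K(x-y)\,\tfrac12\bigl[f(y)\varphi(x)-\varphi(y)f(x)\bigr]\,d\mu(x)\,d\mu(y).$$ A measure $\mu$ is reflectionless for $T$ if $|x-y|^{1-s}\in L^1_{\mathrm{loc}}(\mu\times\mu)$, $\int_{|x|\ge1}|x|^{-s-\alpha}\,d\mu(x)<\infty$,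 and for every $f\in\operatorname{Lip}_0$ with $\int f\,d\mu=0$, $$\langle T(f\mu),\psi\rangle_\mu+\int \bigl(1-\psi(x)\bigr)\Bigl(\int K(x-y)f(y)\,d\mu(y)\Bigr)d\mu(x)=0,$$ where $\psi\in\operatorname{Lip}_0$ equals $1$ in a neighbourhood of $\operatorname{supp} f$ (the left-hand side does not depend on the choice of $\psi$). For $\delta>0$ let $K_\delta(x)=K(x)\bigl(|x|/\max(|x|,\delta)\bigr)^{s+\alpha}$ for $x\neq0$, $K_\delta(0)=0$, and $T_{\mu,\delta}f(x)=\int K_\delta(x-y)f(y)\,d\mu(y)$. For a nice measure $\mu$, $T$ is bounded in $L^2(\mu)$ if $\sup_{\delta>0}\|T_{\mu,\delta}\|_{L^2(\mu)\to L^2(\mu)}<\infty$; in that case $T_\mu$ is the unique bounded linear operator on $L^2(\mu)$ (with $\mathbb{C}^{d'}$-valued images) such that $\int (T_\mu f)\,\varphi\,d\mu=\langle T(f\mu),\varphi\rangle_\mu$ for all $f,\varphi\in\operatorname{Lip}_0$. For $p\in(0,\infty)$ the $p$-Wolff potential of $\mu$ is $$\mathbb{W}_p(\mu)(x)=\int_0^\infty\Bigl(\frac{\mu(B(x,r))}{r^s}\Bigr)^p\frac{dr}{r}.$$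 **Proposition.** Suppose that the only nice reflectionless measure for $T$ is the zero measure. Then there exists $p\in(0,\infty)$, depending only on $d$, $d'$, $s$, $\alpha$ and the kernel $K$ of $T$, such that for all $\Lambda>0$ and $B\in\mathbb{R}$ there is a constant $C>0$, depending only on $d$, $d'$, $s$, $\alpha$, $K$, $\Lambda$ and $B$, with the following property: every $\Lambda$-nice measure $\mu$ for which $T$ is bounded in $L^2(\mu)$ and $\|T_\mu\|_{L^2(\mu)\to L^2(\mu)}\le B$ satisfies $$\int_Q\mathbb{W}_p(\chi_Q\mu)\,d\mu\le C\,\mu(Q)\quad\text{for every (axis-parallel) cube } Q\subset\mathbb{R}^d.$$ -/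

import Mathlib

open MeasureTheory Set Filter Topology
open scoped NNReal ENNReal

namespace CZO

/-- The Euclidean space `ℝ^d`. -/
abbrev E (d : ℕ) : Type := EuclideanSpace ℝ (Fin d)

/-- The Hermitian space `ℂ^m`, where the kernels take their values. -/
abbrev V (m : ℕ) : Type := EuclideanSpace ℂ (Fin m)

/-- `μ` is `Λ`-nice: `μ(B(x,r)) ≤ Λ r^s` for every ball. -/
def IsNiceWith {d : ℕ} (s Λ : ℝ) (μ : Measure (E d)) : Prop :=
  ∀ (x : E d) (r : ℝ), 0 < r → μ (Metric.ball x r) ≤ ENNReal.ofReal (Λ * r ^ s)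

/-- `μ` is nice: it is `Λ`-nice for some `Λ > 0`. -/
def IsNice {d : ℕ} (s : ℝ) (μ : Measure (E d)) : Prop :=
  ∃ Λ : ℝ, 0 < Λ ∧ IsNiceWith s Λ μ

/-- Homogeneous `s`-dimensional Calderón–Zygmund kernels with Hölder exponent `α`.
The value `K 0` is irrelevant. -/
structure IsCZKernel {d m : ℕ} (s α : ℝ) (K : E d → V m) : Prop where
  norm_le : ∀ x, x ≠ 0 → ‖K x‖ ≤ 1 / ‖x‖ ^ s
  odd : ∀ x, x ≠ 0 → K (-x) = -K x
  holder : ∃ C : ℝ, ∀ x y : E d, x ≠ 0 → y ≠ 0 →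
    ‖‖x‖ ^ (s + α) • K x - ‖y‖ ^ (s + α) • K y‖ ≤ C * ‖x - y‖ ^ α
  homogeneous : ∀ (t : ℝ) (x : E d), 0 < t → x ≠ 0 → K (t • x) = t ^ (-s) • K x

/-- The regularized kernel `K_δ(x) = K(x) (|x| / max(|x|, δ))^(s+α)`; for `s + α > 0` and `δ > 0`
it vanishes at `0`. -/
noncomputable def regKernel {d m : ℕ} (s α : ℝ) (K : E d → V m) (δ : ℝ) (x : E d) : V m :=
  (‖x‖ / max ‖x‖ δ) ^ (s + α) • K x

/-- The regularized transform `T_{μ,δ}(f)(x) = ∫ K_δ(x-y) f(y) dμ(y)`. -/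
noncomputable def regTransform {d m : ℕ} (s α : ℝ) (K : E d → V m) (μ : Measure (E d)) (δ : ℝ)
    (f : E d → ℂ) (x : E d) : V m :=
  ∫ y, f y • regKernel s α K δ (x - y) ∂μ

/-- `T` is bounded in `L²(μ)`: the operators `T_{μ,δ}`, `δ > 0`, are uniformly bounded from
`L²(μ)` to `L²(μ)`. -/
def IsBoundedCZO {d m : ℕ} (s α : ℝ) (K : E d → V m) (μ : Measure (E d)) : Prop :=
  ∃ C : ℝ≥0, ∀ δ : ℝ, 0 < δ → ∀ f : E d → ℂ, MemLp f 2 μ →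
    eLpNorm (regTransform s α K μ δ f) 2 μ ≤ C * eLpNorm f 2 μ

/-- `f ∈ Lip_0(ℝ^d)`: `f` is Lipschitz continuous with compact support. -/
def IsLipZero {d : ℕ} (f : E d → ℂ) : Prop :=
  (∃ L : ℝ≥0, LipschitzWith L f) ∧ HasCompactSupport f

/-- The pairing `⟨T(fμ), φ⟩_μ = ∬ K(x-y) H_{f,φ}(x,y) dμ(x) dμ(y)` with
`H_{f,φ}(x,y) = (f(y) φ(x) - φ(y) f(x)) / 2`. -/
noncomputable def pairing {d m : ℕ} (K : E d → V m) (μ : Measure (E d)) (f φ : E d → ℂ) : V m :=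
  ∫ z : E d × E d,
    ((1 / 2 : ℂ) * (f z.2 * φ z.1 - φ z.2 * f z.1)) • K (z.1 - z.2) ∂(μ.prod μ)

/-- The extension of the pairing `⟨T(fμ), φ⟩_μ` to bounded Lipschitz `φ`, computed with a cut-off
function `ψ`, where `ψ = 1` near the support of `f`:
`⟨T(fμ), ψφ⟩_μ + ∫ T(fμ)(x) (1 - ψ(x)) φ(x) dμ(x)`. -/
noncomputable def extPairing {d m : ℕ} (K : E d → V m) (μ : Measure (E d))
    (ψ f φ : E d → ℂ) : V m :=
  pairing K μ f (fun x => ψ x * φ x) +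
    ∫ x, ((1 - ψ x) * φ x) • (∫ y, f y • K (x - y) ∂μ) ∂μ

/-- `μ` is diffuse: `|x-y|^(1-s)` is locally integrable with respect to `μ × μ`. -/
def IsDiffuse {d : ℕ} (s : ℝ) (μ : Measure (E d)) : Prop :=
  ∀ S : Set (E d × E d), IsCompact S →
    ∫⁻ z in S, edist z.1 z.2 ^ (1 - s) ∂(μ.prod μ) < ⊤

/-- Restricted growth at infinity: `∫_{|x| ≥ 1} |x|^{-(s+α)} dμ(x) < ∞`. -/
def HasRestrictedGrowth {d : ℕ} (s α : ℝ) (μ : Measure (E d)) : Prop :=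
  ∫⁻ x in {x : E d | 1 ≤ ‖x‖}, ENNReal.ofReal (1 / ‖x‖ ^ (s + α)) ∂μ < ⊤

/-- `μ` is reflectionless for the operator with kernel `K`: it is a diffuse locally finite measure
with restricted growth at infinity, and `⟨T(fμ), 1⟩_μ = 0` for every `f ∈ Lip_0(ℝ^d)` with
`∫ f dμ = 0`. The pairing does not depend on the admissible cut-off `ψ`. -/
def IsReflectionless {d m : ℕ} (s α : ℝ) (K : E d → V m) (μ : Measure (E d)) : Prop :=
  IsLocallyFiniteMeasure μ ∧ IsDiffuse s μ ∧ HasRestrictedGrowth s α μ ∧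
    ∀ f ψ : E d → ℂ, IsLipZero f → ∫ x, f x ∂μ = 0 →
      IsLipZero ψ → (∀ᶠ x in 𝓝ˢ (tsupport f), ψ x = 1) →
        extPairing K μ ψ f (fun _ => 1) = 0

/-- `S` is the operator `T_μ` on `L²(μ)`: `⟨S f, φ⟩_μ = ⟨T(fμ), φ⟩_μ` for `f, φ ∈ Lip_0(ℝ^d)`
(the pairing on the left is bilinear, without complex conjugation). -/
def IsCZOperator {d m : ℕ} (K : E d → V m) (μ : Measure (E d))
    (S : Lp ℂ 2 μ →L[ℂ] Lp (V m) 2 μ) : Prop :=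
  ∀ (f φ : E d → ℂ), IsLipZero f → IsLipZero φ → ∀ F : Lp ℂ 2 μ, F =ᵐ[μ] f →
    ∫ x, φ x • S F x ∂μ = pairing K μ f φ

/-- The operator `T_μ`. It exists and is unique for a nice measure for which the operator is
bounded in `L²(μ)`. -/
noncomputable def czOperator {d m : ℕ} (K : E d → V m) (μ : Measure (E d)) :
    Lp ℂ 2 μ →L[ℂ] Lp (V m) 2 μ :=
  Classical.epsilon (IsCZOperator K μ)

/-- The `p`-Wolff potential `W_p(μ)(x) = ∫_0^∞ (μ(B(x,r)) / r^s)^p dr/r`, with values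
in `[0, ∞]`. -/
noncomputable def wolffPotential {d : ℕ} (s p : ℝ) (μ : Measure (E d)) (x : E d) : ℝ≥0∞ :=
  ∫⁻ r in Ioi (0 : ℝ),
    (μ (Metric.ball x r) / ENNReal.ofReal (r ^ s)) ^ p / ENNReal.ofReal r

/-- `Q` is a (non-degenerate, axis-parallel) cube: a product of intervals of the same length
`ℓ > 0`, each of them with or without its endpoints. -/
def IsCube {d : ℕ} (Q : Set (E d)) : Prop :=
  ∃ (a : E d) (ℓ : ℝ) (I : Fin d → Set ℝ), 0 < ℓ ∧
    (∀ i, Ioo (a i) (a i + ℓ) ⊆ I i ∧ I i ⊆ Icc (a i) (a i + ℓ)) ∧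
    Q = {x | ∀ i, x i ∈ I i}

end CZO

/-!
Write `D(x, r) = μ(B(x, r)) / r ^ s` for the density of a ball. After restricting `μ` to the cube,
the integral of the Wolff potential is at most a constant times the sum of `D ^ p * μ` over a dyadic
lattice of balls (`CZO.lintegral_wolffPotential_le`). Call a lattice ball dominant if no other ball
has a density larger than its own by more than the factor `2 * q ^ ε`, where `q` is comparable
to the exponential of the hyperbolic distance of the two balls in the upper half space
(`CZO.hypRatio`). Every ball is controlled by a dominant one, and if `ε * p` is large compared with
the dimension, the sum over all balls is controlled by the sum over the dominant ones
(`CZO.tsum_dens_le_tsum_isDominant`).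

The hypothesis on reflectionless measures enters through compactness. Rescale a dominant ball to the
unit ball with unit mass; then the densities of all balls are at most a constant times `q ^ ε`. If,
for each `ε`, the pairings `⟨T(fμ), 1⟩_μ` of the normalized Lipschitz bumps `f` of mean zero could
be arbitrarily small, then a vague limit along `ε → 0` would be a nice, reflectionless and nonzero
measure (`CZO.IsCZKernel.extPairing_eq_zero_of_isVagueLimit`). So there are `ε`, `A`, `Δ > 0` such
that every dominant ball `B(x, r)` has a bump `f` supported in `B(x, A r)` with
`|⟨T(fμ), 1⟩_μ| ≥ Δ * D(x, r) * μ(B(x, r))` (`CZO.IsCZKernel.exists_le_norm_pairing`).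

Bumps of mean zero at dominant balls are almost orthogonal: in the inner product of two of them, the
mean zero of the one at the smaller scale gains the ratio of the radii, which makes the inner
products summable over the scales. With the `L²` bound for `T`, duality gives
`∑ |⟨T(fμ), 1⟩_μ|² / μ(B(x, r)) ≤ C * μ(Q)` over the dominant balls
(`CZO.IsCZKernel.exists_sum_pairing_sq_le`), that is, a bound for the sum of `D ^ 2 * μ`. As
`D ≤ Λ`, it bounds the sum of `D ^ p * μ` too.

The bound for the norm of `T_μ` can be used because `T_μ` exists: it is a weak limit of the
regularized operators (`CZO.IsCZKernel.isCZOperator_czOperator`).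
-/

namespace CZO

/-! ### Hyperbolic geometry of balls and the dyadic lattice -/

/-- The quantity `(|x - y| + r + t)² / (r t)` attached to the balls `B(x, r)` and `B(y, t)`. It is
comparable to the exponential of the hyperbolic distance of `(x, r)` and `(y, t)` in the upper half
space, and it is submultiplicative: see `hypRatio_triangle`. -/
noncomputable def hypRatio {d : ℕ} (x : E d) (r : ℝ) (y : E d) (t : ℝ) : ℝ :=
  (dist x y + r + t) ^ 2 / (r * t)

lemma hypRatio_comm {d : ℕ} (x : E d) (r : ℝ) (y : E d) (t : ℝ) :
    hypRatio x r y t = hypRatio y t x r := by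
  unfold hypRatio
  rw [dist_comm, mul_comm]
  ring

lemma one_le_hypRatio {d : ℕ} (x y : E d) {r t : ℝ} (hr : 0 < r) (ht : 0 < t) :
    1 ≤ hypRatio x r y t := by
  unfold hypRatio
  rw [le_div_iff₀ (by positivity)]
  have := dist_nonneg (x := x) (y := y)
  nlinarith [mul_pos hr ht]

lemma hypRatio_pos {d : ℕ} (x y : E d) {r t : ℝ} (hr : 0 < r) (ht : 0 < t) :
    0 < hypRatio x r y t := lt_of_lt_of_le one_pos (one_le_hypRatio x y hr ht)

lemma hypRatio_self {d : ℕ} (x : E d) {r : ℝ} (hr : 0 < r) : hypRatio x r x r = 4 := by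
  unfold hypRatio
  rw [dist_self, div_eq_iff (by positivity)]
  ring

lemma hypRatio_triangle {d : ℕ} (x y w : E d) {r t u : ℝ} (hr : 0 < r) (ht : 0 < t)
    (hu : 0 < u) : hypRatio x r w u ≤ hypRatio x r y t * hypRatio y t w u := by
  unfold hypRatio
  have h1 := dist_nonneg (x := x) (y := y)
  have h2 := dist_nonneg (x := y) (y := w)
  have h3 := dist_triangle x y w
  have h4 := dist_nonneg (x := x) (y := w)
  have key : (dist x w + r + u) * t ≤ (dist x y + r + t) * (dist y w + t + u) := by
    nlinarith [mul_nonneg h1 h2, mul_nonneg h1 hu.le, mul_nonneg hr.le h2, mul_pos hr hu]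
  rw [div_mul_div_comm, div_le_div_iff₀ (by positivity) (by positivity)]
  have : ((dist x w + r + u) * t) ^ 2 ≤ ((dist x y + r + t) * (dist y w + t + u)) ^ 2 := by
    gcongr
  nlinarith [mul_le_mul_of_nonneg_right this (mul_pos hr hu).le]

lemma one_add_dist_div_le_hypRatio {d : ℕ} (x y : E d) {r t : ℝ} (hr : 0 < r) (ht : 0 < t) :
    1 + dist x y / r ≤ hypRatio x r y t := by
  unfold hypRatio
  have h1 := dist_nonneg (x := x) (y := y)
  rw [le_div_iff₀ (by positivity)]
  have : (1 + dist x y / r) * (r * t) = (r + dist x y) * t := by field_simp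
  rw [this]
  nlinarith

lemma div_le_hypRatio {d : ℕ} (x y : E d) {r t : ℝ} (hr : 0 < r) (ht : 0 < t) :
    r / t ≤ hypRatio x r y t := by
  unfold hypRatio
  have h1 := dist_nonneg (x := x) (y := y)
  rw [div_le_div_iff₀ (by positivity) (by positivity)]
  have : r ^ 2 ≤ (dist x y + r + t) ^ 2 := by gcongr; linarith
  nlinarith

lemma div_le_hypRatio' {d : ℕ} (x y : E d) {r t : ℝ} (hr : 0 < r) (ht : 0 < t) :
    t / r ≤ hypRatio x r y t := by
  rw [hypRatio_comm]
  exact div_le_hypRatio y x ht hr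

/-- Index set of the dyadic lattice: the index `(k, z)` stands for the point `2 ^ k z`. -/
abbrev LatticeIndex (d : ℕ) : Type := ℤ × (Fin d → ℤ)

/-- The lattice point `2 ^ k z`. -/
noncomputable def node {d : ℕ} (j : LatticeIndex d) : E d :=
  (2 : ℝ) ^ j.1 • WithLp.toLp 2 (fun i => (j.2 i : ℝ))

/-- The radius of the ball around a lattice point of scale `2 ^ k`, large enough for the balls
of one scale to cover every ball of radius at most `2 ^ k`. -/
noncomputable def rad {d : ℕ} (j : LatticeIndex d) : ℝ := (d + 1) * (2 : ℝ) ^ j.1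

lemma rad_pos {d : ℕ} (j : LatticeIndex d) : 0 < rad j := by
  unfold rad; positivity

lemma euclidean_norm_le {d : ℕ} (x : E d) (c : ℝ) (h : ∀ i, |x i| ≤ c) :
    ‖x‖ ≤ d * c := by
  have h1 : ‖x‖ ≤ ∑ i, |x i| := by
    rw [EuclideanSpace.norm_eq]
    apply Real.sqrt_le_iff.2
    refine ⟨Finset.sum_nonneg fun i _ => abs_nonneg _, ?_⟩
    simp only [Real.norm_eq_abs]
    exact Finset.sum_sq_le_sq_sum_of_nonneg fun i _ => abs_nonneg _
  refine h1.trans ((Finset.sum_le_sum fun i _ => h i).trans ?_)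
  simp

lemma exists_dist_node_le {d : ℕ} (k : ℤ) (y : E d) :
    ∃ z : Fin d → ℤ, dist y (node (k, z)) ≤ d * (2 : ℝ) ^ k := by
  have h2 : (0 : ℝ) < (2 : ℝ) ^ k := by positivity
  refine ⟨fun i => ⌊y i / (2 : ℝ) ^ k⌋, ?_⟩
  rw [dist_eq_norm]
  apply euclidean_norm_le
  intro i
  have h3 := Int.floor_le (y i / (2 : ℝ) ^ k)
  have h4 := Int.lt_floor_add_one (y i / (2 : ℝ) ^ k)
  rw [le_div_iff₀ h2] at h3
  rw [div_lt_iff₀ h2] at h4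
  simp only [node, PiLp.sub_apply, PiLp.smul_apply, smul_eq_mul]
  rw [abs_le]
  constructor <;> nlinarith

lemma ball_subset_ball_node {d : ℕ} {k : ℤ} {y : E d} {z : Fin d → ℤ} {t : ℝ}
    (hz : dist y (node (k, z)) ≤ d * (2 : ℝ) ^ k) (ht : t ≤ (2 : ℝ) ^ k) :
    Metric.ball y t ⊆ Metric.ball (node (k, z)) (rad (k, z)) := by
  apply Metric.ball_subset_ball'
  simp only [rad]
  linarith

/-! #### Lattice sums -/

lemma summable_int_inv_sq : Summable fun m : ℤ => ((1 + |(m : ℝ)|) ^ 2)⁻¹ := by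
  have h := (summable_nat_add_iff 1).2 (Real.summable_nat_pow_inv.2 (one_lt_two))
  refine Summable.of_nat_of_neg ?_ ?_ <;>
  · refine h.congr fun n => ?_
    simp
    ring

lemma exists_tsum_int_le : ∃ C : ℝ≥0, ∀ a : ℝ,
    ∑' n : ℤ, ENNReal.ofReal (((1 + |a - n|) ^ 2)⁻¹) ≤ C := by
  refine ⟨Real.toNNReal (∑' m : ℤ, 4 * ((1 + |(m : ℝ)|) ^ 2)⁻¹), fun a => ?_⟩
  rw [← (Equiv.addRight ⌊a⌋).tsum_eq]
  change _ ≤ ENNReal.ofReal _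
  rw [ENNReal.ofReal_tsum_of_nonneg (fun m => by positivity) (summable_int_inv_sq.mul_left 4)]
  refine ENNReal.tsum_le_tsum fun m => ENNReal.ofReal_le_ofReal ?_
  have h3 := Int.floor_le a
  have h4 := Int.lt_floor_add_one a
  have h5 : |(m : ℝ)| ≤ |a - ((m + ⌊a⌋ : ℤ) : ℝ)| + 1 := by
    push_cast
    have : (m : ℝ) = -(a - (m + ⌊a⌋)) + (a - ⌊a⌋) := by ring
    calc |(m : ℝ)| = |-(a - (m + ⌊a⌋)) + (a - ⌊a⌋)| := by rw [← this]
      _ ≤ |-(a - (m + ⌊a⌋))| + |a - ⌊a⌋| := abs_add_le _ _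
      _ ≤ _ := by
        rw [abs_neg]
        gcongr
        rw [abs_le]; constructor <;> linarith
  have h6 : (1 + |(m : ℝ)|) ≤ 2 * (1 + |a - ((m + ⌊a⌋ : ℤ) : ℝ)|) := by
    have := abs_nonneg (a - ((m + ⌊a⌋ : ℤ) : ℝ))
    linarith
  have h7 : (1 + |(m : ℝ)|) ^ 2 ≤ 4 * (1 + |a - ((m + ⌊a⌋ : ℤ) : ℝ)|) ^ 2 := by
    calc _ ≤ (2 * (1 + |a - ((m + ⌊a⌋ : ℤ) : ℝ)|)) ^ 2 := by gcongr
      _ = _ := by ring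
  simp only [Equiv.coe_addRight]
  rw [inv_le_iff_one_le_mul₀ (by positivity), mul_assoc, inv_mul_eq_div, ← mul_div_assoc,
    le_div_iff₀ (by positivity), one_mul]
  exact h7

lemma tsum_pi_prod_le {d : ℕ} (f : Fin d → ℤ → ℝ≥0∞) :
    ∑' z : Fin d → ℤ, ∏ i, f i (z i) ≤ ∏ i, ∑' n, f i n := by
  classical
  rw [ENNReal.tsum_eq_iSup_sum]
  refine iSup_le fun u => ?_
  calc ∑ z ∈ u, ∏ i, f i (z i)
      ≤ ∑ z ∈ Fintype.piFinset (fun i => u.image (fun z => z i)), ∏ i, f i (z i) := by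
        apply Finset.sum_le_sum_of_subset
        intro z hz
        rw [Fintype.mem_piFinset]
        exact fun i => Finset.mem_image_of_mem _ hz
    _ = ∏ i, ∑ n ∈ u.image (fun z => z i), f i n := (Finset.prod_univ_sum _ _).symm
    _ ≤ ∏ i, ∑' n, f i n := Finset.prod_le_prod' fun i _ => ENNReal.sum_le_tsum _

/-- The sums `∑ (1 + |v - z|)^(-2d)` over the integer lattice are bounded uniformly in `v`. -/
lemma exists_tsum_lattice_le (d : ℕ) : ∃ C : ℝ≥0, ∀ v : E d,
    ∑' z : Fin d → ℤ, ENNReal.ofReal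
      (((1 + dist v (WithLp.toLp 2 (fun i => (z i : ℝ)))) ^ (2 * d))⁻¹) ≤ C := by
  obtain ⟨C, hC⟩ := exists_tsum_int_le
  refine ⟨C ^ d, fun v => ?_⟩
  calc _ ≤ ∑' z : Fin d → ℤ, ∏ i, ENNReal.ofReal (((1 + |v i - z i|) ^ 2)⁻¹) := by
        refine ENNReal.tsum_le_tsum fun z => ?_
        rw [← ENNReal.ofReal_prod_of_nonneg (fun i _ => by positivity)]
        apply ENNReal.ofReal_le_ofReal
        rw [Finset.prod_inv_distrib]
        apply inv_anti₀ (Finset.prod_pos fun i _ => by positivity)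
        calc ∏ i, (1 + |v i - z i|) ^ 2
            ≤ ∏ _i : Fin d, (1 + dist v (WithLp.toLp 2 (fun i => (z i : ℝ)))) ^ 2 := by
              apply Finset.prod_le_prod (fun i _ => by positivity)
              intro i _
              gcongr
              rw [dist_eq_norm]
              have := PiLp.norm_apply_le (v - WithLp.toLp 2 (fun i => (z i : ℝ))) i
              simpa using this
          _ = _ := by simp [pow_mul]
    _ ≤ ∏ i, ∑' n : ℤ, ENNReal.ofReal (((1 + |v i - n|) ^ 2)⁻¹) :=
        tsum_pi_prod_le (fun i n => ENNReal.ofReal (((1 + |v i - n|) ^ 2)⁻¹))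
    _ ≤ ∏ _i : Fin d, (C : ℝ≥0∞) := Finset.prod_le_prod' fun i _ => hC (v i)
    _ = _ := by simp

lemma exists_two_zpow (a : ℝ) (ha : 0 < a) : ∃ k : ℤ, a ≤ (2 : ℝ) ^ k ∧ (2 : ℝ) ^ k < 2 * a := by
  obtain ⟨k, hk⟩ := exists_mem_Ioc_zpow ha (one_lt_two)
  refine ⟨k + 1, hk.2, ?_⟩
  rw [zpow_add_one₀ two_ne_zero]
  linarith [hk.1]

/-- A sum of a two-sided geometric progression centred at `1 / a`, bounded uniformly in `a`. -/
lemma exists_tsum_scale_le : ∃ C : ℝ≥0, ∀ a : ℝ, 0 < a →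
    ∑' k : ℤ, ENNReal.ofReal (min (a * (2 : ℝ) ^ k) ((a * (2 : ℝ) ^ k)⁻¹)) ≤ C := by
  have hs : Summable fun m : ℤ => 2 * ((1 / 2 : ℝ)) ^ m.natAbs := by
    apply Summable.mul_left
    exact (Summable.of_nat_of_neg (by simpa using summable_geometric_two)
      (by simpa using summable_geometric_two))
  refine ⟨Real.toNNReal (∑' m : ℤ, 2 * ((1 / 2 : ℝ)) ^ m.natAbs), fun a ha => ?_⟩
  obtain ⟨k0, h1, h2⟩ := exists_two_zpow a⁻¹ (by positivity)
  rw [← (Equiv.addRight k0).tsum_eq]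
  change _ ≤ ENNReal.ofReal _
  rw [ENNReal.ofReal_tsum_of_nonneg (fun m => by positivity) hs]
  refine ENNReal.tsum_le_tsum fun m => ENNReal.ofReal_le_ofReal ?_
  simp only [Equiv.coe_addRight]
  have h3 : 1 ≤ a * (2 : ℝ) ^ k0 := by
    rw [inv_le_iff_one_le_mul₀ ha] at h1; linarith
  have h4 : a * (2 : ℝ) ^ k0 ≤ 2 := by
    have := mul_lt_mul_of_pos_left h2 ha
    field_simp at this; linarith
  rw [zpow_add₀ two_ne_zero]
  have e : a * (2 ^ m * (2 : ℝ) ^ k0) = (a * 2 ^ k0) * 2 ^ m := by ring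
  rw [e]
  obtain ⟨n, rfl | rfl⟩ := Int.eq_nat_or_neg m
  · apply (min_le_right _ _).trans
    rw [zpow_natCast, Int.natAbs_natCast, one_div, inv_pow, mul_inv]
    gcongr
    exact (inv_le_one_of_one_le₀ h3).trans one_le_two
  · apply (min_le_left _ _).trans
    rw [zpow_neg, zpow_natCast, Int.natAbs_neg, Int.natAbs_natCast, one_div, inv_pow]
    gcongr

/-- Sums over the dyadic lattice of a weight that decays with the distance to a given ball and with
the ratio of the radii are bounded. -/
lemma exists_tsum_scale_dist_le (d : ℕ) : ∃ C : ℝ≥0, ∀ (y : E d) (t : ℝ), 0 < t →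
    ∑' j : LatticeIndex d, ENNReal.ofReal (min (rad j / t) (t / rad j) *
      ((1 + dist (node j) y / rad j) ^ (2 * d))⁻¹) ≤ C := by
  obtain ⟨C1, hC1⟩ := exists_tsum_lattice_le d
  obtain ⟨C2, hC2⟩ := exists_tsum_scale_le
  have hd : (0 : ℝ) < d + 1 := by positivity
  refine ⟨C2 * (Real.toNNReal ((d + 1 : ℝ) ^ (2 * d)) * C1), fun y t ht => ?_⟩
  set a : ℤ → ℝ≥0∞ := fun k =>
    ENNReal.ofReal (min ((d + 1) / t * (2 : ℝ) ^ k) (((d + 1) / t * (2 : ℝ) ^ k)⁻¹)) with ha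
  set b : ℤ → (Fin d → ℤ) → ℝ≥0∞ := fun k z =>
    ENNReal.ofReal (((1 + dist (((2 : ℝ) ^ k)⁻¹ • y)
          (WithLp.toLp 2 (fun i => (z i : ℝ)))) ^ (2 * d))⁻¹) with hb
  set c := ENNReal.ofReal ((d + 1 : ℝ) ^ (2 * d)) with hc
  have key : ∀ (k : ℤ) (z : Fin d → ℤ),
      ENNReal.ofReal (min (rad (k, z) / t) (t / rad (k, z)) *
        ((1 + dist (node (k, z)) y / rad (k, z)) ^ (2 * d))⁻¹) ≤ a k * (c * b k z) := by
    intro k z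
    have hk : (0 : ℝ) < 2 ^ k := by positivity
    simp only [ha, hb, hc]
    rw [← ENNReal.ofReal_mul (by positivity), ← ENNReal.ofReal_mul (by positivity)]
    apply ENNReal.ofReal_le_ofReal
    have hr := rad_pos (k, z)
    have e1 : min (rad (k, z) / t) (t / rad (k, z)) =
        min ((d + 1) / t * (2 : ℝ) ^ k) (((d + 1) / t * (2 : ℝ) ^ k)⁻¹) := by
      have e : (d + 1) / t * (2 : ℝ) ^ k = rad (k, z) / t := by simp [rad]; ring
      rw [e, inv_div]
    rw [e1]
    gcongr
    set u := dist (((2 : ℝ) ^ k)⁻¹ • y) (WithLp.toLp 2 (fun i => (z i : ℝ))) with hu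
    have hu0 : 0 ≤ u := dist_nonneg
    have e : dist (node (k, z)) y = 2 ^ k * u := by
      rw [hu, dist_comm, dist_eq_norm, dist_eq_norm]
      have : y - node (k, z) = (2 : ℝ) ^ k • (((2 : ℝ) ^ k)⁻¹ • y -
          WithLp.toLp 2 (fun i => (z i : ℝ))) := by
        rw [smul_sub, smul_smul, mul_inv_cancel₀ hk.ne', one_smul]; rfl
      rw [this, norm_smul, Real.norm_of_nonneg hk.le]
    have e' : 2 ^ k * u / rad (k, z) = u / (d + 1) := by
      simp only [rad]; field_simp
    have a4 : 1 + u ≤ (d + 1) * (1 + u / (d + 1)) := by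
      rw [mul_add, mul_div_cancel₀ _ hd.ne']
      have : (0 : ℝ) ≤ d := by positivity
      linarith
    rw [e, e', ← div_eq_mul_inv, le_div_iff₀ (by positivity), inv_mul_le_iff₀ (by positivity),
      ← mul_pow, mul_comm (1 + u / (d + 1))]
    gcongr
  calc _ ≤ ∑' j : LatticeIndex d, a j.1 * (c * b j.1 j.2) :=
        ENNReal.tsum_le_tsum fun j => key j.1 j.2
    _ = ∑' (k : ℤ) (z : Fin d → ℤ), a k * (c * b k z) :=
        ENNReal.tsum_prod (f := fun (k : ℤ) (z : Fin d → ℤ) => a k * (c * b k z))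
    _ ≤ ∑' k : ℤ, a k * (c * C1) := by
        refine ENNReal.tsum_le_tsum fun k => ?_
        rw [ENNReal.tsum_mul_left, ENNReal.tsum_mul_left]
        gcongr
        exact hC1 _
    _ ≤ C2 * (c * C1) := by
        rw [ENNReal.tsum_mul_right]
        gcongr
        exact hC2 _ (by positivity)
    _ = _ := by
        rw [ENNReal.coe_mul, ENNReal.coe_mul]; rfl

/-- Sums of a large negative power of the hyperbolic ratio over the dyadic lattice are bounded. -/
lemma exists_tsum_hypRatio_le (d : ℕ) : ∃ C : ℝ≥0, ∀ (y : E d) (t : ℝ), 0 < t →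
    ∑' j : LatticeIndex d,
      ENNReal.ofReal ((hypRatio (node j) (rad j) y t ^ (2 * d + 1))⁻¹) ≤ C := by
  obtain ⟨C, hC⟩ := exists_tsum_scale_dist_le d
  refine ⟨C, fun y t ht => le_trans (ENNReal.tsum_le_tsum fun j => ?_) (hC y t ht)⟩
  apply ENNReal.ofReal_le_ofReal
  have hr := rad_pos j
  have hH := hypRatio_pos (node j) y hr ht
  rw [pow_succ, mul_inv, mul_comm]
  refine mul_le_mul (le_min ?_ ?_) (inv_anti₀ (by positivity) ?_) (by positivity) (by positivity)
  · rw [← inv_div]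
    exact inv_anti₀ (by positivity) (div_le_hypRatio' _ _ hr ht)
  · rw [← inv_div]
    exact inv_anti₀ (by positivity) (div_le_hypRatio _ _ hr ht)
  · gcongr
    exact one_add_dist_div_le_hypRatio _ _ hr ht

/-! ### Wolff potentials and dominant balls -/

/-- The mass of the lattice ball with index `j`. -/
noncomputable def mass {d : ℕ} (μ : Measure (E d)) (j : LatticeIndex d) : ℝ :=
  μ.real (Metric.ball (node j) (rad j))

/-- The `s`-dimensional density of the lattice ball with index `j`. -/
noncomputable def dens {d : ℕ} (s : ℝ) (μ : Measure (E d)) (j : LatticeIndex d) : ℝ :=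
  mass μ j / rad j ^ s

lemma mass_nonneg {d : ℕ} (μ : Measure (E d)) (j : LatticeIndex d) : 0 ≤ mass μ j :=
  measureReal_nonneg

lemma dens_nonneg {d : ℕ} (s : ℝ) (μ : Measure (E d)) (j : LatticeIndex d) : 0 ≤ dens s μ j :=
  div_nonneg (mass_nonneg μ j) (Real.rpow_nonneg (rad_pos j).le _)

lemma measure_ball_node {d : ℕ} (μ : Measure (E d)) [IsFiniteMeasure μ] (j : LatticeIndex d) :
    μ (Metric.ball (node j) (rad j)) = ENNReal.ofReal (mass μ j) := by
  rw [mass, ofReal_measureReal]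

lemma mass_eq_dens_mul {d : ℕ} (s : ℝ) (μ : Measure (E d)) (j : LatticeIndex d) :
    mass μ j = dens s μ j * rad j ^ s := by
  rw [dens, div_mul_cancel₀ _ (Real.rpow_pos_of_pos (rad_pos j) _).ne']

/-- If a ball of radius `r ∈ (2 ^ (k - 1), 2 ^ k]` lies in the lattice ball `j = (k, z)`, then its
density is at most a constant times that of the lattice ball. -/
lemma density_le_dens {d : ℕ} {s : ℝ} (hs : 0 < s) (μ : Measure (E d)) [IsFiniteMeasure μ]
    {k : ℤ} {x : E d} {z : Fin d → ℤ} {r : ℝ}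
    (hz : dist x (node (k, z)) ≤ d * (2 : ℝ) ^ k) (h1 : (2 : ℝ) ^ k ≤ 2 * r)
    (h2 : r ≤ (2 : ℝ) ^ k) :
    μ.real (Metric.ball x r) ≤ (2 * (d + 1)) ^ s * dens s μ (k, z) * r ^ s := by
  have hk : (0 : ℝ) < 2 ^ k := by positivity
  have hr : 0 < r := by linarith
  have hp := Real.rpow_pos_of_pos (rad_pos (k, z)) s
  calc μ.real (Metric.ball x r) ≤ mass μ (k, z) := measureReal_mono (ball_subset_ball_node hz h2)
    _ = dens s μ (k, z) * rad (k, z) ^ s := mass_eq_dens_mul s μ _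
    _ ≤ dens s μ (k, z) * (2 * (d + 1) * r) ^ s := by
      gcongr
      · exact dens_nonneg _ _ _
      · exact (rad_pos (k, z)).le
      · simp only [rad]; nlinarith [mul_le_mul_of_nonneg_left h1 (by positivity : (0:ℝ) ≤ d + 1)]
    _ = _ := by
      rw [Real.mul_rpow (by positivity) hr.le]; ring

/-- The integral of the Wolff potential is controlled by a sum over the dyadic lattice. -/
lemma lintegral_wolffPotential_le {d : ℕ} {s p : ℝ} (hs : 0 < s) (hp : 0 < p)
    (μ : Measure (E d)) [IsFiniteMeasure μ] :
    ∫⁻ x, wolffPotential s p μ x ∂μ ≤ ENNReal.ofReal (((2 * (d + 1)) ^ s : ℝ) ^ p) *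
      ∑' j : LatticeIndex d, ENNReal.ofReal (dens s μ j ^ p * mass μ j) := by
  -- the dyadic interval `(2 ^ (k - 1), 2 ^ k]` of radii contributes at most the density of one
  -- lattice ball of scale `2 ^ k` that contains `x`, since `∫ dr / r ≤ 1` there
  set c := ENNReal.ofReal (((2 * (d + 1)) ^ s : ℝ) ^ p) with hc
  have key : ∀ x : E d, wolffPotential s p μ x ≤ ∑' j : LatticeIndex d,
      (Metric.ball (node j) (rad j)).indicator
        (fun _ => c * ENNReal.ofReal (dens s μ j ^ p)) x := by
    intro x
    have hcov : Ioi (0 : ℝ) ⊆ ⋃ k : ℤ, Ioc ((2 : ℝ) ^ (k - 1)) (2 ^ k) := by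
      intro r hr
      obtain ⟨k, h1, h2⟩ := exists_two_zpow r hr
      refine mem_iUnion.2 ⟨k, ?_, h1⟩
      rw [zpow_sub_one₀ two_ne_zero]
      linarith
    rw [ENNReal.tsum_prod']
    calc wolffPotential s p μ x ≤ ∑' k : ℤ, ∫⁻ r in Ioc ((2 : ℝ) ^ (k - 1)) (2 ^ k),
          (μ (Metric.ball x r) / ENNReal.ofReal (r ^ s)) ^ p / ENNReal.ofReal r :=
          (lintegral_mono_set hcov).trans (lintegral_iUnion_le _ _)
      _ ≤ _ := by
        refine ENNReal.tsum_le_tsum fun k => ?_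
        obtain ⟨z, hz⟩ := exists_dist_node_le k x
        have hk : (0 : ℝ) < 2 ^ (k - 1) := by positivity
        have hk' : (0 : ℝ) < 2 ^ k := by positivity
        have hkk : (2 : ℝ) ^ k = 2 * 2 ^ (k - 1) := by
          rw [zpow_sub_one₀ two_ne_zero]; ring
        have hx : x ∈ Metric.ball (node (k, z)) (rad (k, z)) := by
          rw [Metric.mem_ball]
          simp only [rad]
          linarith
        refine le_trans ?_ (ENNReal.le_tsum z)
        rw [indicator_of_mem hx]
        calc _ ≤ ∫⁻ _r in Ioc ((2 : ℝ) ^ (k - 1)) (2 ^ k),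
              c * ENNReal.ofReal (dens s μ (k, z) ^ p) / ENNReal.ofReal (2 ^ (k - 1)) := by
              refine setLIntegral_mono' measurableSet_Ioc fun r hr => ?_
              have hr0 : 0 < r := hk.trans hr.1
              gcongr
              · rw [hc, ← ENNReal.ofReal_mul (by positivity),
                  ← Real.mul_rpow (by positivity) (dens_nonneg _ _ _),
                  ← ENNReal.ofReal_rpow_of_nonneg (mul_nonneg (by positivity) (dens_nonneg _ _ _))
                    hp.le]
                gcongr
                apply ENNReal.div_le_of_le_mul
                rw [← ENNReal.ofReal_mul (mul_nonneg (by positivity) (dens_nonneg _ _ _)),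
                  ← ofReal_measureReal]
                apply ENNReal.ofReal_le_ofReal
                exact density_le_dens hs μ hz (by linarith [hr.1]) hr.2
              · exact hr.1.le
          _ = _ := by
            rw [lintegral_const, Measure.restrict_apply_univ, Real.volume_Ioc, hkk]
            rw [show (2 : ℝ) * 2 ^ (k - 1) - 2 ^ (k - 1) = 2 ^ (k - 1) by ring]
            apply ENNReal.div_mul_cancel
            · simpa using hk
            · exact ENNReal.ofReal_ne_top
  calc _ ≤ ∫⁻ x, ∑' j : LatticeIndex d, (Metric.ball (node j) (rad j)).indicator
        (fun _ => c * ENNReal.ofReal (dens s μ j ^ p)) x ∂μ := lintegral_mono key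
    _ = ∑' j : LatticeIndex d, c * ENNReal.ofReal (dens s μ j ^ p * mass μ j) := by
      rw [lintegral_tsum]
      · refine tsum_congr fun j => ?_
        rw [lintegral_indicator_const Metric.isOpen_ball.measurableSet, measure_ball_node,
          mul_assoc, ← ENNReal.ofReal_mul (Real.rpow_nonneg (dens_nonneg _ _ _) _)]
      · exact fun j => (measurable_const.indicator Metric.isOpen_ball.measurableSet).aemeasurable
    _ = _ := ENNReal.tsum_mul_left

/-- A lattice ball of positive mass is dominant (with exponent `ε`) if no lattice ball has a density
much larger, as measured by the power `ε` of the hyperbolic ratio. -/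
def IsDominant {d : ℕ} (s ε : ℝ) (μ : Measure (E d)) (j : LatticeIndex d) : Prop :=
  0 < mass μ j ∧ ∀ i, dens s μ i ≤
    2 * hypRatio (node j) (rad j) (node i) (rad i) ^ ε * dens s μ j

/-- Every lattice ball of positive mass is controlled by a dominant one: an almost maximizer of the
density, discounted by the power `-ε` of the hyperbolic ratio to the given ball. -/
lemma exists_isDominant {d : ℕ} {s ε Λ : ℝ} (hε : 0 < ε) (μ : Measure (E d))
    (hΛ : ∀ j, dens s μ j ≤ Λ) (j : LatticeIndex d) (hj : 0 < mass μ j) :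
    ∃ i, IsDominant s ε μ i ∧ dens s μ j ≤
      2 * 4 ^ ε * dens s μ i * hypRatio (node j) (rad j) (node i) (rad i) ^ (-ε) := by
  set F : LatticeIndex d → ℝ := fun i =>
    dens s μ i * hypRatio (node j) (rad j) (node i) (rad i) ^ (-ε) with hF
  have hH : ∀ i i', 0 < hypRatio (node i : E d) (rad i) (node i') (rad i') :=
    fun i i' => hypRatio_pos _ _ (rad_pos i) (rad_pos i')
  have hbdd : BddAbove (range F) := by
    refine ⟨Λ, ?_⟩
    rintro _ ⟨i, rfl⟩
    calc F i ≤ dens s μ i * 1 := by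
          apply mul_le_mul_of_nonneg_left _ (dens_nonneg _ _ _)
          exact Real.rpow_le_one_of_one_le_of_nonpos
            (one_le_hypRatio _ _ (rad_pos j) (rad_pos i)) (by linarith)
      _ ≤ Λ := by rw [mul_one]; exact hΛ i
  have hdj : 0 < dens s μ j := div_pos hj (Real.rpow_pos_of_pos (rad_pos j) _)
  have hFj : 0 < F j := mul_pos hdj (Real.rpow_pos_of_pos (hH j j) _)
  have hsup : 0 < iSup F := hFj.trans_le (le_ciSup hbdd j)
  obtain ⟨i, hi⟩ := exists_lt_of_lt_ciSup (show iSup F / 2 < iSup F by linarith)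
  have hFi : 0 < F i := by linarith
  have hdi : 0 < dens s μ i := by
    rcases (dens_nonneg s μ i).eq_or_lt with h | h
    · simp [hF, ← h] at hFi
    · exact h
  refine ⟨i, ⟨?_, fun l => ?_⟩, ?_⟩
  · rw [mass_eq_dens_mul s]
    exact mul_pos hdi (Real.rpow_pos_of_pos (rad_pos i) _)
  · have h1 : F l ≤ 2 * F i := by linarith [le_ciSup hbdd l]
    have htri := hypRatio_triangle (node j) (node i) (node l) (rad_pos j) (rad_pos i) (rad_pos l)
    simp only [hF, Real.rpow_neg (hH _ _).le] at h1
    rw [← div_eq_mul_inv, div_le_iff₀ (Real.rpow_pos_of_pos (hH j l) _)] at h1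
    refine h1.trans ?_
    have h2 := Real.rpow_le_rpow (hH j l).le htri hε.le
    rw [Real.mul_rpow (hH _ _).le (hH _ _).le] at h2
    have h3 := Real.rpow_pos_of_pos (hH j i) ε
    calc _ ≤ 2 * (dens s μ i * (hypRatio (node j) (rad j) (node i) (rad i) ^ ε)⁻¹) *
          (hypRatio (node j) (rad j) (node i) (rad i) ^ ε *
            hypRatio (node i) (rad i) (node l) (rad l) ^ ε) := by gcongr
      _ = _ := by field_simp
  · have h1 : F j ≤ 2 * F i := by linarith [le_ciSup hbdd j]
    simp only [hF] at h1
    rw [hypRatio_self _ (rad_pos j), Real.rpow_neg (by norm_num), ← div_eq_mul_inv,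
      div_le_iff₀ (by positivity)] at h1
    linarith

/-- The sum of `dens ^ p * mass` over all lattice balls is controlled by the sum over the dominant
balls if `p` is large. Each ball is assigned to a dominant one; the discount `H ^ (-ε (p + 1))` pays
for the ratio `H ^ s` of the radii and for the sum over the balls assigned to a dominant ball. -/
lemma tsum_dens_le_tsum_isDominant {d : ℕ} {s ε p : ℝ} (hs : 0 < s) (hε : 0 < ε) (hp : 0 < p)
    (hpε : s + (2 * d + 1) ≤ ε * (p + 1)) : ∃ C : ℝ≥0, ∀ (μ : Measure (E d)) (Λ : ℝ),
      (∀ j, dens s μ j ≤ Λ) →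
      ∑' j : LatticeIndex d, ENNReal.ofReal (dens s μ j ^ p * mass μ j) ≤
        C * ∑' i : LatticeIndex d, {i | IsDominant s ε μ i}.indicator
          (fun i => ENNReal.ofReal (dens s μ i ^ p * mass μ i)) i := by
  obtain ⟨C, hC⟩ := exists_tsum_hypRatio_le d
  refine ⟨C * Real.toNNReal ((2 * 4 ^ ε) ^ (p + 1)), fun μ Λ hΛ => ?_⟩
  set c := ENNReal.ofReal ((2 * 4 ^ ε) ^ (p + 1)) with hc
  set g : LatticeIndex d → ℝ≥0∞ := {i | IsDominant s ε μ i}.indicator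
          (fun i => ENNReal.ofReal (dens s μ i ^ p * mass μ i)) with hg
  set h : LatticeIndex d → LatticeIndex d → ℝ≥0∞ := fun j i =>
    ENNReal.ofReal ((hypRatio (node j) (rad j) (node i : E d) (rad i) ^ (2 * d + 1))⁻¹) with hh
  have hH : ∀ i i', 1 ≤ hypRatio (node i : E d) (rad i) (node i') (rad i') :=
    fun i i' => one_le_hypRatio _ _ (rad_pos i) (rad_pos i')
  have key : ∀ j, ENNReal.ofReal (dens s μ j ^ p * mass μ j) ≤ ∑' i, c * (g i * h j i) := by
    intro j
    rcases (mass_nonneg μ j).eq_or_lt with h0 | hj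
    · simp [← h0]
    obtain ⟨i, hi, hle⟩ := exists_isDominant hε μ hΛ j hj
    refine le_trans ?_ (ENNReal.le_tsum i)
    have hdj : 0 < dens s μ j := div_pos hj (Real.rpow_pos_of_pos (rad_pos j) _)
    have hdi : 0 < dens s μ i := div_pos hi.1 (Real.rpow_pos_of_pos (rad_pos i) _)
    simp only [hg, hh, hc]
    rw [indicator_of_mem (show i ∈ {i | IsDominant s ε μ i} from hi),
      ← ENNReal.ofReal_mul (mul_nonneg (Real.rpow_nonneg hdi.le _) hi.1.le),
      ← ENNReal.ofReal_mul (by positivity)]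
    apply ENNReal.ofReal_le_ofReal
    set H := hypRatio (node j) (rad j) (node i : E d) (rad i) with hHdef
    have hH1 : 1 ≤ H := hH j i
    have hH0 : 0 < H := by linarith
    have hri := rad_pos i
    have hrj := rad_pos j
    have e1 : rad j ^ s ≤ H ^ s * rad i ^ s := by
      rw [← Real.mul_rpow hH0.le hri.le]
      apply Real.rpow_le_rpow hrj.le _ hs.le
      rw [← div_le_iff₀ hri]
      exact div_le_hypRatio _ _ hrj hri
    have e2 : dens s μ j ^ (p + 1) ≤
        (2 * 4 ^ ε) ^ (p + 1) * dens s μ i ^ (p + 1) * H ^ (-(ε * (p + 1))) := by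
      refine (Real.rpow_le_rpow hdj.le hle (by linarith)).trans_eq ?_
      rw [Real.mul_rpow (by positivity) (by positivity), Real.mul_rpow (by positivity) hdi.le,
        ← Real.rpow_mul hH0.le, neg_mul]
    have e3 : H ^ (-(ε * (p + 1))) * H ^ s ≤ (H ^ (2 * d + 1))⁻¹ := by
      rw [← Real.rpow_natCast, ← Real.rpow_neg hH0.le, ← Real.rpow_add hH0]
      apply Real.rpow_le_rpow_of_exponent_le hH1
      push_cast
      linarith
    calc dens s μ j ^ p * mass μ j = dens s μ j ^ (p + 1) * rad j ^ s := by
          rw [mass_eq_dens_mul s, Real.rpow_add_one hdj.ne']; ring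
      _ ≤ ((2 * 4 ^ ε) ^ (p + 1) * dens s μ i ^ (p + 1) * H ^ (-(ε * (p + 1)))) *
          (H ^ s * rad i ^ s) := by gcongr
      _ = ((2 * 4 ^ ε) ^ (p + 1) * dens s μ i ^ (p + 1) * rad i ^ s) *
          (H ^ (-(ε * (p + 1))) * H ^ s) := by ring
      _ ≤ ((2 * 4 ^ ε) ^ (p + 1) * dens s μ i ^ (p + 1) * rad i ^ s) *
          (H ^ (2 * d + 1))⁻¹ := by gcongr
      _ = _ := by
          rw [mass_eq_dens_mul s μ i, Real.rpow_add_one hdi.ne']; ring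
  calc _ ≤ ∑' j, ∑' i, c * (g i * h j i) := ENNReal.tsum_le_tsum key
    _ = ∑' i, ∑' j, c * (g i * h j i) := ENNReal.tsum_comm
    _ ≤ ∑' i, c * (g i * C) := by
      refine ENNReal.tsum_le_tsum fun i => ?_
      rw [ENNReal.tsum_mul_left, ENNReal.tsum_mul_left]
      gcongr
      exact hC _ _ (rad_pos i)
    _ = _ := by
      rw [ENNReal.tsum_mul_left, ENNReal.tsum_mul_right, ENNReal.coe_mul]
      change _ = C * c * _
      ring

/-- The density bounds for a dominant lattice ball hold for all balls, up to a constant. -/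
lemma IsDominant.measureReal_ball_le {d : ℕ} {s ε : ℝ} (hs : 0 < s) (hε : 0 < ε) (hε1 : ε ≤ 1)
    {μ : Measure (E d)} [IsFiniteMeasure μ] {j : LatticeIndex d} (hj : IsDominant s ε μ j)
    (y : E d) {t : ℝ} (ht : 0 < t) :
    μ.real (Metric.ball y t) ≤ (2 * (d + 1)) ^ s * (16 * (d + 1)) *
      hypRatio (node j) (rad j) y t ^ ε * dens s μ j * t ^ s := by
  obtain ⟨k, h1, h2⟩ := exists_two_zpow t ht
  obtain ⟨z, hz⟩ := exists_dist_node_le k y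
  have h3 := density_le_dens hs μ hz h2.le h1
  have hk : (0 : ℝ) < 2 ^ k := by positivity
  have hd : (0 : ℝ) < d + 1 := by positivity
  have e1 : hypRatio y t (node (k, z)) (rad (k, z)) ≤ 8 * (d + 1) := by
    unfold hypRatio
    rw [div_le_iff₀ (mul_pos ht (rad_pos (k, z)))]
    have a1 : dist y (node (k, z)) + t + rad (k, z) ≤ 2 * ((d + 1) * (2 : ℝ) ^ k) := by
      simp only [rad]; linarith
    have a0 : 0 ≤ dist y (node (k, z)) + t + rad (k, z) := by
      have := rad_pos (k, z); positivity
    calc (dist y (node (k, z)) + t + rad (k, z)) ^ 2 ≤ (2 * ((d + 1) * (2 : ℝ) ^ k)) ^ 2 := by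
          gcongr
      _ = 4 * (d + 1) * ((d + 1) * (2 : ℝ) ^ k) * (2 : ℝ) ^ k := by ring
      _ ≤ 4 * (d + 1) * ((d + 1) * (2 : ℝ) ^ k) * (2 * t) := by gcongr
      _ = _ := by simp only [rad]; ring
  have p1 := hypRatio_pos (node j) y (rad_pos j) ht
  have p2 := hypRatio_pos y (node (k, z)) ht (rad_pos (k, z))
  have p3 := hypRatio_pos (node j) (node (k, z)) (rad_pos j) (rad_pos (k, z))
  have e2 : hypRatio (node j) (rad j) (node (k, z)) (rad (k, z)) ^ ε ≤
      hypRatio (node j) (rad j) y t ^ ε * (8 * (d + 1)) := by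
    calc _ ≤ (hypRatio (node j) (rad j) y t * hypRatio y t (node (k, z)) (rad (k, z))) ^ ε :=
          Real.rpow_le_rpow p3.le (hypRatio_triangle _ _ _ (rad_pos j) ht (rad_pos (k, z))) hε.le
      _ = hypRatio (node j) (rad j) y t ^ ε * hypRatio y t (node (k, z)) (rad (k, z)) ^ ε :=
          Real.mul_rpow p1.le p2.le
      _ ≤ hypRatio (node j) (rad j) y t ^ ε * hypRatio y t (node (k, z)) (rad (k, z)) ^ (1 : ℝ) := by
          gcongr
          exact one_le_hypRatio _ _ ht (rad_pos (k, z))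
      _ ≤ _ := by rw [Real.rpow_one]; gcongr
  have hdj := dens_nonneg s μ j
  calc _ ≤ _ := h3
    _ ≤ (2 * (d + 1)) ^ s * (2 * (hypRatio (node j) (rad j) y t ^ ε * (8 * (d + 1))) *
        dens s μ j) * t ^ s := by
        gcongr
        refine (hj.2 (k, z)).trans ?_
        gcongr
    _ = _ := by ring

/-! ### Integrals of powers of the distance against measures of polynomial growth -/

/-- The constant in the bounds for integrals of `dist x y ^ (-b)` against measures of growth `σ`. -/
noncomputable def shellConst (b σ : ℝ) : ℝ :=
  2 ^ |b| * 2 ^ σ * (1 - (2 : ℝ) ^ (-|σ - b|))⁻¹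

lemma two_rpow_neg_abs_lt_one {b σ : ℝ} (h : σ ≠ b) : (2 : ℝ) ^ (-|σ - b|) < 1 :=
  Real.rpow_lt_one_of_one_lt_of_neg one_lt_two (by simpa [sub_eq_zero] using h)

lemma shellConst_pos {b σ : ℝ} (h : σ ≠ b) : 0 < shellConst b σ := by
  have := two_rpow_neg_abs_lt_one h
  unfold shellConst
  have : 0 < 1 - (2 : ℝ) ^ (-|σ - b|) := by linarith
  positivity

/-- The contribution of the dyadic shell `ρ ≤ dist x y < 2 ρ`. -/
lemma lintegral_shell_le {d : ℕ} {μ : Measure (E d)} {x : E d} {b σ Λ ρ : ℝ} (hρ : 0 < ρ)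
    (h : μ (Metric.ball x (2 * ρ)) ≤ ENNReal.ofReal (Λ * (2 * ρ) ^ σ)) :
    ∫⁻ y in {y | ρ ≤ dist x y ∧ dist x y < 2 * ρ}, ENNReal.ofReal (dist x y ^ (-b)) ∂μ ≤
      ENNReal.ofReal (2 ^ |b| * 2 ^ σ * (Λ * ρ ^ (σ - b))) := by
  have hm : MeasurableSet {y | ρ ≤ dist x y ∧ dist x y < 2 * ρ} := by
    apply MeasurableSet.inter
    · exact measurableSet_le measurable_const (measurable_const.dist measurable_id)
    · exact measurableSet_lt (measurable_const.dist measurable_id) measurable_const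
  calc _ ≤ ∫⁻ _y in {y | ρ ≤ dist x y ∧ dist x y < 2 * ρ},
        ENNReal.ofReal (2 ^ |b| * ρ ^ (-b)) ∂μ := by
        refine setLIntegral_mono' hm fun y hy => ENNReal.ofReal_le_ofReal ?_
        have hy0 : 0 < dist x y := hρ.trans_le hy.1
        have e : dist x y ^ (-b) = (dist x y / ρ) ^ (-b) * ρ ^ (-b) := by
          rw [← Real.mul_rpow (by positivity) hρ.le, div_mul_cancel₀ _ hρ.ne']
        rw [e]
        gcongr
        have h1 : 1 ≤ dist x y / ρ := by rw [le_div_iff₀ hρ]; linarith [hy.1]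
        have h2 : dist x y / ρ ≤ 2 := by rw [div_le_iff₀ hρ]; linarith [hy.2]
        calc (dist x y / ρ) ^ (-b) ≤ (dist x y / ρ) ^ |b| :=
              Real.rpow_le_rpow_of_exponent_le h1 (neg_le_abs b)
          _ ≤ 2 ^ |b| := by gcongr
    _ ≤ ENNReal.ofReal (2 ^ |b| * ρ ^ (-b)) * ENNReal.ofReal (Λ * (2 * ρ) ^ σ) := by
        rw [lintegral_const, Measure.restrict_apply_univ]
        gcongr
        refine (measure_mono fun y hy => ?_).trans h
        rw [Metric.mem_ball, dist_comm]
        exact hy.2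
    _ = _ := by
        rw [← ENNReal.ofReal_mul (by positivity), Real.mul_rpow zero_le_two hρ.le, sub_eq_add_neg,
          Real.rpow_add hρ]
        congr 1
        ring

/-- Summation of the shell bounds, for radii `ρ' n` for which they decay geometrically: decreasing
if `b < σ` and increasing if `σ < b`. -/
lemma tsum_geometric_shell_le {b σ Λ ρ : ℝ} (hΛ : 0 ≤ Λ) (hρ : 0 < ρ) (h : σ ≠ b) (ρ' : ℕ → ℝ)
    (hρ' : ∀ n, ρ' n ^ (σ - b) ≤ ((2 : ℝ) ^ (-|σ - b|)) ^ n * ρ ^ (σ - b)) :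
    ∑' n : ℕ, ENNReal.ofReal (2 ^ |b| * 2 ^ σ * (Λ * ρ' n ^ (σ - b))) ≤
      ENNReal.ofReal (shellConst b σ * (Λ * ρ ^ (σ - b))) := by
  set q := (2 : ℝ) ^ (-|σ - b|) with hq
  have hq0 : 0 ≤ q := by positivity
  have hq1 : q < 1 := two_rpow_neg_abs_lt_one h
  have hs := (summable_geometric_of_lt_one hq0 hq1).mul_right
    (2 ^ |b| * 2 ^ σ * (Λ * ρ ^ (σ - b)))
  calc _ ≤ ∑' n : ℕ, ENNReal.ofReal (q ^ n * (2 ^ |b| * 2 ^ σ * (Λ * ρ ^ (σ - b)))) := by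
        refine ENNReal.tsum_le_tsum fun n => ENNReal.ofReal_le_ofReal ?_
        calc _ ≤ 2 ^ |b| * 2 ^ σ * (Λ * (q ^ n * ρ ^ (σ - b))) := by
              gcongr
              exact hρ' n
          _ = _ := by ring
    _ = _ := by
        rw [← ENNReal.ofReal_tsum_of_nonneg (fun n => by positivity) hs, tsum_mul_right,
          tsum_geometric_of_lt_one hq0 hq1, shellConst, ← hq]
        congr 1
        ring

lemma measure_singleton_eq_zero {d : ℕ} {μ : Measure (E d)} {x : E d} {σ Λ ρ : ℝ} (hσ : 0 < σ)
    (hρ : 0 < ρ)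
    (h : ∀ r, 0 < r → r ≤ ρ → μ (Metric.ball x r) ≤ ENNReal.ofReal (Λ * r ^ σ)) :
    μ {x} = 0 := by
  have ht : Tendsto (fun r : ℝ => ENNReal.ofReal (Λ * r ^ σ)) (𝓝[>] 0) (𝓝 0) := by
    have h1 : Tendsto (fun r : ℝ => Λ * r ^ σ) (𝓝 0) (𝓝 0) := by
      have := ((Real.continuousAt_rpow_const (0 : ℝ) σ (Or.inr hσ.le)).tendsto).const_mul Λ
      simpa [Real.zero_rpow hσ.ne'] using this
    simpa using (ENNReal.tendsto_ofReal h1).mono_left nhdsWithin_le_nhds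
  refine le_antisymm (ge_of_tendsto ht ?_) bot_le
  filter_upwards [Ioc_mem_nhdsGT hρ] with r hr
  refine (measure_mono ?_).trans (h r hr.1 hr.2)
  simpa using hr.1

/-- Local integrability of `dist x y ^ (-b)` for `b < σ`, with an explicit bound. -/
lemma lintegral_ball_dist_rpow_le {d : ℕ} {μ : Measure (E d)} {x : E d} {b σ Λ ρ : ℝ}
    (hΛ : 0 ≤ Λ) (hσ : 0 < σ) (hb : b < σ) (hρ : 0 < ρ)
    (h : ∀ r, 0 < r → r ≤ ρ → μ (Metric.ball x r) ≤ ENNReal.ofReal (Λ * r ^ σ)) :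
    ∫⁻ y in Metric.ball x ρ, ENNReal.ofReal (dist x y ^ (-b)) ∂μ ≤
      ENNReal.ofReal (shellConst b σ * (Λ * ρ ^ (σ - b))) := by
  have hx := measure_singleton_eq_zero hσ hρ h
  set ρ' : ℕ → ℝ := fun n => (1 / 2) ^ (n + 1) * ρ with hρ'
  have hcov : Metric.ball x ρ ⊆ {x} ∪ ⋃ n, {y | ρ' n ≤ dist x y ∧ dist x y < 2 * ρ' n} := by
    intro y hy
    by_cases hxy : y = x
    · exact Or.inl hxy
    right
    rw [Metric.mem_ball, dist_comm] at hy
    have hpos : 0 < dist x y := dist_pos.2 (Ne.symm hxy)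
    obtain ⟨n, h1, h2⟩ := exists_nat_pow_near_of_lt_one (y := (1 / 2 : ℝ))
      (show 0 < dist x y / ρ by positivity)
      (show dist x y / ρ ≤ 1 by rw [div_le_one hρ]; exact hy.le) (by norm_num) (by norm_num)
    rw [lt_div_iff₀ hρ] at h1
    rw [div_le_iff₀ hρ] at h2
    by_cases hlt : dist x y < 2 * ρ' n
    · exact mem_iUnion.2 ⟨n, h1.le, hlt⟩
    · have heq : dist x y = (1 / 2) ^ n * ρ := by
        have : 2 * ρ' n = (1 / 2) ^ n * ρ := by simp only [hρ', pow_succ]; ring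
        linarith
      rcases n with _ | n
      · simp at heq; linarith
      · refine mem_iUnion.2 ⟨n, heq.ge, ?_⟩
        have : 0 < ρ' n := by positivity
        rw [heq]; simp only [hρ'] at this ⊢; linarith
  calc _ ≤ ∫⁻ y in {x} ∪ ⋃ n, {y | ρ' n ≤ dist x y ∧ dist x y < 2 * ρ' n},
        ENNReal.ofReal (dist x y ^ (-b)) ∂μ := lintegral_mono_set hcov
    _ ≤ ∫⁻ y in {x}, ENNReal.ofReal (dist x y ^ (-b)) ∂μ +
        ∫⁻ y in ⋃ n, {y | ρ' n ≤ dist x y ∧ dist x y < 2 * ρ' n},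
          ENNReal.ofReal (dist x y ^ (-b)) ∂μ := lintegral_union_le _ _ _
    _ = ∫⁻ y in ⋃ n, {y | ρ' n ≤ dist x y ∧ dist x y < 2 * ρ' n},
          ENNReal.ofReal (dist x y ^ (-b)) ∂μ := by
        rw [setLIntegral_measure_zero _ _ hx, zero_add]
    _ ≤ ∑' n, ENNReal.ofReal (2 ^ |b| * 2 ^ σ * (Λ * ρ' n ^ (σ - b))) := by
        refine (lintegral_iUnion_le _ _).trans (ENNReal.tsum_le_tsum fun n => ?_)
        have hn : 0 < ρ' n := by positivity
        apply lintegral_shell_le hn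
        apply h _ (by positivity)
        have : (1 / 2 : ℝ) ^ n ≤ 1 := pow_le_one₀ (by norm_num) (by norm_num)
        simp only [hρ', pow_succ]
        nlinarith
    _ ≤ _ := by
        apply tsum_geometric_shell_le hΛ hρ hb.ne'
        intro n
        simp only [hρ']
        have hpos : 0 < σ - b := by linarith
        rw [Real.mul_rpow (by positivity) hρ.le, abs_of_pos hpos]
        gcongr
        calc ((1 / 2 : ℝ) ^ (n + 1)) ^ (σ - b) ≤ ((1 / 2 : ℝ) ^ n) ^ (σ - b) := by
              gcongr ?_ ^ _
              exact pow_le_pow_of_le_one (by norm_num) (by norm_num) n.le_succ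
          _ = _ := by
              rw [← Real.rpow_natCast, ← Real.rpow_natCast, ← Real.rpow_mul (by norm_num),
                ← Real.rpow_mul (by norm_num), one_div, Real.inv_rpow zero_le_two,
                ← Real.rpow_neg zero_le_two]
              ring_nf

/-- Integrability at infinity of `dist x y ^ (-b)` for `b > σ`, with an explicit bound. -/
lemma lintegral_compl_ball_dist_rpow_le {d : ℕ} {μ : Measure (E d)} {x : E d} {b σ Λ ρ : ℝ}
    (hΛ : 0 ≤ Λ) (hb : σ < b) (hρ : 0 < ρ)
    (h : ∀ r, ρ ≤ r → μ (Metric.ball x r) ≤ ENNReal.ofReal (Λ * r ^ σ)) :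
    ∫⁻ y in {y | ρ ≤ dist x y}, ENNReal.ofReal (dist x y ^ (-b)) ∂μ ≤
      ENNReal.ofReal (shellConst b σ * (Λ * ρ ^ (σ - b))) := by
  set ρ' : ℕ → ℝ := fun n => 2 ^ n * ρ with hρ'
  have hcov : {y | ρ ≤ dist x y} ⊆ ⋃ n, {y | ρ' n ≤ dist x y ∧ dist x y < 2 * ρ' n} := by
    intro y hy
    obtain ⟨n, h1, h2⟩ := exists_nat_pow_near (y := (2 : ℝ))
      (show 1 ≤ dist x y / ρ by rw [le_div_iff₀ hρ]; simpa using hy) (by norm_num)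
    rw [le_div_iff₀ hρ] at h1
    rw [div_lt_iff₀ hρ, pow_succ] at h2
    refine mem_iUnion.2 ⟨n, h1, ?_⟩
    simp only [hρ']
    linarith
  calc _ ≤ ∫⁻ y in ⋃ n, {y | ρ' n ≤ dist x y ∧ dist x y < 2 * ρ' n},
          ENNReal.ofReal (dist x y ^ (-b)) ∂μ := lintegral_mono_set hcov
    _ ≤ ∑' n, ENNReal.ofReal (2 ^ |b| * 2 ^ σ * (Λ * ρ' n ^ (σ - b))) := by
        refine (lintegral_iUnion_le _ _).trans (ENNReal.tsum_le_tsum fun n => ?_)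
        have hn : 0 < ρ' n := by positivity
        apply lintegral_shell_le hn
        apply h
        have : (1 : ℝ) ≤ 2 ^ n := one_le_pow₀ (by norm_num)
        simp only [hρ']
        nlinarith
    _ ≤ _ := by
        apply tsum_geometric_shell_le hΛ hρ hb.ne
        intro n
        simp only [hρ']
        have hneg : σ - b < 0 := by linarith
        rw [Real.mul_rpow (by positivity) hρ.le, abs_of_neg hneg, neg_neg]
        gcongr
        rw [← Real.rpow_natCast, ← Real.rpow_natCast, ← Real.rpow_mul (by norm_num),
          ← Real.rpow_mul (by norm_num), mul_comm]

lemma IsNiceWith.isLocallyFiniteMeasure {d : ℕ} {s Λ : ℝ} {μ : Measure (E d)}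
    (h : IsNiceWith s Λ μ) : IsLocallyFiniteMeasure μ :=
  ⟨fun x => ⟨Metric.ball x 1, Metric.ball_mem_nhds x one_pos,
    (h x 1 one_pos).trans_lt ENNReal.ofReal_lt_top⟩⟩

lemma IsNiceWith.restrict {d : ℕ} {s Λ : ℝ} {μ : Measure (E d)}
    (h : IsNiceWith s Λ μ) (S : Set (E d)) : IsNiceWith s Λ (μ.restrict S) :=
  fun x r hr => (Measure.restrict_apply_le S _).trans (h x r hr)

lemma IsNiceWith.lintegral_edist_rpow_le {d : ℕ} {s Λ : ℝ} (hs : 0 < s) (hΛ : 0 ≤ Λ)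
    {μ : Measure (E d)} (h : IsNiceWith s Λ μ) (x : E d) {ρ : ℝ} (hρ : 0 < ρ) :
    ∫⁻ y in Metric.ball x ρ, edist x y ^ (1 - s) ∂μ ≤
      ENNReal.ofReal (shellConst (s - 1) s * (Λ * ρ)) := by
  have h0 : μ {x} = 0 := measure_singleton_eq_zero (Λ := Λ) hs one_pos fun r hr _ => h x r hr
  have h1 := lintegral_ball_dist_rpow_le (μ := μ) (x := x) (b := s - 1) hΛ hs (by linarith) hρ
    fun r hr _ => h x r hr
  rw [show s - (s - 1) = 1 by ring, Real.rpow_one] at h1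
  refine le_trans (le_of_eq (lintegral_congr_ae ?_)) h1
  apply ae_restrict_of_ae
  have : ∀ᵐ y ∂μ, y ∉ ({x} : Set (E d)) := measure_eq_zero_iff_ae_notMem.1 h0
  filter_upwards [this] with y hy
  have hpos : 0 < dist x y := dist_pos.2 (fun e => hy (by simp [e]))
  rw [edist_dist, ENNReal.ofReal_rpow_of_pos hpos, neg_sub]

lemma IsNiceWith.isDiffuse {d : ℕ} {s Λ : ℝ} (hs : 0 < s) (hΛ : 0 ≤ Λ) {μ : Measure (E d)}
    (h : IsNiceWith s Λ μ) : IsDiffuse s μ := by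
  have := h.isLocallyFiniteMeasure
  intro S hS
  obtain ⟨R, hR0, hR⟩ : ∃ R : ℝ, 0 < R ∧ S ⊆ Metric.ball (0 : E d × E d) R := by
    obtain ⟨R, hR0, hR⟩ := hS.isBounded.subset_ball_lt 0 (0 : E d × E d)
    exact ⟨R, hR0, hR⟩
  have hSR : S ⊆ Metric.ball (0 : E d) R ×ˢ Metric.ball (0 : E d) R := by
    intro z hz
    rw [ball_prod_same]
    exact hR hz
  refine (lintegral_mono_set hSR).trans_lt ?_
  rw [← Measure.prod_restrict, lintegral_prod _ (by fun_prop)]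
  calc _ ≤ ∫⁻ x in Metric.ball (0 : E d) R, ENNReal.ofReal (shellConst (s - 1) s * (Λ * (2 * R))) ∂μ := by
        refine setLIntegral_mono' Metric.isOpen_ball.measurableSet fun x hx => ?_
        refine le_trans (lintegral_mono_set ?_)
          (h.lintegral_edist_rpow_le hs hΛ x (show 0 < 2 * R by linarith))
        apply Metric.ball_subset_ball'
        rw [dist_comm]
        linarith [Metric.mem_ball.1 hx]
    _ < ⊤ := by
        rw [lintegral_const, Measure.restrict_apply_univ]
        exact ENNReal.mul_lt_top ENNReal.ofReal_lt_top measure_ball_lt_top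

lemma IsNiceWith.hasRestrictedGrowth {d : ℕ} {s α Λ : ℝ} (hα : 0 < α) (hΛ : 0 ≤ Λ)
    {μ : Measure (E d)} (h : IsNiceWith s Λ μ) : HasRestrictedGrowth s α μ := by
  have h1 := lintegral_compl_ball_dist_rpow_le (μ := μ) (x := 0) (b := s + α) (σ := s) hΛ
    (by linarith) one_pos fun r hr => h 0 r (by linarith)
  refine lt_of_le_of_lt ?_ (h1.trans_lt ENNReal.ofReal_lt_top)
  simp only [dist_zero_left]
  refine lintegral_mono fun x => ?_
  rw [Real.rpow_neg (norm_nonneg _), one_div]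

/-! ### Calderón–Zygmund kernels -/

section Kernel

variable {d m : ℕ} {s α : ℝ} {K : E d → V m}

lemma IsCZKernel.continuousOn (hK : IsCZKernel s α K) (hα : 0 < α) :
    ContinuousOn K {0}ᶜ := by
  obtain ⟨C, hC⟩ := hK.holder
  have h1 : ContinuousOn (fun x : E d => ‖x‖ ^ (s + α) • K x) {0}ᶜ := by
    intro x hx
    rw [ContinuousWithinAt, tendsto_iff_norm_sub_tendsto_zero]
    have h2 : Tendsto (fun y : E d => C * ‖y - x‖ ^ α) (𝓝[{0}ᶜ] x) (𝓝 0) := by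
      have h3 : Continuous fun y : E d => C * ‖y - x‖ ^ α :=
        continuous_const.mul ((continuous_id.sub continuous_const).norm.rpow_const
          fun _ => Or.inr hα.le)
      have := (h3.tendsto x).mono_left (nhdsWithin_le_nhds (s := {0}ᶜ))
      simpa [Real.zero_rpow hα.ne'] using this
    refine squeeze_zero' (Eventually.of_forall fun _ => norm_nonneg _) ?_ h2
    filter_upwards [self_mem_nhdsWithin] with y hy
    exact hC y x hy hx
  have h2 : ContinuousOn (fun x : E d => ‖x‖ ^ (-(s + α))) {0}ᶜ := by
    intro x hx
    apply ContinuousAt.continuousWithinAt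
    exact continuous_norm.continuousAt.rpow_const (Or.inl (norm_ne_zero_iff.2 hx))
  refine (h2.smul h1).congr fun x hx => ?_
  have hx' : 0 < ‖x‖ := norm_pos_iff.2 hx
  change K x = ‖x‖ ^ (-(s + α)) • ‖x‖ ^ (s + α) • K x
  rw [smul_smul, ← Real.rpow_add hx', neg_add_cancel, Real.rpow_zero, one_smul]

lemma IsCZKernel.measurable (hK : IsCZKernel s α K) (hα : 0 < α) : Measurable K :=
  measurable_of_continuousOn_compl_singleton 0 (hK.continuousOn hα)

lemma regKernel_eq_of_le {δ : ℝ} {x : E d} (hδ : 0 < δ) (h : δ ≤ ‖x‖) :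
    regKernel s α K δ x = K x := by
  rw [regKernel, max_eq_left h, div_self (hδ.trans_le h).ne', Real.one_rpow, one_smul]

lemma regKernel_zero (hs : 0 < s) (hα : 0 < α) (δ : ℝ) : regKernel s α K δ 0 = 0 := by
  rw [regKernel, norm_zero, zero_div, Real.zero_rpow (by linarith), zero_smul]

lemma norm_regKernel_le (hs : 0 < s) (hα : 0 < α) {δ : ℝ} (hδ : 0 < δ) (x : E d) :
    ‖regKernel s α K δ x‖ ≤ ‖K x‖ := by
  rw [regKernel, norm_smul]
  apply mul_le_of_le_one_left (norm_nonneg _)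
  have h1 : 0 < max ‖x‖ δ := lt_max_of_lt_right hδ
  rw [Real.norm_of_nonneg (by positivity)]
  apply Real.rpow_le_one (by positivity) _ (by linarith)
  rw [div_le_one h1]
  exact le_max_left _ _

lemma IsCZKernel.norm_regKernel_le (hK : IsCZKernel s α K) (hs : 0 < s) (hα : 0 < α) {δ : ℝ}
    (hδ : 0 < δ) (x : E d) : ‖regKernel s α K δ x‖ ≤ (‖x‖ / δ) ^ α * δ ^ (-s) := by
  by_cases hx : x = 0
  · subst hx
    rw [regKernel_zero hs hα, norm_zero]
    positivity
  have hx' : 0 < ‖x‖ := norm_pos_iff.2 hx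
  have hm : 0 < max ‖x‖ δ := lt_max_of_lt_right hδ
  calc ‖regKernel s α K δ x‖ ≤ (‖x‖ / max ‖x‖ δ) ^ (s + α) * (1 / ‖x‖ ^ s) := by
        rw [regKernel, norm_smul, Real.norm_of_nonneg (by positivity)]
        gcongr
        exact hK.norm_le x hx
    _ ≤ (‖x‖ / δ) ^ (s + α) * (1 / ‖x‖ ^ s) := by
        gcongr
        exact le_max_right _ _
    _ = _ := by
        rw [Real.rpow_add (by positivity), Real.div_rpow hx'.le hδ.le, Real.rpow_neg hδ.le]
        have := Real.rpow_pos_of_pos hx' s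
        field_simp

lemma IsCZKernel.norm_regKernel_le' (hK : IsCZKernel s α K) (hs : 0 < s) (hα : 0 < α) {δ : ℝ}
    (hδ : 0 < δ) (x : E d) : ‖regKernel s α K δ x‖ ≤ (max ‖x‖ δ) ^ (-s) := by
  rcases le_total δ ‖x‖ with h | h
  · rw [regKernel_eq_of_le hδ h, max_eq_left h]
    refine (hK.norm_le x (norm_pos_iff.1 (hδ.trans_le h))).trans_eq ?_
    rw [Real.rpow_neg (norm_nonneg _), one_div]
  · rw [max_eq_right h]
    refine (hK.norm_regKernel_le hs hα hδ x).trans ?_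
    apply mul_le_of_le_one_left (by positivity)
    exact Real.rpow_le_one (by positivity) ((div_le_one hδ).2 h) hα.le

lemma IsCZKernel.continuous_regKernel (hK : IsCZKernel s α K) (hs : 0 < s) (hα : 0 < α) {δ : ℝ}
    (hδ : 0 < δ) : Continuous (regKernel s α K δ) := by
  rw [continuous_iff_continuousAt]
  intro x
  by_cases hx : x = 0
  · subst hx
    rw [ContinuousAt, regKernel_zero hs hα, tendsto_zero_iff_norm_tendsto_zero]
    have h3 : Continuous fun y : E d => (‖y‖ / δ) ^ α * δ ^ (-s) :=
      ((continuous_norm.div_const δ).rpow_const fun _ => Or.inr hα.le).mul continuous_const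
    have h4 := h3.tendsto 0
    simp only [norm_zero, zero_div, Real.zero_rpow hα.ne', zero_mul] at h4
    exact squeeze_zero (fun _ => norm_nonneg _) (fun y => hK.norm_regKernel_le hs hα hδ y) h4
  · have h1 : ContinuousAt K x :=
      (hK.continuousOn hα).continuousAt (isOpen_compl_singleton.mem_nhds hx)
    change ContinuousAt (fun x => (‖x‖ / max ‖x‖ δ) ^ (s + α) • K x) x
    suffices h : ContinuousAt (fun x : E d => (‖x‖ / max ‖x‖ δ) ^ (s + α)) x from h.smul h1
    refine ContinuousAt.rpow_const ?_ (Or.inr (by linarith))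
    refine continuous_norm.continuousAt.div ?_ (lt_max_of_lt_right hδ).ne'
    exact (continuous_norm.max continuous_const).continuousAt

lemma IsCZKernel.regKernel_neg (hK : IsCZKernel s α K) (hs : 0 < s) (hα : 0 < α) (δ : ℝ)
    (x : E d) : regKernel s α K δ (-x) = -regKernel s α K δ x := by
  by_cases hx : x = 0
  · simp [hx, regKernel_zero hs hα]
  · rw [regKernel, regKernel, norm_neg, hK.odd x hx, smul_neg]

lemma abs_rpow_neg_sub_one_le {β u : ℝ} (hβ : 0 < β) (hu : 1 / 2 ≤ u) :
    |u ^ (-β) - 1| ≤ β * (1 / 2) ^ (-β - 1) * |u - 1| := by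
  have h : ∀ x ∈ Ici (1 / 2 : ℝ), HasDerivWithinAt (fun x : ℝ => x ^ (-β)) (-β * x ^ (-β - 1))
      (Ici (1 / 2)) x := fun x hx =>
    (Real.hasDerivAt_rpow_const (Or.inl (by
      have : (1 / 2 : ℝ) ≤ x := hx
      linarith))).hasDerivWithinAt
  have := Convex.norm_image_sub_le_of_norm_hasDerivWithin_le (C := β * (1 / 2) ^ (-β - 1)) h ?_
    (convex_Ici _) (show (1 : ℝ) ∈ Ici (1 / 2 : ℝ) by norm_num) (show u ∈ Ici (1 / 2 : ℝ) from hu)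
  · simpa using this
  · intro x hx
    have hx' : (1 / 2 : ℝ) ≤ x := hx
    rw [norm_mul, norm_neg, Real.norm_of_nonneg hβ.le,
      Real.norm_of_nonneg (Real.rpow_nonneg (by linarith) _)]
    gcongr β * ?_
    exact Real.rpow_le_rpow_of_nonpos (by norm_num) hx' (by linarith)

/-- The Hölder regularity of a Calderón–Zygmund kernel away from the origin. -/
lemma IsCZKernel.exists_norm_sub_le (hK : IsCZKernel s α K) (hs : 0 < s) (hα : 0 < α)
    (hα1 : α ≤ 1) : ∃ C : ℝ, 0 ≤ C ∧ ∀ x y : E d, x ≠ 0 → 2 * ‖y‖ ≤ ‖x‖ →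
      ‖K (x - y) - K x‖ ≤ C * ‖y‖ ^ α * ‖x‖ ^ (-(s + α)) := by
  obtain ⟨C0, hC0⟩ := hK.holder
  have hβ : 0 < s + α := by linarith
  refine ⟨2 ^ (s + α) * |C0| + (s + α) * (1 / 2) ^ (-(s + α) - 1), by positivity,
    fun x y hx hxy => ?_⟩
  have hx' : 0 < ‖x‖ := norm_pos_iff.2 hx
  have h1 : ‖x‖ / 2 ≤ ‖x - y‖ := by
    have := norm_sub_norm_le x y
    linarith
  have hxy' : 0 < ‖x - y‖ := by linarith
  have hxy0 : x - y ≠ 0 := norm_pos_iff.1 hxy'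
  set β := s + α with hβdef
  set G : E d → V m := fun x => ‖x‖ ^ β • K x with hG
  have hKG : ∀ w : E d, w ≠ 0 → K w = ‖w‖ ^ (-β) • G w := by
    intro w hw
    simp only [hG, smul_smul]
    rw [← Real.rpow_add (norm_pos_iff.2 hw), neg_add_cancel, Real.rpow_zero, one_smul]
  have hGx : ‖G x‖ ≤ ‖x‖ ^ α := by
    rw [hG, norm_smul, Real.norm_of_nonneg (by positivity)]
    calc _ ≤ ‖x‖ ^ β * (1 / ‖x‖ ^ s) := by gcongr; exact hK.norm_le x hx
      _ = _ := by
        rw [hβdef, Real.rpow_add hx']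
        have := Real.rpow_pos_of_pos hx' s
        field_simp
  have e : K (x - y) - K x = ‖x - y‖ ^ (-β) • (G (x - y) - G x) +
      (‖x - y‖ ^ (-β) - ‖x‖ ^ (-β)) • G x := by
    rw [hKG _ hxy0, hKG _ hx, smul_sub, sub_smul]
    abel
  have b1 : ‖‖x - y‖ ^ (-β) • (G (x - y) - G x)‖ ≤
      2 ^ β * |C0| * ‖y‖ ^ α * ‖x‖ ^ (-β) := by
    rw [norm_smul, Real.norm_of_nonneg (by positivity)]
    have a1 : ‖x - y‖ ^ (-β) ≤ 2 ^ β * ‖x‖ ^ (-β) := by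
      calc ‖x - y‖ ^ (-β) ≤ (‖x‖ / 2) ^ (-β) :=
            Real.rpow_le_rpow_of_nonpos (by positivity) h1 (by linarith)
        _ = _ := by
          rw [Real.div_rpow hx'.le zero_le_two, Real.rpow_neg zero_le_two, div_inv_eq_mul, mul_comm]
    have a2 : ‖G (x - y) - G x‖ ≤ |C0| * ‖y‖ ^ α := by
      refine (hC0 _ _ hxy0 hx).trans ?_
      rw [show x - y - x = -y by abel, norm_neg]
      gcongr
      exact le_abs_self _
    calc _ ≤ (2 ^ β * ‖x‖ ^ (-β)) * (|C0| * ‖y‖ ^ α) := by gcongr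
      _ = _ := by ring
  have b2 : ‖(‖x - y‖ ^ (-β) - ‖x‖ ^ (-β)) • G x‖ ≤
      β * (1 / 2) ^ (-β - 1) * ‖y‖ ^ α * ‖x‖ ^ (-β) := by
    have a0 : (‖x - y‖ / ‖x‖) ^ (-β) * ‖x‖ ^ (-β) = ‖x - y‖ ^ (-β) := by
      rw [← Real.mul_rpow (by positivity) hx'.le, div_mul_cancel₀ _ hx'.ne']
    have a1 := abs_rpow_neg_sub_one_le (β := β) (u := ‖x - y‖ / ‖x‖) hβ (by
      rw [le_div_iff₀ hx']; linarith)
    have a2 : |‖x - y‖ / ‖x‖ - 1| ≤ ‖y‖ / ‖x‖ := by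
      have : ‖x - y‖ / ‖x‖ - 1 = (‖x - y‖ - ‖x‖) / ‖x‖ := by field_simp
      rw [this, abs_div, abs_of_pos hx']
      gcongr
      have := abs_norm_sub_norm_le (x - y) x
      rwa [show x - y - x = -y by abel, norm_neg] at this
    have a3 : ‖y‖ / ‖x‖ ≤ (‖y‖ / ‖x‖) ^ α := by
      apply Real.self_le_rpow_of_le_one (by positivity) _ hα1
      rw [div_le_one hx']; linarith [norm_nonneg y]
    rw [norm_smul]
    calc _ = |(‖x - y‖ / ‖x‖) ^ (-β) - 1| * ‖x‖ ^ (-β) * ‖G x‖ := by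
          rw [← a0, Real.norm_eq_abs, ← sub_one_mul, abs_mul,
            abs_of_pos (Real.rpow_pos_of_pos hx' _)]
      _ ≤ (β * (1 / 2) ^ (-β - 1) * (‖y‖ / ‖x‖) ^ α) * ‖x‖ ^ (-β) * ‖x‖ ^ α := by
          gcongr
          refine a1.trans ?_
          gcongr
          exact a2.trans a3
      _ = _ := by
          rw [Real.div_rpow (norm_nonneg _) hx'.le]
          have := Real.rpow_pos_of_pos hx' α
          field_simp
  rw [e]
  refine (norm_add_le _ _).trans ((add_le_add b1 b2).trans_eq ?_)
  ring

end Kernel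

/-! ### Compactly supported Lipschitz functions -/

section LipZero

variable {d : ℕ}

lemma IsLipZero.continuous {f : E d → ℂ} (hf : IsLipZero f) : Continuous f := by
  obtain ⟨⟨L, hL⟩, -⟩ := hf
  exact hL.continuous

lemma IsLipZero.exists_bound {f : E d → ℂ} (hf : IsLipZero f) :
    ∃ M : ℝ, 0 ≤ M ∧ ∀ x, ‖f x‖ ≤ M := by
  obtain ⟨C, hC⟩ := hf.2.exists_bound_of_continuous hf.continuous
  exact ⟨max C 0, le_max_right _ _, fun x => (hC x).trans (le_max_left _ _)⟩

lemma IsLipZero.exists_radius {f : E d → ℂ} (hf : IsLipZero f) :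
    ∃ R : ℝ, 0 < R ∧ tsupport f ⊆ Metric.ball 0 R := by
  obtain ⟨R, h0, hR⟩ := hf.2.isCompact.isBounded.subset_ball_lt 0 (0 : E d)
  exact ⟨R, h0, hR⟩

lemma isLipZero_of_bounds {f : E d → ℂ} {L : ℝ} (hL : ∀ x y, ‖f x - f y‖ ≤ L * dist x y) {R : ℝ}
    (hR : ∀ x, f x ≠ 0 → x ∈ Metric.ball (0 : E d) R) : IsLipZero f := by
  refine ⟨⟨Real.toNNReal L, LipschitzWith.of_dist_le_mul fun x y => ?_⟩, ?_⟩
  · rw [dist_eq_norm]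
    refine (hL x y).trans ?_
    gcongr
    exact Real.le_coe_toNNReal L
  · refine HasCompactSupport.of_support_subset_isCompact (isCompact_closedBall (0 : E d) R) ?_
    exact fun x hx => Metric.ball_subset_closedBall (hR x hx)

lemma IsLipZero.exists_lipschitz {f : E d → ℂ} (hf : IsLipZero f) :
    ∃ L : ℝ, 0 ≤ L ∧ ∀ x y, ‖f x - f y‖ ≤ L * dist x y := by
  obtain ⟨⟨L, hL⟩, -⟩ := hf
  refine ⟨L, L.2, fun x y => ?_⟩
  rw [← dist_eq_norm]
  exact hL.dist_le_mul x y

lemma IsLipZero.eq_zero_of_notMem {f : E d → ℂ} {S : Set (E d)} (hf : tsupport f ⊆ S) {x : E d}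
    (hx : x ∉ S) : f x = 0 :=
  image_eq_zero_of_notMem_tsupport fun h => hx (hf h)

lemma IsLipZero.const_mul {f : E d → ℂ} (hf : IsLipZero f) (c : ℂ) :
    IsLipZero fun x => c * f x := by
  obtain ⟨L, hL0, hL⟩ := hf.exists_lipschitz
  obtain ⟨R, hR0, hR⟩ := hf.exists_radius
  refine isLipZero_of_bounds (L := ‖c‖ * L) (R := R) (fun x y => ?_) fun x hx => ?_
  · rw [← mul_sub, norm_mul, mul_assoc]
    gcongr
    exact hL x y
  · by_contra h
    exact hx (by simp [IsLipZero.eq_zero_of_notMem hR h])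

lemma IsLipZero.add {f g : E d → ℂ} (hf : IsLipZero f) (hg : IsLipZero g) :
    IsLipZero fun x => f x + g x := by
  refine ⟨?_, HasCompactSupport.add hf.2 hg.2⟩
  obtain ⟨⟨L, hL⟩, -⟩ := hf
  obtain ⟨⟨L', hL'⟩, -⟩ := hg
  exact ⟨_, hL.add hL'⟩

lemma IsLipZero.sub {f g : E d → ℂ} (hf : IsLipZero f) (hg : IsLipZero g) :
    IsLipZero fun x => f x - g x := by
  have := hf.add (hg.const_mul (-1))
  simpa [sub_eq_add_neg] using this

lemma isLipZero_finset_sum {ι : Type*} (F : Finset ι) (a : ι → ℂ) (f : ι → E d → ℂ)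
    (hf : ∀ j ∈ F, IsLipZero (f j)) : IsLipZero fun x => ∑ j ∈ F, a j * f j x := by
  classical
  induction F using Finset.induction_on with
  | empty =>
    simp only [Finset.sum_empty]
    exact ⟨⟨0, LipschitzWith.const 0⟩, HasCompactSupport.zero⟩
  | insert j F hj ih =>
    have h1 := (hf j (Finset.mem_insert_self _ _)).const_mul (a j)
    have h2 := h1.add (ih fun i hi => hf i (Finset.mem_insert_of_mem hi))
    refine (funext fun x => ?_ : (fun x => ∑ j ∈ insert j F, a j * f j x) = _) ▸ h2
    rw [Finset.sum_insert hj]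

/-- The radial cut-off function equal to `1` on `B(0, R)` and to `0` outside `B(0, 2R)`. -/
noncomputable def cutoff (d : ℕ) (R : ℝ) (x : E d) : ℝ := max 0 (min 1 (2 - ‖x‖ / R))

lemma cutoff_eq_one {R : ℝ} (hR : 0 < R) {x : E d} (hx : ‖x‖ ≤ R) : cutoff d R x = 1 := by
  have : ‖x‖ / R ≤ 1 := by rwa [div_le_one hR]
  rw [cutoff, min_eq_left (by linarith), max_eq_right zero_le_one]

lemma cutoff_eq_zero {R : ℝ} (hR : 0 < R) {x : E d} (hx : 2 * R ≤ ‖x‖) : cutoff d R x = 0 := by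
  have : 2 ≤ ‖x‖ / R := by rwa [le_div_iff₀ hR]
  rw [cutoff, max_eq_left]
  exact (min_le_right _ _).trans (by linarith)

lemma cutoff_nonneg (R : ℝ) (x : E d) : 0 ≤ cutoff d R x := le_max_left _ _

lemma cutoff_le_one (R : ℝ) (x : E d) : cutoff d R x ≤ 1 :=
  max_le zero_le_one (min_le_left _ _)

lemma abs_cutoff_sub_le {R : ℝ} (hR : 0 < R) (x y : E d) :
    |cutoff d R x - cutoff d R y| ≤ R⁻¹ * dist x y := by
  unfold cutoff
  rw [max_comm 0, max_comm 0]
  refine (abs_max_sub_max_le_abs _ _ _).trans ?_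
  refine (abs_min_sub_min_le_max _ _ _ _).trans ?_
  rw [sub_self, abs_zero, max_eq_right (abs_nonneg _)]
  rw [show 2 - ‖x‖ / R - (2 - ‖y‖ / R) = -(R⁻¹ * (‖x‖ - ‖y‖)) by ring, abs_neg, abs_mul,
    abs_of_pos (inv_pos.2 hR), dist_eq_norm]
  gcongr
  exact abs_norm_sub_norm_le x y

lemma continuous_cutoff {R : ℝ} : Continuous (cutoff d R) := by
  unfold cutoff; fun_prop

lemma isLipZero_cutoff {R : ℝ} (hR : 0 < R) : IsLipZero fun x : E d => (cutoff d R x : ℂ) := by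
  refine isLipZero_of_bounds (L := R⁻¹) (R := 2 * R) (fun x y => ?_) fun x hx => ?_
  · rw [← Complex.ofReal_sub, Complex.norm_real]
    exact abs_cutoff_sub_le hR x y
  · by_contra h
    rw [Metric.mem_ball, dist_zero_right, not_lt] at h
    exact hx (by simp [cutoff_eq_zero hR h])

lemma IsLipZero.integrable {f : E d → ℂ} (hf : IsLipZero f) (μ : Measure (E d))
    [IsLocallyFiniteMeasure μ] : Integrable f μ :=
  hf.continuous.integrable_of_hasCompactSupport hf.2

lemma IsLipZero.memLp {f : E d → ℂ} (hf : IsLipZero f) (μ : Measure (E d))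
    [IsLocallyFiniteMeasure μ] (p : ℝ≥0∞) : MemLp f p μ :=
  hf.continuous.memLp_of_hasCompactSupport hf.2

end LipZero

/-! ### The antisymmetric pairing -/

/-- The antisymmetric function `H_{f,φ}` in the definition of the pairing. -/
noncomputable def pairDensity {d : ℕ} (f φ : E d → ℂ) (z : E d × E d) : ℂ :=
  (1 / 2 : ℂ) * (f z.2 * φ z.1 - φ z.2 * f z.1)

/-- The transform `∫ K(x - y) f(y) dμ(y)`, meaningful away from the support of `f`. -/
noncomputable def transform {d m : ℕ} (K : E d → V m) (μ : Measure (E d)) (f : E d → ℂ)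
    (x : E d) : V m :=
  ∫ y, f y • K (x - y) ∂μ

section Pairing

variable {d m : ℕ} {s α : ℝ} {K : E d → V m} {μ : Measure (E d)}

lemma pairing_eq (K : E d → V m) (μ : Measure (E d)) (f φ : E d → ℂ) :
    pairing K μ f φ = ∫ z, pairDensity f φ z • K (z.1 - z.2) ∂(μ.prod μ) := rfl

lemma pairDensity_diag (f φ : E d → ℂ) (x : E d) : pairDensity f φ (x, x) = 0 := by
  simp [pairDensity, mul_comm]

lemma continuous_pairDensity {f φ : E d → ℂ} (hf : IsLipZero f) (hφ : IsLipZero φ) :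
    Continuous (pairDensity f φ) := by
  have := hf.continuous
  have := hφ.continuous
  unfold pairDensity
  fun_prop

lemma exists_pairDensity_bound {f φ : E d → ℂ} (hf : IsLipZero f) (hφ : IsLipZero φ) :
    ∃ L R : ℝ, 0 ≤ L ∧ 0 < R ∧ (∀ z, ‖pairDensity f φ z‖ ≤ L * dist z.1 z.2) ∧
      ∀ z, pairDensity f φ z ≠ 0 → z.1 ∈ Metric.ball 0 R ∧ z.2 ∈ Metric.ball 0 R := by
  obtain ⟨L, hL0, hL⟩ := hf.exists_lipschitz
  obtain ⟨M, hM0, hM⟩ := hf.exists_bound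
  obtain ⟨L', hL0', hL'⟩ := hφ.exists_lipschitz
  obtain ⟨M', hM0', hM'⟩ := hφ.exists_bound
  obtain ⟨R, hR0, hR⟩ := hf.exists_radius
  obtain ⟨R', hR0', hR'⟩ := hφ.exists_radius
  refine ⟨M * L' + M' * L, max R R', by positivity, lt_max_of_lt_left hR0, fun z => ?_,
    fun z hz => ?_⟩
  · have e : pairDensity f φ z = (1 / 2 : ℂ) *
        (f z.2 * (φ z.1 - φ z.2) - φ z.2 * (f z.1 - f z.2)) := by
      unfold pairDensity; ring
    have h12 : ‖(1 / 2 : ℂ)‖ ≤ 1 := by norm_num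
    rw [e, norm_mul]
    calc _ ≤ 1 * ‖f z.2 * (φ z.1 - φ z.2) - φ z.2 * (f z.1 - f z.2)‖ := by gcongr
      _ ≤ ‖f z.2‖ * ‖φ z.1 - φ z.2‖ + ‖φ z.2‖ * ‖f z.1 - f z.2‖ := by
        rw [one_mul, ← norm_mul, ← norm_mul]
        exact norm_sub_le _ _
      _ ≤ M * (L' * dist z.1 z.2) + M' * (L * dist z.1 z.2) := by
        gcongr
        · exact hM _
        · exact hL' _ _
        · exact hM' _
        · exact hL _ _
      _ = _ := by ring
  · have h1 : ∀ x, x ∉ Metric.ball (0 : E d) (max R R') → f x = 0 ∧ φ x = 0 := fun x hx =>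
      ⟨IsLipZero.eq_zero_of_notMem
        (hR.trans (Metric.ball_subset_ball (le_max_left _ _))) hx,
        IsLipZero.eq_zero_of_notMem
        (hR'.trans (Metric.ball_subset_ball (le_max_right _ _))) hx⟩
    constructor <;> by_contra h <;> exact hz (by simp [pairDensity, h1 _ h])

/-- An integrable majorant for the integrand of the pairing, valid for all kernels of size at most
`1 / |x - y| ^ s`. -/
lemma exists_pairing_majorant {f φ : E d → ℂ} (hf : IsLipZero f) (hφ : IsLipZero φ)
    (hμ : IsDiffuse s μ) :
    ∃ g : E d × E d → ℝ, Integrable g (μ.prod μ) ∧ ∀ (z : E d × E d) (v : V m),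
      (z.1 ≠ z.2 → ‖v‖ ≤ 1 / ‖z.1 - z.2‖ ^ s) → ‖pairDensity f φ z • v‖ ≤ g z := by
  obtain ⟨L, R, hL0, hR0, hL, hR⟩ := exists_pairDensity_bound hf hφ
  set S : Set (E d × E d) := Metric.closedBall 0 R ×ˢ Metric.closedBall 0 R with hS
  have hSc : IsCompact S := (isCompact_closedBall _ _).prod (isCompact_closedBall _ _)
  have hSm : MeasurableSet S := hSc.measurableSet
  refine ⟨S.indicator fun z => L * (edist z.1 z.2 ^ (1 - s)).toReal, ?_, fun z v hv => ?_⟩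
  · rw [integrable_indicator_iff hSm]
    apply Integrable.const_mul
    refine integrable_toReal_of_lintegral_ne_top ?_ (hμ S hSc).ne
    have : Measurable fun z : E d × E d => edist z.1 z.2 ^ (1 - s) := by fun_prop
    exact this.aemeasurable
  · by_cases h0 : pairDensity f φ z = 0
    · rw [h0, zero_smul, norm_zero]
      exact indicator_nonneg (fun _ _ => by positivity) z
    have hzS : z ∈ S := ⟨Metric.ball_subset_closedBall (hR z h0).1,
      Metric.ball_subset_closedBall (hR z h0).2⟩
    have hne : z.1 ≠ z.2 := by
      intro h
      apply h0
      have : z = (z.1, z.1) := Prod.ext rfl h.symm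
      rw [this, pairDensity_diag]
    have hpos : 0 < dist z.1 z.2 := dist_pos.2 hne
    rw [indicator_of_mem hzS, norm_smul, edist_dist, ENNReal.ofReal_rpow_of_pos hpos,
      ENNReal.toReal_ofReal (by positivity)]
    calc _ ≤ (L * dist z.1 z.2) * (1 / ‖z.1 - z.2‖ ^ s) := by
          gcongr
          · exact hL z
          · exact hv hne
      _ = _ := by
        rw [← dist_eq_norm, Real.rpow_sub hpos, Real.rpow_one]
        ring

lemma IsCZKernel.measurable_pairing_integrand (hK : IsCZKernel s α K) (hα : 0 < α)
    {f φ : E d → ℂ} (hf : IsLipZero f) (hφ : IsLipZero φ) :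
    Measurable fun z : E d × E d => pairDensity f φ z • K (z.1 - z.2) := by
  have h1 : Measurable fun z : E d × E d => K (z.1 - z.2) :=
    (hK.measurable hα).comp (by fun_prop)
  exact (continuous_pairDensity hf hφ).measurable.smul h1

lemma IsCZKernel.integrable_pairing (hK : IsCZKernel s α K) (hα : 0 < α)
    {f φ : E d → ℂ} (hf : IsLipZero f) (hφ : IsLipZero φ) (hμ : IsDiffuse s μ) :
    Integrable (fun z : E d × E d => pairDensity f φ z • K (z.1 - z.2)) (μ.prod μ) := by
  obtain ⟨g, hg, hle⟩ := exists_pairing_majorant (m := m) hf hφ hμ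
  refine hg.mono' (hK.measurable_pairing_integrand hα hf hφ).aestronglyMeasurable ?_
  exact Eventually.of_forall fun z => hle z _ fun hne => hK.norm_le _ (sub_ne_zero.2 hne)

lemma pairing_antisymm (K : E d → V m) (μ : Measure (E d)) (f φ : E d → ℂ) :
    pairing K μ φ f = -pairing K μ f φ := by
  rw [pairing_eq, pairing_eq, ← integral_neg]
  refine integral_congr_ae (Eventually.of_forall fun z => ?_)
  simp only [← neg_smul]
  congr 1
  unfold pairDensity
  ring

lemma IsCZKernel.pairing_finset_sum (hK : IsCZKernel s α K) (hα : 0 < α) (hμ : IsDiffuse s μ)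
    {ι : Type*} (F : Finset ι) (a : ι → ℂ) (f : ι → E d → ℂ) (hf : ∀ j ∈ F, IsLipZero (f j))
    {φ : E d → ℂ} (hφ : IsLipZero φ) :
    pairing K μ (fun x => ∑ j ∈ F, a j * f j x) φ = ∑ j ∈ F, a j • pairing K μ (f j) φ := by
  simp only [pairing_eq]
  simp_rw [← integral_smul]
  rw [← integral_finsetSum]
  · refine integral_congr_ae (Eventually.of_forall fun z => ?_)
    simp only [smul_smul, ← Finset.sum_smul]
    congr 1
    unfold pairDensity
    rw [Finset.sum_mul, Finset.mul_sum, ← Finset.sum_sub_distrib, Finset.mul_sum]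
    refine Finset.sum_congr rfl fun j _ => ?_
    ring
  · intro j hj
    exact (hK.integrable_pairing hα (hf j hj) hφ hμ).smul (a j)

lemma IsCZKernel.pairing_sub_mul (hK : IsCZKernel s α K) (hα : 0 < α) (hμ : IsDiffuse s μ)
    {f g φ : E d → ℂ} (hf : IsLipZero f) (hg : IsLipZero g) (hφ : IsLipZero φ) (c : ℂ) :
    pairing K μ (fun x => f x - c * g x) φ = pairing K μ f φ - c • pairing K μ g φ := by
  simp only [pairing_eq]
  have hsub := integral_sub (hK.integrable_pairing hα hf hφ hμ)
    ((hK.integrable_pairing hα hg hφ hμ).smul c)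
  simp only [Pi.smul_apply] at hsub
  rw [← integral_smul, ← hsub]
  refine integral_congr_ae (Eventually.of_forall fun z => ?_)
  simp only [smul_smul, ← sub_smul]
  congr 1
  unfold pairDensity
  ring

lemma IsCZKernel.pairing_sub_right (hK : IsCZKernel s α K) (hα : 0 < α) (hμ : IsDiffuse s μ)
    {f φ χ : E d → ℂ} (hf : IsLipZero f) (hφ : IsLipZero φ) (hχ : IsLipZero χ) :
    pairing K μ f (fun x => φ x - χ x) = pairing K μ f φ - pairing K μ f χ := by
  have := hK.pairing_sub_mul hα hμ hφ hχ hf 1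
  simp only [one_mul, one_smul] at this
  rw [← neg_inj, ← pairing_antisymm, this, pairing_antisymm K μ f φ, pairing_antisymm K μ f χ]
  abel

/-! #### Separated supports -/

lemma IsCZKernel.norm_kernel_le (hK : IsCZKernel s α K) (hs : 0 < s) {η : ℝ} (hη : 0 < η)
    {x : E d} (hx : η ≤ ‖x‖) : ‖K x‖ ≤ η ^ (-s) := by
  have hx0 : x ≠ 0 := norm_pos_iff.1 (hη.trans_le hx)
  refine (hK.norm_le x hx0).trans ?_
  rw [Real.rpow_neg hη.le, one_div]
  gcongr

lemma IsCZKernel.integrable_smul_kernel (hK : IsCZKernel s α K) (hs : 0 < s) (hα : 0 < α)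
    {f : E d → ℂ} (hf : Integrable f μ) {η : ℝ} (hη : 0 < η) {x : E d}
    (hx : ∀ y, f y ≠ 0 → η ≤ dist x y) :
    Integrable (fun y => f y • K (x - y)) μ := by
  refine (hf.norm.mul_const (η ^ (-s))).mono' ?_ (Eventually.of_forall fun y => ?_)
  · have h1 : Measurable fun y : E d => K (x - y) := (hK.measurable hα).comp (by fun_prop)
    exact hf.aestronglyMeasurable.smul h1.aestronglyMeasurable
  · by_cases hy : f y = 0
    · simp [hy]
    rw [norm_smul]
    gcongr
    exact hK.norm_kernel_le hs hη (by rw [← dist_eq_norm]; exact hx y hy)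

lemma IsCZKernel.norm_transform_le (hK : IsCZKernel s α K) (hs : 0 < s)
    {f : E d → ℂ} (hf : Integrable f μ) {η : ℝ} (hη : 0 < η) {x : E d}
    (hx : ∀ y, f y ≠ 0 → η ≤ dist x y) :
    ‖transform K μ f x‖ ≤ η ^ (-s) * ∫ y, ‖f y‖ ∂μ := by
  rw [← integral_const_mul]
  refine norm_integral_le_of_norm_le (hf.norm.const_mul _) (Eventually.of_forall fun y => ?_)
  by_cases hy : f y = 0
  · simp [hy]
  rw [norm_smul, mul_comm]
  gcongr
  exact hK.norm_kernel_le hs hη (by rw [← dist_eq_norm]; exact hx y hy)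

lemma IsCZKernel.stronglyMeasurable_transform [SFinite μ] (hK : IsCZKernel s α K) (hα : 0 < α)
    {f : E d → ℂ} (hf : Continuous f) : StronglyMeasurable (transform K μ f) := by
  have h1 : Measurable fun z : E d × E d => K (z.1 - z.2) :=
    (hK.measurable hα).comp (by fun_prop)
  have h2 : Measurable fun z : E d × E d => f z.2 • K (z.1 - z.2) :=
    (hf.measurable.comp measurable_snd).smul h1
  exact h2.stronglyMeasurable.integral_prod_right'

/-- For functions with separated supports the pairing is the integral of the transform. -/
lemma IsCZKernel.pairing_eq_integral_transform [IsLocallyFiniteMeasure μ]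
    (hK : IsCZKernel s α K) (hs : 0 < s) (hα : 0 < α)
    {f φ : E d → ℂ} (hf : IsLipZero f) (hφ : IsLipZero φ) {η : ℝ} (hη : 0 < η)
    (hsep : ∀ x y, f y ≠ 0 → φ x ≠ 0 → η ≤ dist x y) :
    Integrable (fun x => φ x • transform K μ f x) μ ∧
      pairing K μ f φ = ∫ x, φ x • transform K μ f x ∂μ := by
  set h : E d × E d → V m := fun z => (φ z.1 * f z.2) • K (z.1 - z.2) with hh
  have hint : Integrable h (μ.prod μ) := by
    have h0 := (hφ.integrable μ).mul_prod (hf.integrable μ)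
    refine (h0.norm.mul_const (η ^ (-s))).mono' ?_ (Eventually.of_forall fun z => ?_)
    · have h1 : Measurable fun z : E d × E d => K (z.1 - z.2) :=
        (hK.measurable hα).comp (by fun_prop)
      exact h0.aestronglyMeasurable.smul h1.aestronglyMeasurable
    · by_cases hz : φ z.1 * f z.2 = 0
      · simp [hh, hz]
      rw [hh, norm_smul]
      gcongr
      refine hK.norm_kernel_le hs hη ?_
      rw [← dist_eq_norm]
      exact hsep _ _ (right_ne_zero_of_mul hz) (left_ne_zero_of_mul hz)
  have e1 : ∀ z : E d × E d, pairDensity f φ z • K (z.1 - z.2) =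
      (1 / 2 : ℂ) • (h z + h z.swap) := by
    intro z
    simp only [hh, Prod.fst_swap, Prod.snd_swap]
    by_cases hne : z.1 = z.2
    · have h0 : φ z.2 * f z.2 = 0 := by
        by_contra hne'
        have := hsep z.2 z.2 (right_ne_zero_of_mul hne') (left_ne_zero_of_mul hne')
        rw [dist_self] at this
        linarith
      have h1 : pairDensity f φ z = 0 := by
        unfold pairDensity; rw [hne, mul_comm (f z.2)]; simp
      rw [h1, hne, h0]; simp
    · have hodd : K (z.2 - z.1) = -K (z.1 - z.2) := by
        rw [← hK.odd _ (sub_ne_zero.2 hne), neg_sub]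
      rw [hodd, smul_neg, ← sub_eq_add_neg, ← sub_smul, smul_smul]
      congr 1
      unfold pairDensity
      ring
  have hswap : Integrable (fun z : E d × E d => h z.swap) (μ.prod μ) := hint.swap
  have e2 : ∫ z, h z.swap ∂(μ.prod μ) = ∫ z, h z ∂(μ.prod μ) := integral_prod_swap h
  have e3 : ∀ x, ∫ y, h (x, y) ∂μ = φ x • transform K μ f x := by
    intro x
    rw [transform, ← integral_smul]
    simp only [hh, mul_smul]
  constructor
  · exact hint.integral_prod_left.congr (Eventually.of_forall e3)
  · rw [pairing_eq, integral_congr_ae (Eventually.of_forall e1), integral_smul,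
      integral_add hint hswap, e2, ← two_smul ℂ, smul_smul]
    norm_num
    rw [integral_prod _ hint]
    exact integral_congr_ae (Eventually.of_forall e3)

/-- Decay at infinity of the transform of a function of mean zero. -/
lemma IsCZKernel.exists_norm_transform_le (hK : IsCZKernel s α K) (hs : 0 < s) (hα : 0 < α)
    (hα1 : α ≤ 1) : ∃ C : ℝ, 0 ≤ C ∧ ∀ (μ : Measure (E d)) (f : E d → ℂ) (R : ℝ), 0 < R →
      Integrable f μ → (∀ y, f y ≠ 0 → ‖y‖ ≤ R) → ∫ y, f y ∂μ = 0 →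
      ∀ x, 2 * R ≤ ‖x‖ →
        ‖transform K μ f x‖ ≤ C * R ^ α * (∫ y, ‖f y‖ ∂μ) * ‖x‖ ^ (-(s + α)) := by
  obtain ⟨C, hC0, hC⟩ := hK.exists_norm_sub_le hs hα hα1
  refine ⟨C, hC0, fun μ f R hR hf hsupp hmean x hx => ?_⟩
  have hx0 : 0 < ‖x‖ := by linarith
  have hint : Integrable (fun y => f y • K (x - y)) μ := by
    refine hK.integrable_smul_kernel hs hα hf hR fun y hy => ?_
    rw [dist_eq_norm]
    linarith [hsupp y hy, norm_sub_norm_le x y]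
  have e : transform K μ f x = ∫ y, f y • (K (x - y) - K x) ∂μ := by
    simp_rw [smul_sub]
    rw [integral_sub hint (hf.smul_const _), integral_smul_const, hmean, zero_smul, sub_zero]
    rfl
  rw [e, mul_right_comm, ← integral_const_mul]
  refine norm_integral_le_of_norm_le (hf.norm.const_mul _) (Eventually.of_forall fun y => ?_)
  by_cases hy : f y = 0
  · simp [hy]
  have hyR := hsupp y hy
  rw [norm_smul]
  have := hC x y (norm_pos_iff.1 hx0) (by linarith)
  calc _ ≤ ‖f y‖ * (C * ‖y‖ ^ α * ‖x‖ ^ (-(s + α))) := by gcongr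
    _ ≤ ‖f y‖ * (C * R ^ α * ‖x‖ ^ (-(s + α))) := by gcongr
    _ = _ := by ring

lemma exists_le_dist_of_eventually_eq_one {f ψ : E d → ℂ} (hf : HasCompactSupport f)
    (hψ : ∀ᶠ x in 𝓝ˢ (tsupport f), ψ x = 1) :
    ∃ η : ℝ, 0 < η ∧ ∀ x y, f y ≠ 0 → ψ x ≠ 1 → η ≤ dist x y := by
  obtain ⟨U, hU, hfU, hU1⟩ := eventually_nhdsSet_iff_exists.1 hψ
  obtain ⟨η, hη, hsub⟩ := hf.isCompact.exists_thickening_subset_open hU hfU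
  refine ⟨η, hη, fun x y hy hx => ?_⟩
  by_contra hlt
  apply hx
  apply hU1 x
  apply hsub
  rw [Metric.mem_thickening_iff]
  exact ⟨y, subset_tsupport f hy, not_le.1 hlt⟩

lemma IsCZKernel.integrable_one_sub_smul_transform [IsLocallyFiniteMeasure μ]
    (hK : IsCZKernel s α K) (hs : 0 < s) (hα : 0 < α) (hα1 : α ≤ 1)
    (hμ : HasRestrictedGrowth s α μ) {f ψ : E d → ℂ} (hf : IsLipZero f) (hψ : IsLipZero ψ)
    (hmean : ∫ y, f y ∂μ = 0) {η : ℝ} (hη : 0 < η)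
    (hsep : ∀ x y, f y ≠ 0 → ψ x ≠ 1 → η ≤ dist x y) :
    Integrable (fun x => (1 - ψ x) • transform K μ f x) μ := by
  obtain ⟨C, hC0, hC⟩ := hK.exists_norm_transform_le hs hα hα1
  obtain ⟨R0, hR0, hfR⟩ := hf.exists_radius
  obtain ⟨M, hM0, hM⟩ := hψ.exists_bound
  have hsupp : ∀ y, f y ≠ 0 → ‖y‖ ≤ R0 := fun y hy => by
    have := hfR (subset_tsupport f hy)
    rw [Metric.mem_ball, dist_zero_right] at this
    exact this.le
  set I := ∫ y, ‖f y‖ ∂μ with hI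
  have hI0 : 0 ≤ I := integral_nonneg fun _ => norm_nonneg _
  set R := max 1 (2 * R0) with hR
  set g : E d → ℝ := fun x => (Metric.closedBall (0 : E d) R).indicator
      (fun _ => (1 + M) * (η ^ (-s) * I)) x +
    {x : E d | 1 ≤ ‖x‖}.indicator
      (fun x => ((1 + M) * (C * R0 ^ α * I)) * (1 / ‖x‖ ^ (s + α))) x with hg
  have hgint : Integrable g μ := by
    apply Integrable.add
    · rw [integrable_indicator_iff Metric.isClosed_closedBall.measurableSet]
      exact integrableOn_const measure_closedBall_lt_top.ne
    · have hm : MeasurableSet {x : E d | 1 ≤ ‖x‖} := measurableSet_le measurable_const measurable_norm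
      rw [integrable_indicator_iff hm]
      apply Integrable.const_mul
      refine ⟨?_, ?_⟩
      · have : Measurable fun x : E d => 1 / ‖x‖ ^ (s + α) := by fun_prop
        exact this.aestronglyMeasurable
      · rw [hasFiniteIntegral_iff_ofReal (Eventually.of_forall fun x => by positivity)]
        exact hμ
  refine hgint.mono' ?_ (Eventually.of_forall fun x => ?_)
  · exact (continuous_const.sub hψ.continuous).aestronglyMeasurable.smul
      (hK.stronglyMeasurable_transform hα hf.continuous).aestronglyMeasurable
  · have b1 : ‖1 - ψ x‖ ≤ 1 + M := (norm_sub_le _ _).trans (by rw [norm_one]; gcongr; exact hM x)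
    have n1 : 0 ≤ (Metric.closedBall (0 : E d) R).indicator
      (fun _ => (1 + M) * (η ^ (-s) * I)) x := indicator_nonneg (fun _ _ => by positivity) x
    have n2 : 0 ≤ {x : E d | 1 ≤ ‖x‖}.indicator
      (fun x => ((1 + M) * (C * R0 ^ α * I)) * (1 / ‖x‖ ^ (s + α))) x :=
        indicator_nonneg (fun _ _ => by positivity) x
    rw [norm_smul]
    by_cases hxR : x ∈ Metric.closedBall (0 : E d) R
    · refine le_trans ?_ (le_add_of_nonneg_right n2)
      rw [indicator_of_mem hxR]
      by_cases hx1 : ψ x = 1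
      · rw [hx1, sub_self, norm_zero, zero_mul]; positivity
      gcongr
      exact hK.norm_transform_le hs (hf.integrable μ) hη fun y hy => hsep x y hy hx1
    · refine le_trans ?_ (le_add_of_nonneg_left n1)
      rw [Metric.mem_closedBall, dist_zero_right, not_le] at hxR
      have hx1 : 1 ≤ ‖x‖ := (le_max_left _ _).trans hxR.le
      rw [indicator_of_mem (show x ∈ {x : E d | 1 ≤ ‖x‖} from hx1), mul_assoc]
      gcongr
      refine (hC μ f R0 hR0 (hf.integrable μ) hsupp hmean x
        ((le_max_right _ _).trans hxR.le)).trans_eq ?_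
      rw [Real.rpow_neg (norm_nonneg _), one_div]

/-- Independence of the extended pairing of the cut-off function. -/
lemma IsCZKernel.extPairing_eq [IsLocallyFiniteMeasure μ]
    (hK : IsCZKernel s α K) (hs : 0 < s) (hα : 0 < α) (hα1 : α ≤ 1) (hd : IsDiffuse s μ)
    (hμ : HasRestrictedGrowth s α μ) {f ψ χ : E d → ℂ} (hf : IsLipZero f) (hψ : IsLipZero ψ)
    (hχ : IsLipZero χ) (hmean : ∫ y, f y ∂μ = 0) {η : ℝ} (hη : 0 < η)
    (hsepψ : ∀ x y, f y ≠ 0 → ψ x ≠ 1 → η ≤ dist x y)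
    (hsepχ : ∀ x y, f y ≠ 0 → χ x ≠ 1 → η ≤ dist x y) :
    extPairing K μ ψ f (fun _ => 1) =
      pairing K μ f χ + ∫ x, (1 - χ x) • transform K μ f x ∂μ := by
  have h1 := hK.integrable_one_sub_smul_transform hs hα hα1 hμ hf hψ hmean hη hsepψ
  have h2 := hK.integrable_one_sub_smul_transform hs hα hα1 hμ hf hχ hmean hη hsepχ
  obtain ⟨-, h3⟩ := hK.pairing_eq_integral_transform (μ := μ) hs hα hf (hχ.sub hψ) hη
    (fun x y hy hx => by
      by_cases hψ1 : ψ x = 1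
      · by_cases hχ1 : χ x = 1
        · exact absurd (by rw [hψ1, hχ1, sub_self]) hx
        · exact hsepχ x y hy hχ1
      · exact hsepψ x y hy hψ1)
  rw [hK.pairing_sub_right hα hd hf hχ hψ] at h3
  have h4 : ∫ x, (χ x - ψ x) • transform K μ f x ∂μ =
      ∫ x, (1 - ψ x) • transform K μ f x ∂μ - ∫ x, (1 - χ x) • transform K μ f x ∂μ := by
    rw [← integral_sub h1 h2]
    refine integral_congr_ae (Eventually.of_forall fun x => ?_)
    simp only [← sub_smul]
    congr 1
    ring
  have h5 : extPairing K μ ψ f (fun _ => 1) =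
      pairing K μ f ψ + ∫ x, (1 - ψ x) • transform K μ f x ∂μ := by
    simp only [extPairing, mul_one, transform]
  rw [h5, sub_eq_iff_eq_add.1 h3, h4]
  abel

end Pairing

/-! ### Existence of the operator on `L²` -/

section WeakLimit

open scoped InnerProductSpace

variable {H H' : Type*} [NormedAddCommGroup H] [InnerProductSpace ℂ H] [CompleteSpace H]
  [NormedAddCommGroup H'] [NormedSpace ℂ H']

/-- A bounded sequence in a Hilbert space has a weak limit along an ultrafilter. -/
lemma exists_weak_limit (U : Ultrafilter ℕ) (v : ℕ → H) {M : ℝ} (hv : ∀ n, ‖v n‖ ≤ M) :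
    ∃ w : H, ‖w‖ ≤ M ∧ ∀ G : H, Tendsto (fun n => ⟪v n, G⟫_ℂ) U (𝓝 ⟪w, G⟫_ℂ) := by
  have hM : 0 ≤ M := (norm_nonneg _).trans (hv 0)
  have hb : ∀ G n, ⟪v n, G⟫_ℂ ∈ Metric.closedBall (0 : ℂ) (M * ‖G‖) := by
    intro G n
    rw [mem_closedBall_zero_iff]
    refine (norm_inner_le_norm _ _).trans ?_
    gcongr
    exact hv n
  have hex : ∀ G : H, ∃ l : ℂ, l ∈ Metric.closedBall (0 : ℂ) (M * ‖G‖) ∧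
      Tendsto (fun n => ⟪v n, G⟫_ℂ) U (𝓝 l) := by
    intro G
    obtain ⟨l, hl, hle⟩ := (isCompact_closedBall (0 : ℂ) (M * ‖G‖)).ultrafilter_le_nhds
      (U.map fun n => ⟪v n, G⟫_ℂ) (by
        rw [Ultrafilter.coe_map, le_principal_iff]
        exact mem_map.2 (Eventually.of_forall (hb G)))
    exact ⟨l, hl, hle⟩
  choose l hl1 hl2 using hex
  let ℓ : H →ₗ[ℂ] ℂ :=
    { toFun := l
      map_add' := fun G G' => by
        refine tendsto_nhds_unique (hl2 (G + G')) ?_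
        simpa only [inner_add_right] using (hl2 G).add (hl2 G')
      map_smul' := fun c G => by
        refine tendsto_nhds_unique (hl2 (c • G)) ?_
        simpa only [inner_smul_right, smul_eq_mul, RingHom.id_apply] using (hl2 G).const_mul c }
  have hbound : ∀ G, ‖ℓ G‖ ≤ M * ‖G‖ := fun G => mem_closedBall_zero_iff.1 (hl1 G)
  refine ⟨(InnerProductSpace.toDual ℂ H).symm (ℓ.mkContinuous M hbound), ?_, fun G => ?_⟩
  · rw [LinearIsometryEquiv.norm_map]
    exact LinearMap.mkContinuous_norm_le _ hM _
  · rw [InnerProductSpace.toDual_symm_apply]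
    exact hl2 G

/-- A bounded sequence of operators into a Hilbert space converges along an ultrafilter in the weak
operator topology. -/
lemma exists_weak_operator_limit (U : Ultrafilter ℕ) (T : ℕ → H' →L[ℂ] H) {M : ℝ}
    (hT : ∀ n, ‖T n‖ ≤ M) :
    ∃ S : H' →L[ℂ] H, ∀ F G, Tendsto (fun n => ⟪G, T n F⟫_ℂ) U (𝓝 ⟪G, S F⟫_ℂ) := by
  have h : ∀ F : H', ∃ w : H, ‖w‖ ≤ M * ‖F‖ ∧
      ∀ G : H, Tendsto (fun n => ⟪G, T n F⟫_ℂ) U (𝓝 ⟪G, w⟫_ℂ) := by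
    intro F
    obtain ⟨w, hw1, hw2⟩ := exists_weak_limit U (fun n => T n F)
      (fun n => (T n).le_of_opNorm_le (hT n) F)
    refine ⟨w, hw1, fun G => ?_⟩
    have := (Complex.continuous_conj.tendsto _).comp (hw2 G)
    simpa only [Function.comp_def, inner_conj_symm] using this
  choose S hS1 hS2 using h
  let S' : H' →ₗ[ℂ] H :=
    { toFun := S
      map_add' := fun F F' => by
        refine ext_inner_left ℂ fun G => tendsto_nhds_unique (hS2 (F + F') G) ?_
        simpa only [map_add, inner_add_right] using (hS2 F G).add (hS2 F' G)
      map_smul' := fun c F => by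
        refine ext_inner_left ℂ fun G => tendsto_nhds_unique (hS2 (c • F) G) ?_
        simpa only [map_smul, inner_smul_right, RingHom.id_apply] using (hS2 F G).const_mul c }
  exact ⟨S'.mkContinuous M hS1, hS2⟩

end WeakLimit

section Operator

variable {d m : ℕ} {s α : ℝ} {K : E d → V m} {μ : Measure (E d)}

lemma IsCZKernel.memLp_regKernel (hK : IsCZKernel s α K) (hs : 0 < s) (hα : 0 < α) {δ Λ : ℝ}
    (hδ : 0 < δ) (hΛ : 0 ≤ Λ) (hμ : IsNiceWith s Λ μ) (x : E d) :
    MemLp (fun y => regKernel s α K δ (x - y)) 2 μ := by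
  have := hμ.isLocallyFiniteMeasure
  have hc : Continuous fun y => regKernel s α K δ (x - y) :=
    (hK.continuous_regKernel hs hα hδ).comp (by fun_prop)
  rw [memLp_two_iff_integrable_sq_norm hc.aestronglyMeasurable]
  refine ⟨(by fun_prop : Continuous fun y => ‖regKernel s α K δ (x - y)‖ ^ 2).aestronglyMeasurable,
    ?_⟩
  rw [hasFiniteIntegral_iff_ofReal (Eventually.of_forall fun x => by positivity)]
  have hm : MeasurableSet {y | δ ≤ dist x y} :=
    measurableSet_le measurable_const (measurable_const.dist measurable_id)
  rw [← lintegral_add_compl _ hm]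
  apply ENNReal.add_lt_top.2 ⟨?_, ?_⟩
  · have h1 := lintegral_compl_ball_dist_rpow_le (μ := μ) (x := x) (b := 2 * s) (σ := s) hΛ
      (by linarith) hδ fun r hr => hμ x r (hδ.trans_le hr)
    refine lt_of_le_of_lt ?_ (h1.trans_lt ENNReal.ofReal_lt_top)
    refine setLIntegral_mono' hm fun y hy => ENNReal.ofReal_le_ofReal ?_
    have h2 := hK.norm_regKernel_le' hs hα hδ (x - y)
    rw [← dist_eq_norm, max_eq_left (show δ ≤ dist x y from hy)] at h2
    calc _ ≤ (dist x y ^ (-s)) ^ 2 := by gcongr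
      _ = _ := by
        rw [← Real.rpow_natCast, ← Real.rpow_mul dist_nonneg]
        congr 1; push_cast; ring
  · calc _ ≤ ∫⁻ _y in {y | δ ≤ dist x y}ᶜ, ENNReal.ofReal ((δ ^ (-s)) ^ 2) ∂μ := by
          refine setLIntegral_mono' hm.compl fun y hy => ENNReal.ofReal_le_ofReal ?_
          have h2 := hK.norm_regKernel_le' hs hα hδ (x - y)
          have hy' : dist x y < δ := not_le.1 hy
          rw [← dist_eq_norm, max_eq_right hy'.le] at h2
          gcongr
      _ < ⊤ := by
        rw [lintegral_const, Measure.restrict_apply_univ]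
        refine ENNReal.mul_lt_top ENNReal.ofReal_lt_top
          ((measure_mono fun y hy => ?_).trans_lt (measure_ball_lt_top (μ := μ) (x := x) (r := δ)))
        rw [Metric.mem_ball, dist_comm]
        exact not_le.1 hy

lemma IsCZKernel.integrable_smul_regKernel (hK : IsCZKernel s α K) (hs : 0 < s) (hα : 0 < α)
    {δ Λ : ℝ} (hδ : 0 < δ) (hΛ : 0 ≤ Λ) (hμ : IsNiceWith s Λ μ) {F : E d → ℂ} (hF : MemLp F 2 μ)
    (x : E d) : Integrable (fun y => F y • regKernel s α K δ (x - y)) μ :=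
  memLp_one_iff_integrable.1 ((hK.memLp_regKernel hs hα hδ hΛ hμ x).smul hF)

/-- The regularized transforms define bounded operators on `L²`. -/
lemma IsCZKernel.exists_regOperator (hK : IsCZKernel s α K) (hs : 0 < s) (hα : 0 < α)
    {δ Λ : ℝ} (hδ : 0 < δ) (hΛ : 0 ≤ Λ) (hμ : IsNiceWith s Λ μ) {C : ℝ≥0}
    (hC : ∀ f : E d → ℂ, MemLp f 2 μ →
      eLpNorm (regTransform s α K μ δ f) 2 μ ≤ C * eLpNorm f 2 μ) :
    ∃ T : Lp ℂ 2 μ →L[ℂ] Lp (V m) 2 μ, ‖T‖ ≤ C ∧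
      ∀ F : Lp ℂ 2 μ, T F =ᵐ[μ] regTransform s α K μ δ F := by
  have := hμ.isLocallyFiniteMeasure
  have hmem : ∀ F : Lp ℂ 2 μ, MemLp (regTransform s α K μ δ F) 2 μ := by
    intro F
    refine ⟨?_, (hC F (Lp.memLp F)).trans_lt
      (ENNReal.mul_lt_top ENNReal.coe_lt_top (Lp.memLp F).2)⟩
    have h1 : Continuous fun z : E d × E d => regKernel s α K δ (z.1 - z.2) :=
      (hK.continuous_regKernel hs hα hδ).comp (by fun_prop)
    have h2 : StronglyMeasurable fun z : E d × E d => F z.2 • regKernel s α K δ (z.1 - z.2) :=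
      ((Lp.stronglyMeasurable F).comp_measurable measurable_snd).smul h1.stronglyMeasurable
    exact h2.integral_prod_right'.aestronglyMeasurable
  have hint := fun (F : Lp ℂ 2 μ) x => hK.integrable_smul_regKernel hs hα hδ hΛ hμ (Lp.memLp F) x
  let T : Lp ℂ 2 μ →ₗ[ℂ] Lp (V m) 2 μ :=
    { toFun := fun F => (hmem F).toLp _
      map_add' := fun F G => by
        rw [← MemLp.toLp_add, MemLp.toLp_eq_toLp_iff]
        refine Eventually.of_forall fun x => ?_
        rw [Pi.add_apply, regTransform, regTransform, regTransform, ← integral_add (hint F x) (hint G x)]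
        refine integral_congr_ae ?_
        filter_upwards [Lp.coeFn_add F G] with y hy
        rw [hy, Pi.add_apply, add_smul]
      map_smul' := fun c F => by
        rw [RingHom.id_apply, ← MemLp.toLp_const_smul, MemLp.toLp_eq_toLp_iff]
        refine Eventually.of_forall fun x => ?_
        rw [Pi.smul_apply, regTransform, regTransform, ← integral_smul]
        refine integral_congr_ae ?_
        filter_upwards [Lp.coeFn_smul c F] with y hy
        rw [hy, Pi.smul_apply, smul_assoc] }
  have hb : ∀ F, ‖T F‖ ≤ C * ‖F‖ := by
    intro F
    change ‖(hmem F).toLp _‖ ≤ _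
    rw [Lp.norm_toLp, Lp.norm_def, ← ENNReal.coe_toReal, ← ENNReal.toReal_mul]
    exact ENNReal.toReal_mono (ENNReal.mul_ne_top ENNReal.coe_ne_top (Lp.memLp F).2.ne)
      (hC F (Lp.memLp F))
  exact ⟨T.mkContinuous C hb, LinearMap.mkContinuous_norm_le _ C.2 _, fun F => (hmem F).coeFn_toLp⟩

/-- The bilinear form of a regularized transform is the regularized antisymmetric pairing. -/
lemma IsCZKernel.integral_smul_regTransform [IsLocallyFiniteMeasure μ] (hK : IsCZKernel s α K)
    (hs : 0 < s) (hα : 0 < α) {δ : ℝ} (hδ : 0 < δ) {f φ : E d → ℂ} (hf : IsLipZero f)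
    (hφ : IsLipZero φ) :
    Integrable (fun x => φ x • regTransform s α K μ δ f x) μ ∧
    ∫ x, φ x • regTransform s α K μ δ f x ∂μ =
      ∫ z, pairDensity f φ z • regKernel s α K δ (z.1 - z.2) ∂(μ.prod μ) := by
  set h : E d × E d → V m := fun z => (φ z.1 * f z.2) • regKernel s α K δ (z.1 - z.2) with hh
  have h1 : Continuous fun z : E d × E d => regKernel s α K δ (z.1 - z.2) :=
    (hK.continuous_regKernel hs hα hδ).comp (by fun_prop)
  have hint : Integrable h (μ.prod μ) := by
    have h0 := (hφ.integrable μ).mul_prod (hf.integrable μ)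
    refine (h0.norm.mul_const (δ ^ (-s))).mono'
      (h0.aestronglyMeasurable.smul h1.aestronglyMeasurable) (Eventually.of_forall fun z => ?_)
    rw [hh, norm_smul]
    gcongr
    refine (hK.norm_regKernel_le' hs hα hδ _).trans ?_
    exact Real.rpow_le_rpow_of_nonpos hδ (le_max_right _ _) (by linarith)
  have e1 : ∀ z : E d × E d, pairDensity f φ z • regKernel s α K δ (z.1 - z.2) =
      (1 / 2 : ℂ) • (h z + h z.swap) := by
    intro z
    simp only [hh, Prod.fst_swap, Prod.snd_swap]
    have hodd : regKernel s α K δ (z.2 - z.1) = -regKernel s α K δ (z.1 - z.2) := by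
      rw [← hK.regKernel_neg hs hα, neg_sub]
    rw [hodd, smul_neg, ← sub_eq_add_neg, ← sub_smul, smul_smul]
    congr 1
    unfold pairDensity
    ring
  have hswap : Integrable (fun z : E d × E d => h z.swap) (μ.prod μ) := hint.swap
  have e2 : ∫ z, h z.swap ∂(μ.prod μ) = ∫ z, h z ∂(μ.prod μ) := integral_prod_swap h
  have e3 : ∀ x, ∫ y, h (x, y) ∂μ = φ x • regTransform s α K μ δ f x := by
    intro x
    rw [regTransform, ← integral_smul]
    simp only [hh, mul_smul]
  constructor
  · exact hint.integral_prod_left.congr (Eventually.of_forall e3)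
  · rw [integral_congr_ae (Eventually.of_forall e1), integral_smul,
      integral_add hint hswap, e2, ← two_smul ℂ, smul_smul]
    norm_num
    rw [integral_prod _ hint]
    exact (integral_congr_ae (Eventually.of_forall e3)).symm

lemma IsCZKernel.tendsto_pairing_regKernel (hK : IsCZKernel s α K) (hs : 0 < s) (hα : 0 < α)
    (hμ : IsDiffuse s μ) {f φ : E d → ℂ} (hf : IsLipZero f) (hφ : IsLipZero φ) {δ : ℕ → ℝ}
    (hδ0 : ∀ n, 0 < δ n) (hδ : Tendsto δ atTop (𝓝 0)) :
    Tendsto (fun n => ∫ z, pairDensity f φ z • regKernel s α K (δ n) (z.1 - z.2) ∂(μ.prod μ))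
      atTop (𝓝 (pairing K μ f φ)) := by
  obtain ⟨g, hg, hle⟩ := exists_pairing_majorant (m := m) hf hφ hμ
  refine tendsto_integral_of_dominated_convergence g (fun n => ?_) hg (fun n => ?_) ?_
  · have h1 : Continuous fun z : E d × E d => regKernel s α K (δ n) (z.1 - z.2) :=
      (hK.continuous_regKernel hs hα (hδ0 n)).comp (by fun_prop)
    exact ((continuous_pairDensity hf hφ).smul h1).aestronglyMeasurable
  · exact Eventually.of_forall fun z => hle z _ fun hne =>
      (CZO.norm_regKernel_le hs hα (hδ0 n) _).trans (hK.norm_le _ (sub_ne_zero.2 hne))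
  · refine Eventually.of_forall fun z => ?_
    by_cases hz : z.1 = z.2
    · have : pairDensity f φ z = 0 := by
        have e : z = (z.1, z.1) := Prod.ext rfl hz.symm
        rw [e, pairDensity_diag]
      unfold pairDensity at this
      simp only [pairDensity, this, zero_smul, tendsto_const_nhds_iff]
    · refine tendsto_const_nhds.congr' ?_
      have hpos : 0 < ‖z.1 - z.2‖ := norm_pos_iff.2 (sub_ne_zero.2 hz)
      filter_upwards [hδ.eventually (gt_mem_nhds hpos)] with n hn
      rw [regKernel_eq_of_le (hδ0 n) hn.le]
      rfl

open scoped InnerProductSpace in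
/-- The operator `T_μ` exists: it is a weak limit of the regularized operators. -/
lemma IsCZKernel.isCZOperator_czOperator (hK : IsCZKernel s α K) (hs : 0 < s) (hα : 0 < α)
    {Λ : ℝ} (hΛ : 0 ≤ Λ) (hμ : IsNiceWith s Λ μ) (hb : IsBoundedCZO s α K μ) :
    IsCZOperator K μ (czOperator K μ) := by
  apply Classical.epsilon_spec (p := IsCZOperator K μ)
  have := hμ.isLocallyFiniteMeasure
  obtain ⟨C, hC⟩ := hb
  set δ : ℕ → ℝ := fun n => 1 / ((n : ℝ) + 1) with hδ
  have hδ0 : ∀ n, 0 < δ n := fun n => by positivity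
  choose T hT1 hT2 using fun n => hK.exists_regOperator hs hα (hδ0 n) hΛ hμ (hC (δ n) (hδ0 n))
  obtain ⟨S, hS⟩ := exists_weak_operator_limit (hyperfilter ℕ) T hT1
  refine ⟨S, fun f φ hf hφ F hF => ?_⟩
  -- test with the function `conj φ • v`, so that the inner product is the bilinear pairing with `φ`
  refine ext_inner_left ℂ fun v => ?_
  have hG0 : MemLp (fun x => (starRingEnd ℂ (φ x)) • v) 2 μ := by
    have h1 : MemLp (fun x => starRingEnd ℂ (φ x)) 2 μ := (hφ.memLp μ 2).star
    refine h1.of_le_mul (c := ‖v‖) ?_ (Eventually.of_forall fun x => ?_)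
    · exact h1.1.smul aestronglyMeasurable_const
    · rw [norm_smul, mul_comm]
  set G : Lp (V m) 2 μ := hG0.toLp _ with hG
  have hinner : ∀ (W : Lp (V m) 2 μ), ⟪G, W⟫_ℂ = ⟪v, ∫ x, φ x • W x ∂μ⟫_ℂ := by
    intro W
    have hi : Integrable (fun x => φ x • W x) μ :=
      memLp_one_iff_integrable.1 ((Lp.memLp W).smul (hφ.memLp μ 2))
    rw [← integral_inner hi, L2.inner_def]
    refine integral_congr_ae ?_
    filter_upwards [hG0.coeFn_toLp] with x hx
    rw [hG, hx, inner_smul_left, inner_smul_right, RingHomCompTriple.comp_apply]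
    rfl
  have e1 : ∀ n, ⟪G, T n F⟫_ℂ =
      ⟪v, ∫ z, pairDensity f φ z • regKernel s α K (δ n) (z.1 - z.2) ∂(μ.prod μ)⟫_ℂ := by
    intro n
    rw [hinner, ← (hK.integral_smul_regTransform hs hα (hδ0 n) hf hφ).2]
    congr 1
    refine integral_congr_ae ?_
    filter_upwards [hT2 n F] with x hx
    rw [hx]
    congr 1
    refine integral_congr_ae ?_
    filter_upwards [hF] with y hy
    rw [hy]
  rw [← hinner]
  refine tendsto_nhds_unique (hS F G) ?_
  simp_rw [e1]
  have h3 := hK.tendsto_pairing_regKernel hs hα (hμ.isDiffuse hs hΛ) hf hφ hδ0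
    tendsto_one_div_add_atTop_nhds_zero_nat
  exact (tendsto_const_nhds.inner h3).mono_left Nat.hyperfilter_le_atTop

end Operator

/-! ### Bounds for the pairing and restriction to subsets -/

/-- The pairing is bounded with respect to the norm of `L²(μ)`. -/
def PairingBound {d m : ℕ} (K : E d → V m) (μ : Measure (E d)) (B : ℝ) : Prop :=
  ∀ f φ : E d → ℂ, IsLipZero f → IsLipZero φ →
    ‖pairing K μ f φ‖ ≤ B * √(∫ x, ‖f x‖ ^ 2 ∂μ) * √(∫ x, ‖φ x‖ ^ 2 ∂μ)

section PairingBound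

variable {d m : ℕ} {s α : ℝ} {K : E d → V m} {μ : Measure (E d)}

lemma toReal_eLpNorm_two {f : E d → ℂ} (hf : MemLp f 2 μ) :
    (eLpNorm f 2 μ).toReal = √(∫ x, ‖f x‖ ^ 2 ∂μ) := by
  rw [hf.eLpNorm_eq_integral_rpow_norm two_ne_zero ENNReal.ofNat_ne_top, ENNReal.toReal_ofReal]
  · rw [Real.sqrt_eq_rpow]
    simp
  · positivity

lemma IsCZKernel.pairingBound (hK : IsCZKernel s α K) (hs : 0 < s) (hα : 0 < α)
    {Λ B : ℝ} (hΛ : 0 ≤ Λ) (hμ : IsNiceWith s Λ μ) (hb : IsBoundedCZO s α K μ)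
    (hB : ‖czOperator K μ‖ ≤ B) : PairingBound K μ B := by
  have := hμ.isLocallyFiniteMeasure
  intro f φ hf hφ
  have h2f := hf.memLp μ 2
  have h2φ := hφ.memLp μ 2
  rw [← toReal_eLpNorm_two h2f, ← toReal_eLpNorm_two h2φ,
    ← hK.isCZOperator_czOperator hs hα hΛ hμ hb f φ hf hφ (h2f.toLp f) h2f.coeFn_toLp]
  have h1 : ‖czOperator K μ (h2f.toLp f)‖ ≤ B * (eLpNorm f 2 μ).toReal := by
    refine ((czOperator K μ).le_of_opNorm_le hB _).trans_eq ?_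
    rw [Lp.norm_toLp]
  generalize czOperator K μ (h2f.toLp f) = W at h1 ⊢
  have h3 : ‖∫ x, φ x • W x ∂μ‖ₑ ≤ eLpNorm φ 2 μ * eLpNorm W 2 μ := by
    refine (enorm_integral_le_lintegral_enorm _).trans ?_
    rw [← eLpNorm_one_eq_lintegral_enorm]
    have h5 := eLpNorm_smul_le_mul_eLpNorm (p := 2) (q := 2) (r := 1) (Lp.memLp W).1 h2φ.1
    exact h5
  have h4 := ENNReal.toReal_mono (ENNReal.mul_ne_top h2φ.2.ne (Lp.memLp W).2.ne) h3
  rw [toReal_enorm, ENNReal.toReal_mul, ← Lp.norm_def] at h4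
  calc _ ≤ _ := h4
    _ ≤ (eLpNorm φ 2 μ).toReal * (B * (eLpNorm f 2 μ).toReal) := by gcongr
    _ = _ := by ring

lemma pairing_restrict [SFinite μ] (K : E d → V m) (S : Set (E d)) (f φ : E d → ℂ) :
    pairing K (μ.restrict S) f φ =
      ∫ z in S ×ˢ S, pairDensity f φ z • K (z.1 - z.2) ∂(μ.prod μ) := by
  rw [pairing_eq, Measure.prod_restrict]

/-- Lipschitz approximations of the indicator function of a set. -/
noncomputable def approxIndicator (S : Set (E d)) (n : ℕ) (x : E d) : ℝ :=
  max 0 (1 - n * Metric.infDist x S)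

lemma approxIndicator_nonneg (S : Set (E d)) (n : ℕ) (x : E d) : 0 ≤ approxIndicator S n x :=
  le_max_left _ _

lemma approxIndicator_le_one (S : Set (E d)) (n : ℕ) (x : E d) : approxIndicator S n x ≤ 1 :=
  max_le zero_le_one (by
    have := Metric.infDist_nonneg (x := x) (s := S)
    have : 0 ≤ n * Metric.infDist x S := by positivity
    linarith)

lemma abs_approxIndicator_sub_le (S : Set (E d)) (n : ℕ) (x y : E d) :
    |approxIndicator S n x - approxIndicator S n y| ≤ n * dist x y := by
  unfold approxIndicator
  rw [max_comm 0, max_comm 0]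
  refine (abs_max_sub_max_le_abs _ _ _).trans ?_
  rw [show 1 - (n : ℝ) * Metric.infDist x S - (1 - n * Metric.infDist y S) =
    -(n * (Metric.infDist x S - Metric.infDist y S)) by ring, abs_neg, abs_mul, Nat.abs_cast]
  gcongr
  have := (Metric.lipschitz_infDist_pt S).dist_le_mul x y
  simpa [Real.dist_eq] using this

lemma tendsto_approxIndicator {S : Set (E d)} (hS : IsClosed S) (hne : S.Nonempty) (x : E d) :
    Tendsto (fun n => approxIndicator S n x) atTop (𝓝 (S.indicator (fun _ => 1) x)) := by
  refine tendsto_const_nhds.congr' ?_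
  by_cases hx : x ∈ S
  · refine Eventually.of_forall fun n => ?_
    rw [indicator_of_mem hx]
    simp [approxIndicator, Metric.infDist_zero_of_mem hx]
  · have hpos : 0 < Metric.infDist x S := (hS.notMem_iff_infDist_pos hne).1 hx
    obtain ⟨N, hN⟩ := exists_nat_gt (1 / Metric.infDist x S)
    filter_upwards [eventually_ge_atTop N] with n hn
    rw [indicator_of_notMem hx]
    unfold approxIndicator
    rw [max_eq_left]
    have : (N : ℝ) ≤ n := by exact_mod_cast hn
    rw [div_lt_iff₀ hpos] at hN
    nlinarith

lemma IsLipZero.approxIndicator_mul {f : E d → ℂ} (hf : IsLipZero f) (S : Set (E d)) (n : ℕ) :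
    IsLipZero fun x => (approxIndicator S n x : ℂ) * f x := by
  obtain ⟨L, hL0, hL⟩ := hf.exists_lipschitz
  obtain ⟨M, hM0, hM⟩ := hf.exists_bound
  obtain ⟨R, hR0, hR⟩ := hf.exists_radius
  refine isLipZero_of_bounds (L := L + n * M) (R := R) (fun x y => ?_) fun x hx => ?_
  · have e : (approxIndicator S n x : ℂ) * f x - (approxIndicator S n y : ℂ) * f y =
        (approxIndicator S n x : ℂ) * (f x - f y) +
          ((approxIndicator S n x - approxIndicator S n y : ℝ) : ℂ) * f y := by
      push_cast; ring
    rw [e]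
    refine (norm_add_le _ _).trans ?_
    rw [norm_mul, norm_mul, Complex.norm_real, Complex.norm_real,
      Real.norm_of_nonneg (approxIndicator_nonneg _ _ _), Real.norm_eq_abs]
    calc _ ≤ 1 * (L * dist x y) + (n * dist x y) * M := by
          gcongr
          · exact approxIndicator_le_one _ _ _
          · exact hL _ _
          · exact abs_approxIndicator_sub_le _ _ _ _
          · exact hM _
      _ = _ := by ring
  · by_contra h
    exact hx (by simp [IsLipZero.eq_zero_of_notMem hR h])

lemma IsLipZero.integrable_sq [IsLocallyFiniteMeasure μ] {f : E d → ℂ} (hf : IsLipZero f) :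
    Integrable (fun x => ‖f x‖ ^ 2) μ :=
  (memLp_two_iff_integrable_sq_norm (hf.memLp μ 2).1).1 (hf.memLp μ 2)

lemma tendsto_integral_approxIndicator_mul_sq [IsLocallyFiniteMeasure μ] {f : E d → ℂ}
    (hf : IsLipZero f) {S : Set (E d)} (hS : IsClosed S) (hne : S.Nonempty) :
    Tendsto (fun n => ∫ x, ‖(approxIndicator S n x : ℂ) * f x‖ ^ 2 ∂μ) atTop
      (𝓝 (∫ x in S, ‖f x‖ ^ 2 ∂μ)) := by
  rw [← integral_indicator hS.measurableSet]
  refine tendsto_integral_of_dominated_convergence (fun x => ‖f x‖ ^ 2) (fun n => ?_)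
    hf.integrable_sq (fun n => Eventually.of_forall fun x => ?_) (Eventually.of_forall fun x => ?_)
  · exact ((hf.approxIndicator_mul S n).continuous.norm.pow 2).aestronglyMeasurable
  · rw [norm_mul, Complex.norm_real, Real.norm_of_nonneg (approxIndicator_nonneg _ _ _), norm_pow,
      norm_mul, norm_norm, Real.norm_of_nonneg (approxIndicator_nonneg _ _ _)]
    have a1 := approxIndicator_nonneg S n x
    exact pow_le_pow_left₀ (by positivity)
      (mul_le_of_le_one_left (norm_nonneg _) (approxIndicator_le_one _ _ _)) 2
  · have h1 := tendsto_approxIndicator hS hne x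
    have h2 : Tendsto (fun n => (approxIndicator S n x * ‖f x‖) ^ 2) atTop
        (𝓝 ((S.indicator (fun _ => 1) x * ‖f x‖) ^ 2)) := (h1.mul_const _).pow 2
    have e : (S.indicator (fun _ => (1 : ℝ)) x * ‖f x‖) ^ 2 = S.indicator (fun x => ‖f x‖ ^ 2) x := by
      by_cases hx : x ∈ S <;> simp [hx]
    rw [e] at h2
    refine h2.congr fun n => ?_
    rw [norm_mul, Complex.norm_real, Real.norm_of_nonneg (approxIndicator_nonneg _ _ _)]

/-- For a compact set `S`, test the bound with `f` and `φ` multiplied by Lipschitz approximations of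
the indicator function of `S`: both factors of `S ×ˢ S` then appear in the antisymmetric density. -/
lemma PairingBound.restrict_isCompact [IsLocallyFiniteMeasure μ] (hK : IsCZKernel s α K)
    (hα : 0 < α) (hμ : IsDiffuse s μ) {B : ℝ} (h : PairingBound K μ B) {S : Set (E d)}
    (hS : IsCompact S) : PairingBound K (μ.restrict S) B := by
  intro f φ hf hφ
  rcases S.eq_empty_or_nonempty with rfl | hne
  · simp [pairing]
  have h1 := tendsto_integral_approxIndicator_mul_sq (μ := μ) hf hS.isClosed hne
  have h2 := tendsto_integral_approxIndicator_mul_sq (μ := μ) hφ hS.isClosed hne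
  have h3 : Tendsto (fun n => pairing K μ (fun x => (approxIndicator S n x : ℂ) * f x)
      (fun x => (approxIndicator S n x : ℂ) * φ x)) atTop (𝓝 (pairing K (μ.restrict S) f φ)) := by
    rw [pairing_restrict, ← integral_indicator (hS.measurableSet.prod hS.measurableSet)]
    have hint := (hK.integrable_pairing hα hf hφ hμ).norm
    simp_rw [pairing_eq]
    refine tendsto_integral_of_dominated_convergence _ (fun n => ?_) hint
      (fun n => Eventually.of_forall fun z => ?_) (Eventually.of_forall fun z => ?_)
    · exact (hK.measurable_pairing_integrand hα (hf.approxIndicator_mul S n)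
        (hφ.approxIndicator_mul S n)).aestronglyMeasurable
    · have e : pairDensity (fun x => (approxIndicator S n x : ℂ) * f x)
          (fun x => (approxIndicator S n x : ℂ) * φ x) z =
          ((approxIndicator S n z.1 * approxIndicator S n z.2 : ℝ) : ℂ) * pairDensity f φ z := by
        unfold pairDensity; push_cast; ring
      rw [e, mul_smul, norm_smul, Complex.norm_real]
      apply mul_le_of_le_one_left (norm_nonneg _)
      have a1 := approxIndicator_nonneg S n z.1
      have a2 := approxIndicator_nonneg S n z.2
      rw [Real.norm_of_nonneg (by positivity)]
      exact mul_le_one₀ (approxIndicator_le_one _ _ _) a2 (approxIndicator_le_one _ _ _)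
    · have b1 := tendsto_approxIndicator hS.isClosed hne z.1
      have b2 := tendsto_approxIndicator hS.isClosed hne z.2
      have b3 := ((Complex.continuous_ofReal.tendsto _).comp (b1.mul b2)).smul_const
        (pairDensity f φ z • K (z.1 - z.2))
      have e : ((S.indicator (fun _ => (1 : ℝ)) z.1 * S.indicator (fun _ => (1 : ℝ)) z.2 : ℝ) : ℂ) •
          (pairDensity f φ z • K (z.1 - z.2)) =
          (S ×ˢ S).indicator (fun z => pairDensity f φ z • K (z.1 - z.2)) z := by
        by_cases hz1 : z.1 ∈ S <;> by_cases hz2 : z.2 ∈ S <;>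
          simp [hz1, hz2, indicator, mem_prod]
      rw [e] at b3
      refine b3.congr fun n => ?_
      simp only [Function.comp_apply, smul_smul]
      congr 1
      unfold pairDensity; push_cast; ring
  refine le_of_tendsto_of_tendsto h3.norm ((h1.sqrt.const_mul B).mul h2.sqrt)
    (Eventually.of_forall fun n => ?_)
  exact h _ _ (hf.approxIndicator_mul S n) (hφ.approxIndicator_mul S n)

/-- The bound for the pairing passes to the restrictions of the measure. -/
lemma PairingBound.restrict [IsLocallyFiniteMeasure μ] (hK : IsCZKernel s α K)
    (hα : 0 < α) (hμ : IsDiffuse s μ) {B : ℝ} (h : PairingBound K μ B) {Q : Set (E d)}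
    (hQ : MeasurableSet Q) (hQfin : μ Q ≠ ⊤) : PairingBound K (μ.restrict Q) B := by
  intro f φ hf hφ
  -- exhaust `Q` by an increasing sequence of compact sets, up to a null set
  have hex : ∀ n : ℕ, ∃ S ⊆ Q, IsCompact S ∧ μ (Q \ S) < ((n : ℝ≥0∞) + 1)⁻¹ := fun n =>
    hQ.exists_isCompact_sdiff_lt hQfin (by simp)
  choose S hSQ hSc hSlt using hex
  have hGc : ∀ n, IsCompact (accumulate S n) := fun n =>
    (Set.finite_Iic n).isCompact_biUnion fun i _ => hSc i
  have hGm : Monotone (accumulate S) := monotone_accumulate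
  have hU : μ.restrict Q = μ.restrict (⋃ n, accumulate S n) := by
    apply Measure.restrict_congr_set
    rw [iUnion_accumulate]
    refine EventuallyEq.symm (eventuallyLE_antisymm_iff.2 ⟨?_, ?_⟩)
    · exact LE.le.eventuallyLE (iUnion_subset hSQ)
    · rw [ae_le_set]
      refine le_antisymm (ge_of_tendsto (x := atTop) (f := fun n : ℕ => ((n : ℝ≥0∞) + 1)⁻¹) ?_
        (Eventually.of_forall fun n => ?_)) bot_le
      · have := (tendsto_add_atTop_iff_nat 1).2 ENNReal.tendsto_inv_nat_nhds_zero
        simpa using this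
      · exact (measure_mono (sdiff_subset_sdiff_right (subset_iUnion S n))).trans (hSlt n).le
  have hprod : (⋃ n, accumulate S n ×ˢ accumulate S n) =
      (⋃ n, accumulate S n) ×ˢ (⋃ n, accumulate S n) := iUnion_prod_of_monotone hGm hGm
  have h3 : Tendsto (fun n => pairing K (μ.restrict (accumulate S n)) f φ) atTop
      (𝓝 (pairing K (μ.restrict Q) f φ)) := by
    rw [hU]
    simp_rw [pairing_restrict]
    rw [← hprod]
    exact tendsto_setIntegral_of_monotone
      (fun n => (hGc n).measurableSet.prod (hGc n).measurableSet)
      (fun i j hij => prod_mono (hGm hij) (hGm hij))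
      (hK.integrable_pairing hα hf hφ hμ).integrableOn
  have h4 : ∀ g : E d → ℂ, IsLipZero g → Tendsto (fun n => ∫ x in accumulate S n, ‖g x‖ ^ 2 ∂μ)
      atTop (𝓝 (∫ x in Q, ‖g x‖ ^ 2 ∂μ)) := by
    intro g hg
    rw [hU]
    exact tendsto_setIntegral_of_monotone (fun n => (hGc n).measurableSet) hGm
      hg.integrable_sq.integrableOn
  refine le_of_tendsto_of_tendsto h3.norm (((h4 f hf).sqrt.const_mul B).mul (h4 φ hφ).sqrt)
    (Eventually.of_forall fun n => ?_)
  exact h.restrict_isCompact hK hα hμ (hGc n) f φ hf hφ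

end PairingBound

/-! ### Almost orthogonality and Bessel's inequality -/

/-- `f` is a normalized Lipschitz bump of mean zero, adapted to the ball `B(x, r)`: it is supported
in `B(x, A r)`, bounded by `1`, and its Lipschitz constant is at most `1 / r`. -/
structure IsBump {d : ℕ} (μ : Measure (E d)) (x : E d) (r A : ℝ) (f : E d → ℂ) : Prop where
  isLipZero : IsLipZero f
  norm_sub_le : ∀ y z, ‖f y - f z‖ ≤ dist y z / r
  norm_le : ∀ y, ‖f y‖ ≤ 1
  mem_ball : ∀ y, f y ≠ 0 → y ∈ Metric.ball x (A * r)
  integral_eq_zero : ∫ y, f y ∂μ = 0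

section Overlap

variable {d : ℕ}

/-- The weight that bounds the inner product of two bumps at lattice balls, where the ball `k` is
the smaller one. -/
noncomputable def overlap (A : ℝ) (μ : Measure (E d)) (j k : LatticeIndex d) : ℝ :=
  open Classical in
  if rad k ≤ rad j ∧ dist (node j : E d) (node k) < 2 * A * rad j then
    rad k / rad j * mass μ k else 0

lemma overlap_nonneg (A : ℝ) (μ : Measure (E d)) (j k : LatticeIndex d) : 0 ≤ overlap A μ j k := by
  have := rad_pos j
  have := rad_pos k
  have := mass_nonneg μ k
  unfold overlap
  split_ifs <;> positivity

/-- Sum over the larger balls: boundedly many at each scale, and geometric decay over the scales. -/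
lemma exists_sum_overlap_left_le (d : ℕ) {A : ℝ} (hA : 0 ≤ A) : ∃ C : ℝ, 0 ≤ C ∧
    ∀ (μ : Measure (E d)) (F : Finset (LatticeIndex d)) (k : LatticeIndex d),
      ∑ j ∈ F, overlap A μ j k ≤ C * mass μ k := by
  obtain ⟨C, hC⟩ := exists_tsum_scale_dist_le d
  refine ⟨(1 + 2 * A) ^ (2 * d) * C, by positivity, fun μ F k => ?_⟩
  have hk := rad_pos k
  have hmk := mass_nonneg μ k
  set g : LatticeIndex d → ℝ := fun j => min (rad j / rad k) (rad k / rad j) *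
      ((1 + dist (node j) (node k) / rad j) ^ (2 * d))⁻¹ with hg
  have hg0 : ∀ j, 0 ≤ g j := fun j => by
    have := rad_pos j
    positivity
  have hgF : ∑ j ∈ F, g j ≤ C := by
    have h1 := (ENNReal.sum_le_tsum F).trans (hC (node k) (rad k) hk)
    rw [← ENNReal.ofReal_sum_of_nonneg fun j _ => hg0 j] at h1
    have := ENNReal.toReal_mono ENNReal.coe_ne_top h1
    rwa [ENNReal.toReal_ofReal (Finset.sum_nonneg fun j _ => hg0 j), ENNReal.coe_toReal] at this
  calc _ ≤ ∑ j ∈ F, (1 + 2 * A) ^ (2 * d) * g j * mass μ k := by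
        refine Finset.sum_le_sum fun j _ => ?_
        have hj := rad_pos j
        unfold overlap
        split_ifs with h
        · gcongr
          simp only [hg]
          rw [min_eq_right (((div_le_one hj).2 h.1).trans ((one_le_div hk).2 h.1))]
          rw [mul_left_comm]
          apply le_mul_of_one_le_right (by positivity)
          rw [← div_eq_mul_inv, le_div_iff₀ (by positivity), one_mul]
          gcongr
          rw [div_le_iff₀ hj]
          exact h.2.le
        · have := hg0 j
          positivity
    _ = (1 + 2 * A) ^ (2 * d) * (∑ j ∈ F, g j) * mass μ k := by
        rw [Finset.mul_sum, Finset.sum_mul]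
    _ ≤ _ := by gcongr

/-- Sum over the smaller balls: these have bounded overlap at each scale and lie in a dilate of the
larger one, so their masses are bounded by integrating a lattice sum over this dilate. -/
lemma exists_sum_overlap_right_le (d : ℕ) (A : ℝ) : ∃ C : ℝ, 0 ≤ C ∧
    ∀ (μ : Measure (E d)) [IsFiniteMeasure μ] (F : Finset (LatticeIndex d)) (j : LatticeIndex d),
      ∑ k ∈ F, overlap A μ j k ≤ C * μ.real (Metric.ball (node j) ((2 * A + 1) * rad j)) := by
  obtain ⟨C, hC⟩ := exists_tsum_scale_dist_le d
  refine ⟨2 ^ (2 * d) * C, by positivity, fun μ _ F j => ?_⟩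
  have hj := rad_pos j
  set G : Set (E d) := Metric.ball (node j) ((2 * A + 1) * rad j) with hG
  set g : LatticeIndex d → E d → ℝ := fun k x => min (rad k / rad j) (rad j / rad k) *
      ((1 + dist (node k) x / rad k) ^ (2 * d))⁻¹ with hg
  have hg0 : ∀ k x, 0 ≤ g k x := fun k x => by
    have := rad_pos k
    positivity
  have key : ∀ k, ENNReal.ofReal (overlap A μ j k) ≤
      ∫⁻ x in G, ENNReal.ofReal (2 ^ (2 * d)) * ENNReal.ofReal (g k x) ∂μ := by
    intro k
    have hk := rad_pos k
    unfold overlap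
    split_ifs with h
    · have hsub : Metric.ball (node k) (rad k) ⊆ G := by
        apply Metric.ball_subset_ball'
        rw [dist_comm]
        linarith [h.1, h.2]
      calc _ = ∫⁻ _x in Metric.ball (node k) (rad k), ENNReal.ofReal (rad k / rad j) ∂μ := by
            rw [lintegral_const, Measure.restrict_apply_univ, measure_ball_node,
              ENNReal.ofReal_mul (by positivity)]
        _ ≤ ∫⁻ x in Metric.ball (node k) (rad k),
              ENNReal.ofReal (2 ^ (2 * d)) * ENNReal.ofReal (g k x) ∂μ := by
            refine setLIntegral_mono' Metric.isOpen_ball.measurableSet fun x hx => ?_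
            rw [← ENNReal.ofReal_mul (by positivity)]
            apply ENNReal.ofReal_le_ofReal
            simp only [hg]
            rw [min_eq_left (((div_le_one hj).2 h.1).trans ((one_le_div hk).2 h.1)), mul_left_comm]
            apply le_mul_of_one_le_right (by positivity)
            rw [← div_eq_mul_inv, le_div_iff₀ (by positivity), one_mul]
            gcongr
            rw [Metric.mem_ball, dist_comm] at hx
            have : dist (node k) x / rad k ≤ 1 := (div_le_one hk).2 hx.le
            linarith
        _ ≤ _ := lintegral_mono_set hsub
    · simp
  have hmeas : ∀ k, Measurable fun x => ENNReal.ofReal (2 ^ (2 * d)) * ENNReal.ofReal (g k x) := by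
    intro k
    have : Measurable (g k) := by
      simp only [hg]
      have : Measurable fun x : E d => dist (node k) x := measurable_const.dist measurable_id
      fun_prop
    fun_prop
  have h1 : ENNReal.ofReal (∑ k ∈ F, overlap A μ j k) ≤
      ENNReal.ofReal (2 ^ (2 * d) * C * μ.real G) := by
    rw [ENNReal.ofReal_sum_of_nonneg fun k _ => overlap_nonneg A μ j k]
    calc _ ≤ ∑ k ∈ F, ∫⁻ x in G, ENNReal.ofReal (2 ^ (2 * d)) * ENNReal.ofReal (g k x) ∂μ :=
          Finset.sum_le_sum fun k _ => key k
      _ = ∫⁻ x in G, ∑ k ∈ F, ENNReal.ofReal (2 ^ (2 * d)) * ENNReal.ofReal (g k x) ∂μ :=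
          (lintegral_finsetSum _ fun k _ => hmeas k).symm
      _ ≤ ∫⁻ _x in G, ENNReal.ofReal (2 ^ (2 * d)) * C ∂μ := by
          refine lintegral_mono fun x => ?_
          simp only
          rw [← Finset.mul_sum]
          gcongr
          exact (ENNReal.sum_le_tsum F).trans (hC x (rad j) hj)
      _ = _ := by
          rw [lintegral_const, Measure.restrict_apply_univ, ENNReal.ofReal_mul (by positivity),
            ENNReal.ofReal_mul (by positivity), ofReal_measureReal, ENNReal.ofReal_coe_nnreal]
  exact (ENNReal.ofReal_le_ofReal_iff (by positivity)).1 h1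

end Overlap

section Bessel

variable {d m : ℕ}

/-- The mean zero of the bump `g` allows subtracting from `f` its value at the centre of `g`, which
gains the ratio of the radii by the Lipschitz bound for `f`. -/
lemma IsBump.norm_integral_mul_le {μ : Measure (E d)} [IsFiniteMeasure μ] {x y : E d}
    {r t A : ℝ} {f g : E d → ℂ} (hr : 0 < r) (hf : IsBump μ x r A f)
    (hg : IsBump μ y t A g) :
    ‖∫ w, f w * starRingEnd ℂ (g w) ∂μ‖ ≤ A * (t / r * μ.real (Metric.ball y (A * t))) := by
  have hgc := hg.isLipZero.continuous
  have hfc := hf.isLipZero.continuous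
  have hgi : Integrable (fun w => starRingEnd ℂ (g w)) μ := by
    refine (hg.isLipZero.integrable μ).norm.mono' ?_ (Eventually.of_forall fun w => ?_)
    · exact (Complex.continuous_conj.comp hgc).aestronglyMeasurable
    · simp
  have hfg : Integrable (fun w => f w * starRingEnd ℂ (g w)) μ := by
    refine hgi.norm.mono' ?_ (Eventually.of_forall fun w => ?_)
    · exact (hfc.mul (Complex.continuous_conj.comp hgc)).aestronglyMeasurable
    · rw [norm_mul]
      exact mul_le_of_le_one_left (norm_nonneg _) (hf.norm_le w)
  have e : ∫ w, f w * starRingEnd ℂ (g w) ∂μ =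
      ∫ w, (f w - f y) * starRingEnd ℂ (g w) ∂μ := by
    simp_rw [sub_mul]
    rw [integral_sub hfg (hgi.const_mul _), integral_const_mul, integral_conj,
      hg.integral_eq_zero]
    simp
  rw [e]
  have hs : ∀ w, w ∉ Metric.ball y (A * t) → (f w - f y) * starRingEnd ℂ (g w) = 0 := by
    intro w hw
    have : g w = 0 := by
      by_contra h
      exact hw (hg.mem_ball w h)
    simp [this]
  rw [← setIntegral_eq_integral_of_forall_compl_eq_zero hs]
  have := norm_setIntegral_le_of_norm_le_const (μ := μ) (s := Metric.ball y (A * t))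
    (f := fun w => (f w - f y) * starRingEnd ℂ (g w)) (C := A * t / r)
    (measure_lt_top _ _) (fun w hw => by
      rw [norm_mul, RCLike.norm_conj]
      calc _ ≤ dist w y / r * 1 := by
            gcongr
            · exact hf.norm_sub_le w y
            · exact hg.norm_le w
        _ ≤ A * t / r := by
            rw [mul_one]
            gcongr
            exact (Metric.mem_ball.1 hw).le)
  refine this.trans_eq ?_
  ring

lemma IsBump.integral_mul_eq_zero {μ : Measure (E d)} {x y : E d}
    {r t A : ℝ} {f g : E d → ℂ} (hf : IsBump μ x r A f)
    (hg : IsBump μ y t A g) (h : A * r + A * t ≤ dist x y) :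
    ∫ w, f w * starRingEnd ℂ (g w) ∂μ = 0 := by
  have : ∀ w, f w * starRingEnd ℂ (g w) = 0 := by
    intro w
    by_contra hne
    have h1 := hf.mem_ball w (left_ne_zero_of_mul hne)
    have h2 := hg.mem_ball w (by
      have := right_ne_zero_of_mul hne
      simpa using this)
    rw [Metric.mem_ball] at h1 h2
    have := dist_triangle_left x y w
    linarith
  simp [this]

lemma IsDominant.measureReal_dilate_le {s ε : ℝ} (hs : 0 < s) (hε : 0 < ε) (hε1 : ε ≤ 1)
    {μ : Measure (E d)} [IsFiniteMeasure μ] {j : LatticeIndex d} (hj : IsDominant s ε μ j)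
    {A : ℝ} (hA : 1 ≤ A) :
    μ.real (Metric.ball (node j) (A * rad j)) ≤
      (2 * (d + 1)) ^ s * (16 * (d + 1)) * (4 * A) * A ^ s * mass μ j := by
  have hr := rad_pos j
  have hA0 : 0 < A := by linarith
  have h1 := hj.measureReal_ball_le hs hε hε1 (node j) (mul_pos hA0 hr)
  have h2 : hypRatio (node j) (rad j) (node j : E d) (A * rad j) ^ ε ≤ 4 * A := by
    have e : hypRatio (node j) (rad j) (node j : E d) (A * rad j) = (1 + A) ^ 2 / A := by
      unfold hypRatio
      rw [dist_self]
      field_simp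
      ring
    have e1 : (1 + A) ^ 2 / A ≤ 4 * A := by
      rw [div_le_iff₀ hA0]; nlinarith
    calc _ ≤ hypRatio (node j) (rad j) (node j : E d) (A * rad j) ^ (1 : ℝ) :=
          Real.rpow_le_rpow_of_exponent_le (one_le_hypRatio _ _ hr (mul_pos hA0 hr)) hε1
      _ ≤ _ := by rw [Real.rpow_one, e]; exact e1
  have hdj := dens_nonneg s μ j
  calc _ ≤ _ := h1
    _ ≤ (2 * (d + 1)) ^ s * (16 * (d + 1)) * (4 * A) * dens s μ j * (A * rad j) ^ s := by gcongr
    _ = _ := by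
      rw [Real.mul_rpow hA0.le hr.le, mass_eq_dens_mul s]
      ring

/-- Bumps at dominant lattice balls are almost orthogonal in `L²(μ)`, by Schur's test for the
overlaps. -/
lemma exists_integral_sq_sum_bump_le (d : ℕ) {s A : ℝ} (hs : 0 < s) (hA : 1 ≤ A) :
    ∃ C : ℝ, 0 ≤ C ∧ ∀ (μ : Measure (E d)) [IsFiniteMeasure μ] (ε : ℝ), 0 < ε → ε ≤ 1 →
      ∀ (F : Finset (LatticeIndex d)) (f : LatticeIndex d → E d → ℂ),
        (∀ j ∈ F, IsDominant s ε μ j) → (∀ j ∈ F, IsBump μ (node j) (rad j) A (f j)) →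
        ∀ a : LatticeIndex d → ℂ,
          ∫ x, ‖∑ j ∈ F, a j * f j x‖ ^ 2 ∂μ ≤ C * ∑ j ∈ F, ‖a j‖ ^ 2 * mass μ j := by
  have hA0 : 0 ≤ A := by linarith
  obtain ⟨C1, hC10, hC1⟩ := exists_sum_overlap_left_le d hA0
  obtain ⟨C2, hC20, hC2⟩ := exists_sum_overlap_right_le d A
  set D : ℝ → ℝ := fun A => (2 * (d + 1)) ^ s * (16 * (d + 1)) * (4 * A) * A ^ s with hD
  have hD0 : ∀ A, 0 ≤ A → 0 ≤ D A := fun A hA => by simp only [hD]; positivity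
  refine ⟨A * D A * (C2 * D (2 * A + 1) + C1),
    by have := hD0 A hA0; have := hD0 (2 * A + 1) (by linarith); positivity,
    fun μ _ ε hε hε1 F f hdom hb a => ?_⟩
  have hDA := hD0 A hA0
  set I : LatticeIndex d → LatticeIndex d → ℂ := fun j k =>
    ∫ x, f j x * starRingEnd ℂ (f k x) ∂μ with hI
  -- the inner products are bounded by the overlaps
  have hle : ∀ j ∈ F, ∀ k ∈ F, rad k ≤ rad j → ‖I j k‖ ≤ A * D A * overlap A μ j k := by
    intro j hj k hk hjk
    have hrj := rad_pos j
    have hrk := rad_pos k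
    by_cases hdist : dist (node j : E d) (node k) < 2 * A * rad j
    · rw [overlap, if_pos ⟨hjk, hdist⟩]
      refine ((hb j hj).norm_integral_mul_le hrj (hb k hk)).trans ?_
      have := (hdom k hk).measureReal_dilate_le hs hε hε1 hA
      calc _ ≤ A * (rad k / rad j * (D A * mass μ k)) := by gcongr
        _ = _ := by ring
    · have : I j k = 0 := (hb j hj).integral_mul_eq_zero (hb k hk) (by nlinarith)
      rw [this, norm_zero]
      have := overlap_nonneg A μ j k
      positivity
  have hIsymm : ∀ j k, ‖I j k‖ = ‖I k j‖ := by
    intro j k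
    rw [← RCLike.norm_conj (I j k), ← integral_conj]
    simp only [map_mul, RingHomCompTriple.comp_apply, RingHom.id_apply, hI]
    congr 2
    funext x
    rw [mul_comm]
  have hI2 : ∀ j ∈ F, ∀ k ∈ F, ‖I j k‖ ≤ A * D A * (overlap A μ j k + overlap A μ k j) := by
    intro j hj k hk
    have h1 := overlap_nonneg A μ j k
    have h2 := overlap_nonneg A μ k j
    rcases le_total (rad k) (rad j) with h | h
    · refine (hle j hj k hk h).trans ?_
      gcongr
      linarith
    · rw [hIsymm]
      refine (hle k hk j hj h).trans ?_
      gcongr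
      linarith
  -- expansion of the square
  have hexp : ((∫ x, ‖∑ j ∈ F, a j * f j x‖ ^ 2 ∂μ : ℝ) : ℂ) =
      ∑ j ∈ F, ∑ k ∈ F, a j * starRingEnd ℂ (a k) * I j k := by
    rw [← integral_complex_ofReal]
    have e : ∀ x, ((‖∑ j ∈ F, a j * f j x‖ ^ 2 : ℝ) : ℂ) =
        ∑ j ∈ F, ∑ k ∈ F, a j * starRingEnd ℂ (a k) * (f j x * starRingEnd ℂ (f k x)) := by
      intro x
      push_cast
      rw [← Complex.mul_conj', map_sum, Finset.sum_mul_sum]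
      refine Finset.sum_congr rfl fun j _ => Finset.sum_congr rfl fun k _ => ?_
      rw [map_mul]
      ring
    simp_rw [e]
    have hint : ∀ j ∈ F, ∀ k ∈ F, Integrable
        (fun x => a j * starRingEnd ℂ (a k) * (f j x * starRingEnd ℂ (f k x))) μ := by
      intro j hj k hk
      apply Integrable.const_mul
      refine ((hb j hj).isLipZero.integrable μ).norm.mono' ?_ (Eventually.of_forall fun w => ?_)
      · exact ((hb j hj).isLipZero.continuous.mul
          (Complex.continuous_conj.comp (hb k hk).isLipZero.continuous)).aestronglyMeasurable
      · rw [norm_mul, RCLike.norm_conj]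
        exact mul_le_of_le_one_right (norm_nonneg _) ((hb k hk).norm_le w)
    rw [integral_finsetSum _ fun j hj => integrable_finsetSum _ fun k hk => hint j hj k hk]
    refine Finset.sum_congr rfl fun j hj => ?_
    rw [integral_finsetSum _ fun k hk => hint j hj k hk]
    refine Finset.sum_congr rfl fun k hk => ?_
    rw [integral_const_mul]
  have hpos : 0 ≤ ∫ x, ‖∑ j ∈ F, a j * f j x‖ ^ 2 ∂μ := integral_nonneg fun _ => by positivity
  calc ∫ x, ‖∑ j ∈ F, a j * f j x‖ ^ 2 ∂μ
      = ‖((∫ x, ‖∑ j ∈ F, a j * f j x‖ ^ 2 ∂μ : ℝ) : ℂ)‖ := by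
        rw [Complex.norm_real, Real.norm_of_nonneg hpos]
    _ ≤ ∑ j ∈ F, ∑ k ∈ F, ‖a j‖ * ‖a k‖ * ‖I j k‖ := by
        rw [hexp]
        refine (norm_sum_le _ _).trans (Finset.sum_le_sum fun j _ => ?_)
        refine (norm_sum_le _ _).trans (Finset.sum_le_sum fun k _ => ?_)
        rw [norm_mul, norm_mul, RCLike.norm_conj]
    _ ≤ ∑ j ∈ F, ∑ k ∈ F, A * D A * ((‖a j‖ ^ 2 + ‖a k‖ ^ 2) / 2 *
          (overlap A μ j k + overlap A μ k j)) := by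
        refine Finset.sum_le_sum fun j hj => Finset.sum_le_sum fun k hk => ?_
        have h1 := overlap_nonneg A μ j k
        have h2 := overlap_nonneg A μ k j
        have h3 : ‖a j‖ * ‖a k‖ ≤ (‖a j‖ ^ 2 + ‖a k‖ ^ 2) / 2 := by
          nlinarith [sq_nonneg (‖a j‖ - ‖a k‖)]
        calc _ ≤ (‖a j‖ ^ 2 + ‖a k‖ ^ 2) / 2 *
              (A * D A * (overlap A μ j k + overlap A μ k j)) := by
              gcongr
              exact hI2 j hj k hk
          _ = _ := by ring
    _ = A * D A * (∑ j ∈ F, ‖a j‖ ^ 2 * ∑ k ∈ F, overlap A μ j k +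
          ∑ k ∈ F, ‖a k‖ ^ 2 * ∑ j ∈ F, overlap A μ j k) := by
        have e1 : ∑ j ∈ F, ∑ k ∈ F, ((‖a j‖ ^ 2 + ‖a k‖ ^ 2) / 2 *
          (overlap A μ j k + overlap A μ k j)) =
          ∑ j ∈ F, ∑ k ∈ F, ((‖a j‖ ^ 2 + ‖a k‖ ^ 2) / 2 * overlap A μ j k) +
          ∑ j ∈ F, ∑ k ∈ F, ((‖a j‖ ^ 2 + ‖a k‖ ^ 2) / 2 * overlap A μ k j) := by
          simp_rw [mul_add, Finset.sum_add_distrib]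
        have e2 : ∑ j ∈ F, ∑ k ∈ F, ((‖a j‖ ^ 2 + ‖a k‖ ^ 2) / 2 * overlap A μ k j) =
            ∑ j ∈ F, ∑ k ∈ F, ((‖a j‖ ^ 2 + ‖a k‖ ^ 2) / 2 * overlap A μ j k) := by
          rw [Finset.sum_comm]
          simp_rw [add_comm]
        have e3 : ∑ k ∈ F, ‖a k‖ ^ 2 * ∑ j ∈ F, overlap A μ j k =
            ∑ j ∈ F, ∑ k ∈ F, ‖a k‖ ^ 2 * overlap A μ j k := by
          rw [Finset.sum_comm]
          simp_rw [Finset.mul_sum]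
        have e0 : ∑ j ∈ F, ∑ k ∈ F, A * D A * ((‖a j‖ ^ 2 + ‖a k‖ ^ 2) / 2 *
            (overlap A μ j k + overlap A μ k j)) = A * D A * ∑ j ∈ F, ∑ k ∈ F,
            ((‖a j‖ ^ 2 + ‖a k‖ ^ 2) / 2 * (overlap A μ j k + overlap A μ k j)) := by
          simp_rw [Finset.mul_sum]
        rw [e0, e1, e2, e3]
        congr 1
        simp_rw [Finset.mul_sum, ← Finset.sum_add_distrib]
        refine Finset.sum_congr rfl fun j _ => Finset.sum_congr rfl fun k _ => ?_
        ring
    _ ≤ A * D A * (∑ j ∈ F, ‖a j‖ ^ 2 * (C2 * (D (2 * A + 1) * mass μ j)) +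
          ∑ k ∈ F, ‖a k‖ ^ 2 * (C1 * mass μ k)) := by
        gcongr with j hj k hk
        · refine (hC2 μ F j).trans ?_
          gcongr
          exact (hdom j hj).measureReal_dilate_le hs hε hε1 (by linarith)
        · exact hC1 μ F k
    _ = _ := by
        rw [← Finset.sum_add_distrib, Finset.mul_sum, Finset.mul_sum]
        refine Finset.sum_congr rfl fun j _ => ?_
        ring

/-- Duality form of Bessel's inequality for vector-valued coefficients, obtained coordinate by
coordinate. -/
lemma sum_sq_div_le_of_forall_norm_sum_le {ι : Type*} (F : Finset ι) (w : ι → ℝ)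
    (hw : ∀ j ∈ F, 0 < w j) (v : ι → V m) {A C : ℝ} (hC : 0 ≤ C)
    (h : ∀ a : ι → ℂ, ‖∑ j ∈ F, a j • v j‖ ≤ A * √(C * ∑ j ∈ F, ‖a j‖ ^ 2 * w j)) :
    ∑ j ∈ F, ‖v j‖ ^ 2 / w j ≤ m * (A ^ 2 * C) := by
  have key : ∀ i : Fin m, ∑ j ∈ F, ‖v j i‖ ^ 2 / w j ≤ A ^ 2 * C := by
    intro i
    set S := ∑ j ∈ F, ‖v j i‖ ^ 2 / w j with hS
    have hS0 : 0 ≤ S := Finset.sum_nonneg fun j hj => by have := hw j hj; positivity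
    -- the extremal coefficients for the coordinate `i`
    set a : ι → ℂ := fun j => starRingEnd ℂ (v j i) / w j with ha
    have h1 := h a
    have e1 : ∑ j ∈ F, ‖a j‖ ^ 2 * w j = S := by
      refine Finset.sum_congr rfl fun j hj => ?_
      have := hw j hj
      simp only [ha, norm_div, RCLike.norm_conj, Complex.norm_real, Real.norm_of_nonneg this.le]
      field_simp
    have e2 : (∑ j ∈ F, a j • v j) i = (S : ℂ) := by
      simp only [hS, WithLp.ofLp_sum, Finset.sum_apply, PiLp.smul_apply, smul_eq_mul]
      push_cast
      refine Finset.sum_congr rfl fun j hj => ?_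
      rw [← Complex.conj_mul']
      simp only [ha]
      ring
    have h2 : S ≤ A * √(C * S) := by
      have := (PiLp.norm_apply_le (∑ j ∈ F, a j • v j) i).trans h1
      rwa [e2, e1, Complex.norm_real, Real.norm_of_nonneg hS0] at this
    rcases hS0.eq_or_lt with h0 | hpos
    · rw [← h0]; positivity
    have h3 : S ^ 2 ≤ A ^ 2 * (C * S) := by
      calc S ^ 2 ≤ (A * √(C * S)) ^ 2 := by gcongr
        _ = _ := by rw [mul_pow, Real.sq_sqrt (by positivity)]
    nlinarith
  calc ∑ j ∈ F, ‖v j‖ ^ 2 / w j = ∑ j ∈ F, ∑ i, ‖v j i‖ ^ 2 / w j := by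
        refine Finset.sum_congr rfl fun j _ => ?_
        rw [EuclideanSpace.norm_sq_eq, Finset.sum_div]
    _ = ∑ i, ∑ j ∈ F, ‖v j i‖ ^ 2 / w j := Finset.sum_comm
    _ ≤ ∑ _i : Fin m, A ^ 2 * C := Finset.sum_le_sum fun i _ => key i
    _ = _ := by simp

lemma pairing_one_eq_cutoff {K : E d → V m} {μ : Measure (E d)} [SFinite μ] {R : ℝ} (hR : 0 < R)
    (hμ : μ (Metric.ball 0 R)ᶜ = 0) (f : E d → ℂ) :
    pairing K μ f (fun _ => 1) = pairing K μ f (fun x => (cutoff d R x : ℂ)) := by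
  have h0 : ∀ᵐ x ∂μ, x ∈ Metric.ball (0 : E d) R := mem_ae_iff.2 hμ
  have h1 : ∀ᵐ z ∂(μ.prod μ), z.1 ∈ Metric.ball (0 : E d) R :=
    Measure.quasiMeasurePreserving_fst.ae h0
  have h2 : ∀ᵐ z ∂(μ.prod μ), z.2 ∈ Metric.ball (0 : E d) R :=
    Measure.quasiMeasurePreserving_snd.ae h0
  refine integral_congr_ae ?_
  filter_upwards [h1, h2] with z hz1 hz2
  rw [Metric.mem_ball, dist_zero_right] at hz1 hz2
  simp only [cutoff_eq_one hR hz1.le, cutoff_eq_one hR hz2.le, Complex.ofReal_one]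

/-- Bessel's inequality: the pairings of bumps at dominant balls with the function `1` are square
summable, after normalization. -/
lemma IsCZKernel.exists_sum_pairing_sq_le {s α A : ℝ} {K : E d → V m} (hK : IsCZKernel s α K)
    (hs : 0 < s) (hα : 0 < α) (hA : 1 ≤ A) :
    ∃ C : ℝ, 0 ≤ C ∧ ∀ (μ : Measure (E d)) [IsFiniteMeasure μ] (B R ε : ℝ), 0 < ε → ε ≤ 1 →
      0 ≤ B → 0 < R → μ (Metric.ball 0 R)ᶜ = 0 → IsDiffuse s μ → PairingBound K μ B →
      ∀ (F : Finset (LatticeIndex d)) (f : LatticeIndex d → E d → ℂ),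
        (∀ j ∈ F, IsDominant s ε μ j) → (∀ j ∈ F, IsBump μ (node j) (rad j) A (f j)) →
        ∑ j ∈ F, ‖pairing K μ (f j) (fun _ => 1)‖ ^ 2 / mass μ j ≤ C * B ^ 2 * μ.real univ := by
  obtain ⟨C, hC0, hC⟩ := exists_integral_sq_sum_bump_le d hs hA
  refine ⟨m * C, by positivity, fun μ _ B R ε hε hε1 hB hR hμR hμd hbd F f hdom hb => ?_⟩
  simp_rw [pairing_one_eq_cutoff hR hμR]
  set χ : E d → ℂ := fun x => (cutoff d R x : ℂ) with hχ
  have hχL : IsLipZero χ := isLipZero_cutoff hR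
  have hχ2 : ∫ x, ‖χ x‖ ^ 2 ∂μ ≤ μ.real univ := by
    calc _ ≤ ∫ _x, (1 : ℝ) ∂μ := by
          refine integral_mono hχL.integrable_sq (integrable_const _) fun x => ?_
          simp only [hχ]
          rw [Complex.norm_real, Real.norm_of_nonneg (cutoff_nonneg _ _)]
          exact pow_le_one₀ (cutoff_nonneg _ _) (cutoff_le_one _ _)
      _ = _ := by simp
  refine (sum_sq_div_le_of_forall_norm_sum_le (A := B * √(μ.real univ)) (C := C) F (mass μ)
    (fun j hj => (hdom j hj).1) (fun j => pairing K μ (f j) χ) hC0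
    fun a => ?_).trans_eq ?_
  · rw [← hK.pairing_finset_sum hα hμd F a f (fun j hj => (hb j hj).isLipZero) hχL]
    refine (hbd _ _ (isLipZero_finset_sum F a f fun j hj => (hb j hj).isLipZero) hχL).trans ?_
    calc _ ≤ B * √(C * ∑ j ∈ F, ‖a j‖ ^ 2 * mass μ j) * √(μ.real univ) := by
          gcongr
          exact hC μ ε hε hε1 F f hdom hb a
      _ = _ := by ring
  · rw [mul_pow, Real.sq_sqrt measureReal_nonneg]
    ring

end Bessel

/-! ### Vague limits of measures along ultrafilters -/

/-- `ν` is the vague limit of the measures `μ n` along the filter `U`. -/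
def IsVagueLimit {d : ℕ} (U : Filter ℕ) (μ : ℕ → Measure (E d)) (ν : Measure (E d)) : Prop :=
  ∀ g : E d → ℝ, Continuous g → HasCompactSupport g →
    Tendsto (fun n => ∫ x, g x ∂(μ n)) U (𝓝 (∫ x, g x ∂ν))

section Vague

variable {d : ℕ} {μ : ℕ → Measure (E d)} {ν : Measure (E d)}

/-- Vague compactness: locally uniformly bounded measures have a vague limit along every
ultrafilter, by the Riesz–Markov–Kakutani theorem. -/
lemma exists_isVagueLimit (U : Ultrafilter ℕ) [∀ n, IsLocallyFiniteMeasure (μ n)] {M : ℝ → ℝ}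
    (hM : ∀ R n, (μ n).real (Metric.ball 0 R) ≤ M R) :
    ∃ ν : Measure (E d), IsLocallyFiniteMeasure ν ∧ IsVagueLimit U μ ν := by
  have hex : ∀ g : CompactlySupportedContinuousMap (E d) ℝ, ∃ l : ℝ,
      Tendsto (fun n => ∫ x, g x ∂(μ n)) U (𝓝 l) := by
    intro g
    obtain ⟨C, hC⟩ := g.hasCompactSupport.exists_bound_of_continuous g.continuous
    obtain ⟨R, hR⟩ := g.hasCompactSupport.isCompact.isBounded.subset_ball (0 : E d)
    have hb : ∀ n, ∫ x, g x ∂(μ n) ∈ Metric.closedBall (0 : ℝ) (max C 0 * M R) := by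
      intro n
      rw [mem_closedBall_zero_iff]
      rw [← setIntegral_eq_integral_of_forall_compl_eq_zero (s := Metric.ball 0 R) fun x hx =>
        image_eq_zero_of_notMem_tsupport fun h => hx (hR h)]
      refine (norm_setIntegral_le_of_norm_le_const measure_ball_lt_top
        fun x _ => (hC x).trans (le_max_left C 0)).trans ?_
      gcongr
      exact hM R n
    obtain ⟨l, -, hl⟩ := (isCompact_closedBall (0 : ℝ) (max C 0 * M R)).ultrafilter_le_nhds
      (U.map fun n => ∫ x, g x ∂(μ n)) (by
        rw [Ultrafilter.coe_map, le_principal_iff]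
        exact mem_map.2 (Eventually.of_forall hb))
    exact ⟨l, hl⟩
  choose l hl using hex
  let Φ₀ : CompactlySupportedContinuousMap (E d) ℝ →ₗ[ℝ] ℝ :=
    { toFun := l
      map_add' := fun f g => by
        refine tendsto_nhds_unique (hl (f + g)) (((hl f).add (hl g)).congr fun n => ?_)
        exact (integral_add' f.integrable g.integrable).symm
      map_smul' := fun c f => by
        refine tendsto_nhds_unique (hl (c • f)) (((hl f).const_mul c).congr fun n => ?_)
        exact (integral_smul c f).symm }
  let Φ := PositiveLinearMap.mk₀ Φ₀ fun f hf =>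
    ge_of_tendsto (hl f) (Eventually.of_forall fun n => integral_nonneg hf)
  refine ⟨RealRMK.rieszMeasure Φ, inferInstance, fun g hg hgc => ?_⟩
  have h1 := RealRMK.integral_rieszMeasure Φ ⟨⟨g, hg⟩, hgc⟩
  have h2 := hl ⟨⟨g, hg⟩, hgc⟩
  change ∫ x, g x ∂_ = l _ at h1
  rw [h1]
  exact h2

variable {W : Type*} [NormedAddCommGroup W] [NormedSpace ℝ W] [FiniteDimensional ℝ W]

lemma IsVagueLimit.tendsto_integral {U : Filter ℕ} (h : IsVagueLimit U μ ν)
    [∀ n, IsLocallyFiniteMeasure (μ n)] [IsLocallyFiniteMeasure ν] {g : E d → W}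
    (hg : Continuous g) (hgc : HasCompactSupport g) :
    Tendsto (fun n => ∫ x, g x ∂(μ n)) U (𝓝 (∫ x, g x ∂ν)) := by
  have := FiniteDimensional.complete ℝ W
  let b := Module.finBasis ℝ W
  let c : Fin (Module.finrank ℝ W) → W →L[ℝ] ℝ := fun i => (b.coord i).toContinuousLinearMap
  have e : ∀ (ρ : Measure (E d)) [IsLocallyFiniteMeasure ρ],
      ∫ x, g x ∂ρ = ∑ i, (∫ x, c i (g x) ∂ρ) • b i := by
    intro ρ _
    conv_lhs => rw [← b.sum_repr (∫ x, g x ∂ρ)]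
    refine Finset.sum_congr rfl fun i _ => ?_
    rw [(c i).integral_comp_comm (hg.integrable_of_hasCompactSupport hgc)]
    rfl
  simp_rw [e]
  refine tendsto_finsetSum _ fun i _ => Tendsto.smul_const ?_ _
  exact h _ ((c i).continuous.comp hg) (hgc.comp_left (map_zero (c i)))

/-- The squares of vaguely convergent measures converge vaguely. -/
lemma IsVagueLimit.tendsto_integral_prod {U : Filter ℕ} (h : IsVagueLimit U μ ν)
    [∀ n, IsLocallyFiniteMeasure (μ n)] [IsLocallyFiniteMeasure ν] {M : ℝ → ℝ}
    (hM : ∀ R n, (μ n).real (Metric.ball 0 R) ≤ M R) {g : E d × E d → W}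
    (hg : Continuous g) (hgc : HasCompactSupport g) :
    Tendsto (fun n => ∫ z, g z ∂((μ n).prod (μ n))) U (𝓝 (∫ z, g z ∂(ν.prod ν))) := by
  have := FiniteDimensional.complete ℝ W
  obtain ⟨R, hR0, hR⟩ := hgc.isCompact.isBounded.subset_ball_lt 0 (0 : E d × E d)
  have hsupp : ∀ x y, (x ∉ Metric.ball (0 : E d) R ∨ y ∉ Metric.ball (0 : E d) R) →
      g (x, y) = 0 := by
    intro x y hxy
    apply image_eq_zero_of_notMem_tsupport
    intro hmem
    have h1 : ((x, y) : E d × E d) ∈ Metric.ball (0 : E d) R ×ˢ Metric.ball (0 : E d) R := by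
      rw [ball_prod_same]
      exact hR hmem
    rcases hxy with h2 | h2
    · exact h2 h1.1
    · exact h2 h1.2
  -- a common bound for the masses of the ball containing the supports
  set M' := max (max (M R) (ν.real (Metric.ball 0 R))) 1 with hM'
  have hM'0 : 0 < M' := lt_max_of_lt_right one_pos
  have hgx : ∀ x, Continuous fun y => g (x, y) := fun x => hg.comp (by fun_prop)
  have hgxc : ∀ x, HasCompactSupport fun y => g (x, y) := fun x =>
    HasCompactSupport.of_support_subset_isCompact (isCompact_closedBall (0 : E d) R) fun y hy => by
      by_contra h'
      exact hy (hsupp x y (Or.inr fun h'' => h' (Metric.ball_subset_closedBall h'')))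
  have hdiff : ∀ (ρ : Measure (E d)) [IsLocallyFiniteMeasure ρ], ρ.real (Metric.ball 0 R) ≤ M' →
      ∀ x x' c, 0 ≤ c → (∀ y, ‖g (x, y) - g (x', y)‖ ≤ c) →
      ‖∫ y, g (x, y) ∂ρ - ∫ y, g (x', y) ∂ρ‖ ≤ c * M' := by
    intro ρ _ hρ x x' c hc hb
    rw [← integral_sub ((hgx x).integrable_of_hasCompactSupport (hgxc x))
      ((hgx x').integrable_of_hasCompactSupport (hgxc x'))]
    rw [← setIntegral_eq_integral_of_forall_compl_eq_zero (s := Metric.ball 0 R) fun y hy => by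
      rw [hsupp x y (Or.inr hy), hsupp x' y (Or.inr hy), sub_zero]]
    refine (norm_setIntegral_le_of_norm_le_const measure_ball_lt_top fun y _ => hb y).trans ?_
    gcongr
  have hν : ν.real (Metric.ball 0 R) ≤ M' := (le_max_right _ _).trans (le_max_left _ _)
  have hμ : ∀ n, (μ n).real (Metric.ball 0 R) ≤ M' := fun n =>
    (hM R n).trans ((le_max_left _ _).trans (le_max_left _ _))
  set F : E d → W := fun x => ∫ y, g (x, y) ∂ν with hF
  have huc : ∀ ε : ℝ, 0 < ε → ∃ δ : ℝ, 0 < δ ∧ ∀ x x' y, dist x x' < δ →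
      ‖g (x, y) - g (x', y)‖ ≤ ε := by
    intro ε hε
    obtain ⟨δ, hδ, hδ'⟩ := Metric.uniformContinuous_iff.1
      (hgc.uniformContinuous_of_continuous hg) ε hε
    refine ⟨δ, hδ, fun x x' y hxx => ?_⟩
    rw [← dist_eq_norm]
    refine (hδ' ?_).le
    rw [Prod.dist_eq, dist_self, max_eq_left dist_nonneg]
    exact hxx
  -- `F` is an admissible test function, so it remains to compare it with the inner integrals
  -- against `μ n`
  have hFc : Continuous F := by
    rw [Metric.continuous_iff]
    intro x ε hε
    obtain ⟨δ, hδ, hδ'⟩ := huc (ε / (2 * M')) (by positivity)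
    refine ⟨δ, hδ, fun x' hx' => ?_⟩
    rw [dist_eq_norm]
    refine (hdiff ν hν x' x _ (by positivity) fun y => hδ' x' x y hx').trans_lt ?_
    have : ε / (2 * M') * M' = ε / 2 := by field_simp
    linarith
  have hFs : ∀ x, x ∉ Metric.ball (0 : E d) R → F x = 0 := fun x hx => by
    simp [hF, hsupp x _ (Or.inl hx)]
  have hFcs : HasCompactSupport F :=
    HasCompactSupport.of_support_subset_isCompact (isCompact_closedBall (0 : E d) R) fun x hx => by
      by_contra h'
      exact hx (hFs x fun h'' => h' (Metric.ball_subset_closedBall h''))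
  have hprod : ∀ (ρ : Measure (E d)) [IsLocallyFiniteMeasure ρ],
      ∫ z, g z ∂(ρ.prod ρ) = ∫ x, ∫ y, g (x, y) ∂ρ ∂ρ := fun ρ _ =>
    integral_prod _ (hg.integrable_of_hasCompactSupport hgc)
  simp_rw [hprod]
  -- uniform convergence of the inner integrals
  have hunif : ∀ ε : ℝ, 0 < ε → ∀ᶠ n in U, ∀ x, ‖∫ y, g (x, y) ∂(μ n) - F x‖ ≤ ε := by
    intro ε hε
    obtain ⟨δ, hδ, hδ'⟩ := huc (ε / (3 * M')) (by positivity)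
    have e3 : ε / (3 * M') * M' = ε / 3 := by field_simp
    obtain ⟨T, -, hTfin, hT⟩ := (isCompact_closedBall (0 : E d) R).finite_cover_balls hδ
    have h1 : ∀ᶠ n in U, ∀ x ∈ T, ‖∫ y, g (x, y) ∂(μ n) - F x‖ ≤ ε / 3 := by
      rw [eventually_all_finite hTfin]
      intro x _
      have := (h.tendsto_integral (hgx x) (hgxc x)).eventually
        (Metric.closedBall_mem_nhds _ (show 0 < ε / 3 by positivity))
      filter_upwards [this] with n hn
      rwa [← dist_eq_norm]
    filter_upwards [h1] with n hn x
    by_cases hx : x ∈ Metric.ball (0 : E d) R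
    · obtain ⟨x', hx'T, hx'⟩ := mem_iUnion₂.1 (hT (Metric.ball_subset_closedBall hx))
      have a1 := hdiff (μ n) (hμ n) x x' _ (by positivity) fun y => hδ' x x' y hx'
      have a2 := hdiff ν hν x x' _ (by positivity) fun y => hδ' x x' y hx'
      have a3 := hn x' hx'T
      rw [e3] at a1 a2
      have e : ∫ y, g (x, y) ∂(μ n) - F x = (∫ y, g (x, y) ∂(μ n) - ∫ y, g (x', y) ∂(μ n)) +
        (∫ y, g (x', y) ∂(μ n) - F x') - (F x - F x') := by abel
      rw [e]
      refine (norm_sub_le _ _).trans ?_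
      have := norm_add_le (∫ y, g (x, y) ∂(μ n) - ∫ y, g (x', y) ∂(μ n))
        (∫ y, g (x', y) ∂(μ n) - F x')
      simp only [hF] at a1 a2 a3 this ⊢
      linarith
    · rw [hFs x hx]
      simp [hsupp x _ (Or.inl hx), hε.le]
  have hlim := h.tendsto_integral hFc hFcs
  rw [Metric.tendsto_nhds] at hlim ⊢
  intro ε hε
  filter_upwards [hlim (ε / 2) (by positivity), hunif (ε / (4 * M')) (by positivity)] with n h1 h2
  have h3 : ‖∫ x, ∫ y, g (x, y) ∂(μ n) ∂(μ n) - ∫ x, F x ∂(μ n)‖ ≤ ε / (4 * M') * M' := by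
    have hi : Integrable (fun x => ∫ y, g (x, y) ∂(μ n)) (μ n) :=
      (hg.integrable_of_hasCompactSupport (μ := (μ n).prod (μ n)) hgc).integral_prod_left
    rw [← integral_sub hi (hFc.integrable_of_hasCompactSupport hFcs)]
    rw [← setIntegral_eq_integral_of_forall_compl_eq_zero (s := Metric.ball 0 R) fun x hx => by
      rw [hFs x hx]
      simp [hsupp x _ (Or.inl hx)]]
    refine (norm_setIntegral_le_of_norm_le_const measure_ball_lt_top fun x _ => h2 x).trans ?_
    gcongr
    exact hμ n
  have e4 : ε / (4 * M') * M' = ε / 4 := by field_simp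
  rw [e4, ← dist_eq_norm] at h3
  refine (dist_triangle _ (∫ x, F x ∂(μ n)) _).trans_lt ?_
  linarith

lemma continuous_cutoff_sub (y : E d) (t : ℝ) : Continuous fun x => cutoff d t (x - y) :=
  continuous_cutoff.comp (by fun_prop)

lemma hasCompactSupport_cutoff_sub (y : E d) {t : ℝ} (ht : 0 < t) :
    HasCompactSupport fun x => cutoff d t (x - y) := by
  refine HasCompactSupport.of_support_subset_isCompact (isCompact_closedBall y (2 * t)) fun x hx => ?_
  by_contra h
  rw [Metric.mem_closedBall, not_le, dist_eq_norm] at h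
  exact hx (cutoff_eq_zero ht h.le)

lemma measureReal_ball_le_integral_cutoff (ρ : Measure (E d)) [IsLocallyFiniteMeasure ρ] (y : E d)
    {t : ℝ} (ht : 0 < t) : ρ.real (Metric.ball y t) ≤ ∫ x, cutoff d t (x - y) ∂ρ := by
  rw [← integral_indicator_one Metric.isOpen_ball.measurableSet]
  refine integral_mono ?_ ((continuous_cutoff_sub y t).integrable_of_hasCompactSupport
    (hasCompactSupport_cutoff_sub y ht)) fun x => ?_
  · exact (integrable_indicator_iff Metric.isOpen_ball.measurableSet).2
      (integrableOn_const measure_ball_lt_top.ne)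
  · by_cases hx : x ∈ Metric.ball y t
    · have : cutoff d t (x - y) = 1 := by
        rw [Metric.mem_ball, dist_eq_norm] at hx
        exact cutoff_eq_one ht hx.le
      simp [hx, this]
    · simpa [hx] using cutoff_nonneg t (x - y)

lemma IsVagueLimit.measure_ball_le {U : Filter ℕ} [U.NeBot] (h : IsVagueLimit U μ ν)
    [∀ n, IsLocallyFiniteMeasure (μ n)] [IsLocallyFiniteMeasure ν] {y : E d} {t : ℝ} (ht : 0 < t)
    {c : ℕ → ℝ} {c' : ℝ} (hc : ∀ n, (μ n).real (Metric.ball y (2 * t)) ≤ c n)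
    (hlim : Tendsto c U (𝓝 c')) : ν (Metric.ball y t) ≤ ENNReal.ofReal c' := by
  have h1 := h _ (continuous_cutoff_sub y t) (hasCompactSupport_cutoff_sub y ht)
  have h2 : ∀ n, ∫ x, cutoff d t (x - y) ∂(μ n) ≤ c n := by
    intro n
    refine le_trans ?_ (hc n)
    rw [← integral_indicator_one Metric.isOpen_ball.measurableSet]
    refine integral_mono ((continuous_cutoff_sub y t).integrable_of_hasCompactSupport
      (hasCompactSupport_cutoff_sub y ht)) ?_ fun x => ?_
    · exact (integrable_indicator_iff Metric.isOpen_ball.measurableSet).2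
        (integrableOn_const measure_ball_lt_top.ne)
    · by_cases hx : x ∈ Metric.ball y (2 * t)
      · simpa [hx] using cutoff_le_one t (x - y)
      · have : cutoff d t (x - y) = 0 := by
          rw [Metric.mem_ball, not_lt, dist_eq_norm] at hx
          exact cutoff_eq_zero ht hx
        simp [hx, this]
  have h3 := measureReal_ball_le_integral_cutoff ν y ht
  rw [← ofReal_measureReal (measure_ball_lt_top.ne)]
  exact ENNReal.ofReal_le_ofReal (h3.trans (le_of_tendsto_of_tendsto h1 hlim (Eventually.of_forall h2)))

lemma IsVagueLimit.ne_zero {U : Filter ℕ} [U.NeBot] (h : IsVagueLimit U μ ν)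
    [∀ n, IsLocallyFiniteMeasure (μ n)] {y : E d} {t : ℝ} (ht : 0 < t)
    (hμ : ∀ n, 1 ≤ (μ n).real (Metric.ball y t)) : ν ≠ 0 := by
  rintro rfl
  have h1 := h _ (continuous_cutoff_sub y t) (hasCompactSupport_cutoff_sub y ht)
  rw [integral_zero_measure] at h1
  have := ge_of_tendsto h1 (Eventually.of_forall fun n =>
    (hμ n).trans (measureReal_ball_le_integral_cutoff (μ n) y ht))
  linarith

end Vague

/-! ### Limits of pairings -/

section PairingLimit

variable {d m : ℕ} {s α : ℝ} {K : E d → V m}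

lemma IsCZKernel.integrable_pairDensity_smul_regKernel (hK : IsCZKernel s α K) (hs : 0 < s)
    (hα : 0 < α) {μ : Measure (E d)} (hμ : IsDiffuse s μ) {f φ : E d → ℂ} (hf : IsLipZero f)
    (hφ : IsLipZero φ) {δ : ℝ} (hδ : 0 < δ) :
    Integrable (fun z : E d × E d => pairDensity f φ z • regKernel s α K δ (z.1 - z.2))
      (μ.prod μ) := by
  obtain ⟨g, hg, hle⟩ := exists_pairing_majorant (m := m) hf hφ hμ
  refine hg.mono' ?_ (Eventually.of_forall fun z => hle z _ fun hne =>
      (CZO.norm_regKernel_le hs hα hδ _).trans (hK.norm_le _ (sub_ne_zero.2 hne)))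
  have h1 : Continuous fun z : E d × E d => regKernel s α K δ (z.1 - z.2) :=
    (hK.continuous_regKernel hs hα hδ).comp (by fun_prop)
  exact ((continuous_pairDensity hf hφ).smul h1).aestronglyMeasurable

/-- The error made in the pairing by regularizing the kernel, for measures with some growth at small
scales. -/
lemma IsCZKernel.norm_pairing_sub_regKernel_le (hK : IsCZKernel s α K) (hs : 0 < s)
    (hα : 0 < α) {μ : Measure (E d)} [IsLocallyFiniteMeasure μ] (hμ : IsDiffuse s μ)
    {f φ : E d → ℂ} (hf : IsLipZero f) (hφ : IsLipZero φ) {L R : ℝ} (hL0 : 0 ≤ L)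
    (hL : ∀ z, ‖pairDensity f φ z‖ ≤ L * dist z.1 z.2)
    (hR : ∀ z, pairDensity f φ z ≠ 0 → z.1 ∈ Metric.ball 0 R ∧ z.2 ∈ Metric.ball 0 R)
    {δ σ Λ : ℝ} (hδ : 0 < δ) (hΛ : 0 ≤ Λ) (hσ : 0 < σ) (hσs : s - 1 < σ)
    (hgrowth : ∀ x ∈ Metric.ball (0 : E d) R, ∀ r, 0 < r → r ≤ δ →
      μ (Metric.ball x r) ≤ ENNReal.ofReal (Λ * r ^ σ)) :
    ‖pairing K μ f φ - ∫ z, pairDensity f φ z • regKernel s α K δ (z.1 - z.2) ∂(μ.prod μ)‖ ≤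
      2 * L * (shellConst (s - 1) σ * (Λ * δ ^ (σ - (s - 1)))) * μ.real (Metric.ball 0 R) := by
  have hsc := shellConst_pos (b := s - 1) (σ := σ) hσs.ne'
  rw [pairing_eq, ← integral_sub (hK.integrable_pairing hα hf hφ hμ)
    (hK.integrable_pairDensity_smul_regKernel hs hα hμ hf hφ hδ)]
  refine (norm_integral_le_lintegral_norm _).trans ?_
  apply ENNReal.toReal_le_of_le_ofReal (by positivity)
  set G : E d × E d → ℝ≥0∞ := fun z => (Metric.ball (0 : E d) R).indicator (fun _ => 1) z.1 *
    {z : E d × E d | dist z.1 z.2 < δ}.indicator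
      (fun z => ENNReal.ofReal (2 * L) * ENNReal.ofReal (dist z.1 z.2 ^ (-(s - 1)))) z with hG
  have hm : MeasurableSet {z : E d × E d | dist z.1 z.2 < δ} :=
    measurableSet_lt (by fun_prop) measurable_const
  have hGm : Measurable G := by
    apply Measurable.mul
    · exact (measurable_const.indicator Metric.isOpen_ball.measurableSet).comp measurable_fst
    · exact Measurable.indicator (by fun_prop) hm
  have hle : ∀ z : E d × E d, ENNReal.ofReal ‖pairDensity f φ z • K (z.1 - z.2) -
      pairDensity f φ z • regKernel s α K δ (z.1 - z.2)‖ ≤ G z := by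
    intro z
    rw [← smul_sub]
    by_cases h0 : pairDensity f φ z = 0
    · simp [h0]
    by_cases hz : dist z.1 z.2 < δ
    · simp only [hG]
      rw [indicator_of_mem (hR z h0).1,
        indicator_of_mem (show z ∈ {z : E d × E d | dist z.1 z.2 < δ} from hz), one_mul,
        ← ENNReal.ofReal_mul (by positivity)]
      apply ENNReal.ofReal_le_ofReal
      have hne : z.1 ≠ z.2 := by
        intro h
        apply h0
        have : z = (z.1, z.1) := Prod.ext rfl h.symm
        rw [this, pairDensity_diag]
      have hpos : 0 < dist z.1 z.2 := dist_pos.2 hne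
      have hk := hK.norm_le _ (sub_ne_zero.2 hne)
      rw [← dist_eq_norm] at hk
      rw [norm_smul]
      calc _ ≤ (L * dist z.1 z.2) * (1 / dist z.1 z.2 ^ s + 1 / dist z.1 z.2 ^ s) := by
            gcongr
            · exact hL z
            · refine (norm_sub_le _ _).trans (add_le_add hk ?_)
              exact (CZO.norm_regKernel_le hs hα hδ _).trans hk
        _ = _ := by
            rw [neg_sub, Real.rpow_sub hpos, Real.rpow_one]
            ring
    · rw [regKernel_eq_of_le hδ (by rw [← dist_eq_norm]; exact not_lt.1 hz)]
      simp
  calc _ ≤ ∫⁻ z, G z ∂(μ.prod μ) := lintegral_mono hle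
    _ = ∫⁻ x, ∫⁻ y, G (x, y) ∂μ ∂μ := lintegral_prod _ hGm.aemeasurable
    _ ≤ ∫⁻ x, (Metric.ball (0 : E d) R).indicator (fun _ => ENNReal.ofReal (2 * L) *
          ENNReal.ofReal (shellConst (s - 1) σ * (Λ * δ ^ (σ - (s - 1))))) x ∂μ := by
        refine lintegral_mono fun x => ?_
        by_cases hx : x ∈ Metric.ball (0 : E d) R
        · have e : ∀ y, G (x, y) = (Metric.ball x δ).indicator (fun y => ENNReal.ofReal (2 * L) *
              ENNReal.ofReal (dist x y ^ (-(s - 1)))) y := by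
            intro y
            simp only [hG]
            rw [indicator_of_mem hx, one_mul]
            by_cases hy : dist x y < δ
            · rw [indicator_of_mem (show (x, y) ∈ {z : E d × E d | dist z.1 z.2 < δ} from hy),
                indicator_of_mem (by rw [Metric.mem_ball, dist_comm]; exact hy)]
            · rw [indicator_of_notMem (show (x, y) ∉ {z : E d × E d | dist z.1 z.2 < δ} from hy),
                indicator_of_notMem (by rw [Metric.mem_ball, dist_comm]; exact hy)]
          have hmd : Measurable fun y : E d => ENNReal.ofReal (dist x y ^ (-(s - 1))) := by
            have : Measurable fun y : E d => dist x y := measurable_const.dist measurable_id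
            fun_prop
          simp_rw [e]
          rw [lintegral_indicator Metric.isOpen_ball.measurableSet, indicator_of_mem hx,
            lintegral_const_mul _ hmd]
          gcongr
          exact lintegral_ball_dist_rpow_le hΛ hσ hσs hδ (hgrowth x hx)
        · simp [hG, hx]
    _ = _ := by
        rw [lintegral_indicator_const Metric.isOpen_ball.measurableSet,
          ← ENNReal.ofReal_mul (by positivity), ← ofReal_measureReal measure_ball_lt_top.ne,
          ← ENNReal.ofReal_mul (by positivity)]

/-- Bound for the part at infinity of the integral of the transform of a function of mean zero. -/
lemma IsCZKernel.exists_norm_integral_tail_le (hK : IsCZKernel s α K) (hs : 0 < s) (hα : 0 < α)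
    (hα1 : α ≤ 1) : ∃ C : ℝ, 0 ≤ C ∧ ∀ (μ : Measure (E d)) (f g : E d → ℂ) (R₀ R σ Λ : ℝ),
      0 < R₀ → 2 * R₀ ≤ R → 0 ≤ Λ → σ < s + α → Integrable f μ → (∀ y, f y ≠ 0 → ‖y‖ ≤ R₀) →
      ∫ y, f y ∂μ = 0 → (∀ x, ‖g x‖ ≤ 1) → (∀ x, ‖x‖ ≤ R → g x = 0) →
      (∀ r, R ≤ r → μ (Metric.ball 0 r) ≤ ENNReal.ofReal (Λ * r ^ σ)) →
        ‖∫ x, g x • transform K μ f x ∂μ‖ ≤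
          C * R₀ ^ α * (∫ y, ‖f y‖ ∂μ) * (shellConst (s + α) σ * (Λ * R ^ (σ - (s + α)))) := by
  obtain ⟨C, hC0, hC⟩ := hK.exists_norm_transform_le hs hα hα1
  refine ⟨C, hC0, fun μ f g R₀ R σ Λ hR₀ hR hΛ hσ hf hsupp hmean hg1 hg0 hgrowth => ?_⟩
  have hRpos : 0 < R := by linarith
  have hI : 0 ≤ ∫ y, ‖f y‖ ∂μ := integral_nonneg fun _ => norm_nonneg _
  have hsc := shellConst_pos (b := s + α) (σ := σ) hσ.ne
  refine (norm_integral_le_lintegral_norm _).trans ?_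
  apply ENNReal.toReal_le_of_le_ofReal (by positivity)
  set c := C * R₀ ^ α * (∫ y, ‖f y‖ ∂μ) with hc
  have hc0 : 0 ≤ c := by positivity
  have hm : MeasurableSet {x : E d | R ≤ dist 0 x} :=
    measurableSet_le measurable_const (measurable_const.dist measurable_id)
  have hmd : Measurable fun y : E d => ENNReal.ofReal (dist 0 y ^ (-(s + α))) := by
    have : Measurable fun y : E d => dist 0 y := measurable_const.dist measurable_id
    fun_prop
  calc _ ≤ ∫⁻ x, {x : E d | R ≤ dist 0 x}.indicator
        (fun x => ENNReal.ofReal c * ENNReal.ofReal (dist 0 x ^ (-(s + α)))) x ∂μ := by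
        refine lintegral_mono fun x => ?_
        by_cases hx : R ≤ dist 0 x
        · rw [indicator_of_mem (show x ∈ {x : E d | R ≤ dist 0 x} from hx),
            ← ENNReal.ofReal_mul hc0]
          apply ENNReal.ofReal_le_ofReal
          rw [dist_zero_left] at hx ⊢
          rw [norm_smul]
          exact (mul_le_of_le_one_left (norm_nonneg _) (hg1 x)).trans
            (hC μ f R₀ hR₀ hf hsupp hmean x (by linarith))
        · rw [dist_zero_left, not_le] at hx
          simp [hg0 x hx.le]
    _ = ENNReal.ofReal c * ∫⁻ x in {x : E d | R ≤ dist 0 x},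
          ENNReal.ofReal (dist 0 x ^ (-(s + α))) ∂μ := by
        rw [lintegral_indicator hm, lintegral_const_mul _ hmd]
    _ ≤ ENNReal.ofReal c *
          ENNReal.ofReal (shellConst (s + α) σ * (Λ * R ^ (σ - (s + α)))) := by
        gcongr
        exact lintegral_compl_ball_dist_rpow_le hΛ hσ hRpos hgrowth
    _ = _ := by rw [← ENNReal.ofReal_mul hc0]

lemma hasCompactSupport_pairDensity_smul {f φ : E d → ℂ} {R : ℝ}
    (hR : ∀ z, pairDensity f φ z ≠ 0 → z.1 ∈ Metric.ball 0 R ∧ z.2 ∈ Metric.ball 0 R)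
    (k : E d × E d → V m) : HasCompactSupport fun z => pairDensity f φ z • k z := by
  refine HasCompactSupport.of_support_subset_isCompact
    ((isCompact_closedBall (0 : E d) R).prod (isCompact_closedBall (0 : E d) R)) fun z hz => ?_
  have h0 : pairDensity f φ z ≠ 0 := fun h => hz (by simp [h])
  exact ⟨Metric.ball_subset_closedBall (hR z h0).1, Metric.ball_subset_closedBall (hR z h0).2⟩

/-- The pairing is continuous along vague limits of measures with uniform growth at small scales. -/
lemma IsCZKernel.tendsto_pairing (hK : IsCZKernel s α K) (hs : 0 < s) (hα : 0 < α)
    {U : Filter ℕ} {μ : ℕ → Measure (E d)} {ν : Measure (E d)}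
    [∀ n, IsLocallyFiniteMeasure (μ n)] [IsLocallyFiniteMeasure ν] (h : IsVagueLimit U μ ν)
    (hμd : ∀ n, IsDiffuse s (μ n)) (hνd : IsDiffuse s ν) {M : ℝ → ℝ}
    (hM : ∀ R n, (μ n).real (Metric.ball 0 R) ≤ M R) {σ : ℝ} {Λ : ℝ → ℝ} (hΛ : ∀ R, 0 ≤ Λ R)
    (hσ : 0 < σ) (hσs : s - 1 < σ)
    (hgrowth : ∀ n R, 0 < R → ∀ x ∈ Metric.ball (0 : E d) R, ∀ r, 0 < r → r ≤ 1 →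
      (μ n) (Metric.ball x r) ≤ ENNReal.ofReal (Λ R * r ^ σ))
    {f φ : E d → ℂ} (hf : IsLipZero f) (hφ : IsLipZero φ) :
    Tendsto (fun n => pairing K (μ n) f φ) U (𝓝 (pairing K ν f φ)) := by
  obtain ⟨L, R, hL0, hR0, hL, hR⟩ := exists_pairDensity_bound hf hφ
  have hsc := shellConst_pos (b := s - 1) (σ := σ) hσs.ne'
  rw [Metric.tendsto_nhds]
  intro ε hε
  -- choice of the regularization parameter
  have hδ0 : ∀ n : ℕ, (0 : ℝ) < 1 / ((n : ℝ) + 1) := fun n => by positivity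
  have hδ1 : ∀ n : ℕ, 1 / ((n : ℝ) + 1) ≤ 1 := fun n => by
    rw [div_le_one (by positivity)]
    have : (0 : ℝ) ≤ n := by positivity
    linarith
  have hlimδ : Tendsto (fun n : ℕ => 1 / ((n : ℝ) + 1)) atTop (𝓝 0) :=
    tendsto_one_div_add_atTop_nhds_zero_nat
  have h1 := hK.tendsto_pairing_regKernel hs hα hνd hf hφ hδ0 hlimδ
  have h2 : Tendsto (fun n : ℕ => 2 * L * (shellConst (s - 1) σ *
      (Λ R * (1 / ((n : ℝ) + 1)) ^ (σ - (s - 1)))) * max (M R) 0) atTop (𝓝 0) := by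
    have hpos : 0 < σ - (s - 1) := by linarith
    have h3 := (Real.continuousAt_rpow_const 0 (σ - (s - 1)) (Or.inr hpos.le)).tendsto.comp hlimδ
    rw [Real.zero_rpow hpos.ne'] at h3
    have h4 := (((h3.const_mul (Λ R)).const_mul (shellConst (s - 1) σ)).const_mul
      (2 * L)).mul_const (max (M R) 0)
    simpa using h4
  obtain ⟨k, hk1, hk2⟩ := ((Metric.tendsto_nhds.1 h1 (ε / 3) (by positivity)).and
    (h2.eventually (gt_mem_nhds (show 0 < ε / 3 by positivity)))).exists
  set δ : ℝ := 1 / ((k : ℝ) + 1) with hδ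
  have hδpos : 0 < δ := hδ0 k
  have hcont : Continuous fun z : E d × E d =>
      pairDensity f φ z • regKernel s α K δ (z.1 - z.2) :=
    (continuous_pairDensity hf hφ).smul ((hK.continuous_regKernel hs hα hδpos).comp (by fun_prop))
  have h5 := h.tendsto_integral_prod hM hcont (hasCompactSupport_pairDensity_smul hR _)
  filter_upwards [Metric.tendsto_nhds.1 h5 (ε / 3) (by positivity)] with n hn
  have h6 := hK.norm_pairing_sub_regKernel_le hs hα (hμd n) hf hφ hL0 hL hR hδpos (hΛ R) hσ hσs
    fun x hx r hr hrδ => hgrowth n R hR0 x hx r hr (hrδ.trans (hδ1 k))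
  have h7 : ‖pairing K (μ n) f φ - ∫ z, pairDensity f φ z • regKernel s α K δ (z.1 - z.2)
      ∂((μ n).prod (μ n))‖ < ε / 3 := by
    refine (h6.trans ?_).trans_lt hk2
    have := hΛ R
    gcongr
    exact (hM R n).trans (le_max_left _ _)
  rw [← dist_eq_norm] at h7
  have t1 := dist_triangle4 (pairing K (μ n) f φ)
    (∫ z, pairDensity f φ z • regKernel s α K δ (z.1 - z.2) ∂((μ n).prod (μ n)))
    (∫ z, pairDensity f φ z • regKernel s α K δ (z.1 - z.2) ∂(ν.prod ν)) (pairing K ν f φ)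
  linarith

end PairingLimit

/-! ### Limits of measures with small pairings are reflectionless -/

section Compactness

variable {d m : ℕ} {s α : ℝ} {K : E d → V m}

lemma pairing_const_mul (K : E d → V m) (μ : Measure (E d)) (c : ℂ) (f φ : E d → ℂ) :
    pairing K μ (fun x => c * f x) φ = c • pairing K μ f φ := by
  simp only [pairing_eq]
  rw [← integral_smul]
  refine integral_congr_ae (Eventually.of_forall fun z => ?_)
  simp only [smul_smul, pairDensity]
  congr 1
  ring

/-- For a function of mean zero, replacing the constant `1` by a cut-off function in the pairing
makes a small error. -/
lemma IsCZKernel.exists_norm_pairing_one_sub_cutoff_le (hK : IsCZKernel s α K) (hs : 0 < s)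
    (hα : 0 < α) (hα1 : α ≤ 1) : ∃ C : ℝ, 0 ≤ C ∧ ∀ (μ : Measure (E d)) [IsFiniteMeasure μ]
      (f : E d → ℂ) (R₀ R R' σ Λ : ℝ), 0 < R₀ → 2 * R₀ ≤ R → 0 ≤ Λ → σ < s + α →
      IsDiffuse s μ → 0 < R' → μ (Metric.ball 0 R')ᶜ = 0 → IsLipZero f →
      (∀ y, f y ≠ 0 → ‖y‖ ≤ R₀) → ∫ y, f y ∂μ = 0 →
      (∀ r, R ≤ r → μ (Metric.ball 0 r) ≤ ENNReal.ofReal (Λ * r ^ σ)) →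
        ‖pairing K μ f (fun _ => 1) - pairing K μ f (fun x => (cutoff d R x : ℂ))‖ ≤
          C * R₀ ^ α * (∫ y, ‖f y‖ ∂μ) * (shellConst (s + α) σ * (Λ * R ^ (σ - (s + α)))) := by
  obtain ⟨C, hC0, hC⟩ := hK.exists_norm_integral_tail_le hs hα hα1
  refine ⟨C, hC0, fun μ _ f R₀ R R' σ Λ hR₀ hR hΛ hσ hμd hR' hμR' hf hsupp hmean hgrowth => ?_⟩
  have hRpos : 0 < R := by linarith
  have hR1 : 0 < max R R' := lt_max_of_lt_left hRpos
  have hμR1 : μ (Metric.ball 0 (max R R'))ᶜ = 0 :=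
    measure_mono_null (compl_subset_compl.2 (Metric.ball_subset_ball (le_max_right _ _))) hμR'
  have h0 : ∀ x : E d, ‖x‖ ≤ R → (cutoff d (max R R') x : ℂ) - cutoff d R x = 0 := by
    intro x hx
    rw [cutoff_eq_one hR1 (hx.trans (le_max_left _ _)), cutoff_eq_one hRpos hx, sub_self]
  have hχ := isLipZero_cutoff (d := d) hRpos
  have hχ' := isLipZero_cutoff (d := d) hR1
  rw [pairing_one_eq_cutoff hR1 hμR1, ← hK.pairing_sub_right hα hμd hf hχ' hχ,
    (hK.pairing_eq_integral_transform (μ := μ) hs hα hf (hχ'.sub hχ) hR₀ fun x y hy hx => ?_).2]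
  · refine hC μ f _ R₀ R σ Λ hR₀ hR hΛ hσ (hf.integrable μ) hsupp hmean (fun x => ?_) h0 hgrowth
    rw [← Complex.ofReal_sub, Complex.norm_real, Real.norm_eq_abs, abs_le]
    have h1 := cutoff_nonneg R x
    have h2 := cutoff_le_one R x
    have h3 := cutoff_nonneg (max R R') x
    have h4 := cutoff_le_one (max R R') x
    constructor <;> linarith
  · have h1 : R < ‖x‖ := not_le.1 fun h => hx (h0 x h)
    rw [dist_eq_norm]
    linarith [hsupp y hy, norm_sub_norm_le x y]

/-- If the pairings with `1` of normalized bumps on larger and larger balls tend to zero, then the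
extended pairing with `1` vanishes for the vague limit of the measures: a test function of mean zero
for the limit becomes, after a small correction of its mean, a bump for the measures. -/
lemma IsCZKernel.extPairing_eq_zero_of_isVagueLimit (hK : IsCZKernel s α K) (hs : 0 < s)
    (hα : 0 < α) (hα1 : α ≤ 1) {U : Filter ℕ} [U.NeBot] (hU : U ≤ atTop)
    {μ : ℕ → Measure (E d)} {ν : Measure (E d)} [∀ n, IsFiniteMeasure (μ n)]
    [IsLocallyFiniteMeasure ν] (h : IsVagueLimit U μ ν) (hμd : ∀ n, IsDiffuse s (μ n))
    (hνd : IsDiffuse s ν) (hνr : HasRestrictedGrowth s α ν) {M : ℝ → ℝ}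
    (hM : ∀ R n, (μ n).real (Metric.ball 0 R) ≤ M R) {σ : ℝ} {Λ : ℝ → ℝ} (hΛ : ∀ R, 0 ≤ Λ R)
    (hσ : 0 < σ) (hσs : s - 1 < σ)
    (hgrowth : ∀ n R, 0 < R → ∀ x ∈ Metric.ball (0 : E d) R, ∀ r, 0 < r → r ≤ 1 →
      (μ n) (Metric.ball x r) ≤ ENNReal.ofReal (Λ R * r ^ σ))
    {σ' Λ' : ℝ} (hΛ' : 0 ≤ Λ') (hσ' : σ' < s + α)
    (hlarge : ∀ n r, 1 ≤ r → (μ n) (Metric.ball 0 r) ≤ ENNReal.ofReal (Λ' * r ^ σ'))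
    (hνlarge : ∀ r, 1 ≤ r → ν (Metric.ball 0 r) ≤ ENNReal.ofReal (Λ' * r ^ σ'))
    (hbdd : ∀ n, ∃ R, 0 < R ∧ (μ n) (Metric.ball 0 R)ᶜ = 0)
    (hone : ∀ n, 1 ≤ (μ n).real (Metric.ball 0 1))
    (hsmall : ∀ (n : ℕ) (f : E d → ℂ), IsBump (μ n) 0 1 (n + 1) f →
      ‖pairing K (μ n) f (fun _ => 1)‖ ≤ 1 / ((n : ℝ) + 1))
    {f ψ : E d → ℂ} (hf : IsLipZero f) (hmean : ∫ x, f x ∂ν = 0) (hψ : IsLipZero ψ)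
    (hψ1 : ∀ᶠ x in 𝓝ˢ (tsupport f), ψ x = 1) :
    extPairing K ν ψ f (fun _ => 1) = 0 := by
  obtain ⟨C₁, hC₁0, hC₁⟩ := hK.exists_norm_pairing_one_sub_cutoff_le hs hα hα1
  obtain ⟨C₂, hC₂0, hC₂⟩ := hK.exists_norm_integral_tail_le hs hα hα1
  obtain ⟨η, hη, hsepψ⟩ := exists_le_dist_of_eventually_eq_one hf.2 hψ1
  obtain ⟨L, hL0, hL⟩ := hf.exists_lipschitz
  obtain ⟨b, hb0, hb⟩ := hf.exists_bound
  obtain ⟨Rf, hRf0, hRf⟩ := hf.exists_radius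
  have hsc := shellConst_pos (b := s + α) (σ := σ') hσ'.ne
  -- the correction of the mean uses the cut-off function of the unit ball, whose integrals
  -- are bounded from below
  set g : E d → ℂ := fun x => (cutoff d 1 x : ℂ) with hg
  have hgL : IsLipZero g := isLipZero_cutoff one_pos
  set R₀ := max Rf 2 with hR₀
  have hR₀pos : 0 < R₀ := lt_max_of_lt_left hRf0
  have hfsupp : ∀ y, f y ≠ 0 → ‖y‖ < R₀ := by
    intro y hy
    have := hRf (subset_tsupport f hy)
    rw [Metric.mem_ball, dist_zero_right] at this
    exact this.trans_le (le_max_left _ _)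
  have hgsupp : ∀ y, g y ≠ 0 → ‖y‖ < R₀ := by
    intro y hy
    by_contra h'
    refine hy ?_
    have : cutoff d 1 y = 0 := cutoff_eq_zero one_pos (by
      linarith [not_lt.1 h', le_max_right Rf 2])
    simp [hg, this]
  have hgint : ∀ n, 1 ≤ ‖∫ x, g x ∂(μ n)‖ := by
    intro n
    simp only [hg]
    rw [integral_complex_ofReal, Complex.norm_real]
    refine le_trans ((hone n).trans ?_) (le_abs_self _)
    simpa using measureReal_ball_le_integral_cutoff (μ n) 0 one_pos
  set c : ℕ → ℂ := fun n => (∫ x, f x ∂(μ n)) / ∫ x, g x ∂(μ n) with hc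
  have hclim : Tendsto c U (𝓝 0) := by
    have h1 := h.tendsto_integral hf.continuous hf.2
    rw [hmean] at h1
    refine squeeze_zero_norm (fun n => ?_) (tendsto_zero_iff_norm_tendsto_zero.1 h1)
    simp only [hc]
    rw [norm_div]
    exact div_le_self (norm_nonneg _) (hgint n)
  have hc1 : ∀ᶠ n in U, ‖c n‖ ≤ 1 := by
    filter_upwards [hclim.eventually (Metric.closedBall_mem_nhds 0 one_pos)] with n hn
    simpa using hn
  set F : ℕ → E d → ℂ := fun n x => f x - c n * g x with hF
  have hFL : ∀ n, IsLipZero (F n) := fun n => hf.sub (hgL.const_mul _)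
  have hFsupp : ∀ n y, F n y ≠ 0 → ‖y‖ < R₀ := by
    intro n y hy
    by_contra h'
    have h1 : f y = 0 := by_contra fun h1 => h' (hfsupp y h1)
    have h2 : g y = 0 := by_contra fun h2 => h' (hgsupp y h2)
    exact hy (by simp [hF, h1, h2])
  have hFmean : ∀ n, ∫ x, F n x ∂(μ n) = 0 := by
    intro n
    have hne : ∫ x, g x ∂(μ n) ≠ 0 := norm_pos_iff.1 (one_pos.trans_le (hgint n))
    simp only [hF]
    rw [integral_sub (hf.integrable _) ((hgL.const_mul _).integrable _), integral_const_mul]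
    simp only [hc]
    rw [div_mul_cancel₀ _ hne, sub_self]
  have hg1 : ∀ x, ‖g x‖ ≤ 1 := by
    intro x
    simp only [hg]
    rw [Complex.norm_real, Real.norm_of_nonneg (cutoff_nonneg _ _)]
    exact cutoff_le_one _ _
  have hFb : ∀ n, ‖c n‖ ≤ 1 → ∀ x, ‖F n x‖ ≤ b + 1 := by
    intro n hn x
    refine (norm_sub_le _ _).trans (add_le_add (hb x) ?_)
    rw [norm_mul]
    exact mul_le_one₀ hn (norm_nonneg _) (hg1 x)
  have hFlip : ∀ n, ‖c n‖ ≤ 1 → ∀ x y, ‖F n x - F n y‖ ≤ (L + 1) * dist x y := by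
    intro n hn x y
    have e : F n x - F n y = (f x - f y) - c n * (g x - g y) := by simp only [hF]; ring
    have h1 : ‖g x - g y‖ ≤ dist x y := by
      simp only [hg]
      rw [← Complex.ofReal_sub, Complex.norm_real]
      simpa using abs_cutoff_sub_le one_pos x y
    rw [e, add_mul, one_mul]
    refine (norm_sub_le _ _).trans (add_le_add (hL x y) ?_)
    rw [norm_mul]
    exact (mul_le_of_le_one_left (norm_nonneg _) hn).trans h1
  set N : ℝ := b + L + 1 with hN
  have hNpos : 0 < N := by positivity
  have hpair : ∀ n : ℕ, ‖c n‖ ≤ 1 → R₀ ≤ (n : ℝ) + 1 →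
      ‖pairing K (μ n) (F n) (fun _ => 1)‖ ≤ N * (1 / ((n : ℝ) + 1)) := by
    intro n hn hnR
    have hNn : ‖((N : ℂ))⁻¹‖ = N⁻¹ := by
      rw [norm_inv, Complex.norm_real, Real.norm_of_nonneg hNpos.le]
    have hbump : IsBump (μ n) 0 1 (n + 1) (fun x => (N : ℂ)⁻¹ * F n x) := by
      refine ⟨(hFL n).const_mul _, fun y z => ?_, fun y => ?_, fun y hy => ?_, ?_⟩
      · rw [← mul_sub, norm_mul, hNn, div_one, inv_mul_le_iff₀ hNpos]
        refine (hFlip n hn y z).trans ?_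
        gcongr
        linarith
      · rw [norm_mul, hNn, inv_mul_le_iff₀ hNpos]
        linarith [hFb n hn y]
      · rw [Metric.mem_ball, dist_zero_right, mul_one]
        exact (hFsupp n y (right_ne_zero_of_mul hy)).trans_le hnR
      · rw [integral_const_mul, hFmean, mul_zero]
    have h1 := hsmall n _ hbump
    rwa [pairing_const_mul, norm_smul, hNn, inv_mul_le_iff₀ hNpos] at h1
  set J : ℝ := (b + 1) * max (M R₀) 0 with hJ
  have hJ0 : 0 ≤ J := by positivity
  have hFJ : ∀ n, ‖c n‖ ≤ 1 → ∫ x, ‖F n x‖ ∂(μ n) ≤ J := by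
    intro n hn
    rw [← setIntegral_eq_integral_of_forall_compl_eq_zero (s := Metric.ball 0 R₀) fun x hx => by
      by_contra h'
      exact hx (by simpa using hFsupp n x (norm_ne_zero_iff.1 h'))]
    refine (le_abs_self _).trans ?_
    rw [← Real.norm_eq_abs]
    refine (norm_setIntegral_le_of_norm_le_const measure_ball_lt_top
      fun x _ => (norm_norm (F n x)).trans_le (hFb n hn x)).trans ?_
    rw [hJ]
    gcongr
    exact (hM R₀ n).trans (le_max_left _ _)
  set I : ℝ := ∫ x, ‖f x‖ ∂ν with hI
  -- the bound for a fixed cut-off radius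
  have hkey : ∀ R, max 1 (2 * R₀) ≤ R → ‖extPairing K ν ψ f (fun _ => 1)‖ ≤
      (C₁ * R₀ ^ α * J + C₂ * R₀ ^ α * I) *
        (shellConst (s + α) σ' * (Λ' * R ^ (σ' - (s + α)))) := by
    intro R hR
    have hR1 : 1 ≤ R := (le_max_left _ _).trans hR
    have hR2 : 2 * R₀ ≤ R := (le_max_right _ _).trans hR
    have hRpos : 0 < R := by linarith
    set χ : E d → ℂ := fun x => (cutoff d R x : ℂ) with hχ
    have hχL : IsLipZero χ := isLipZero_cutoff hRpos
    have hχ1 : ∀ x, ‖x‖ ≤ R → χ x = 1 := fun x hx => by simp [hχ, cutoff_eq_one hRpos hx]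
    have hsepχ : ∀ x y, f y ≠ 0 → χ x ≠ 1 → min η R₀ ≤ dist x y := by
      intro x y hy hx
      have h1 : R < ‖x‖ := not_le.1 fun h => hx (hχ1 x h)
      refine (min_le_right _ _).trans ?_
      rw [dist_eq_norm]
      linarith [hfsupp y hy, norm_sub_norm_le x y]
    rw [hK.extPairing_eq hs hα hα1 hνd hνr hf hψ hχL hmean (lt_min hη hR₀pos)
      (fun x y hy hx => (min_le_left _ _).trans (hsepψ x y hy hx)) hsepχ, add_mul]
    refine (norm_add_le _ _).trans (add_le_add ?_ ?_)
    · have hlim : ∀ φ, IsLipZero φ →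
          Tendsto (fun n => pairing K (μ n) φ χ) U (𝓝 (pairing K ν φ χ)) := fun φ hφ =>
        hK.tendsto_pairing hs hα h hμd hνd hM hΛ hσ hσs hgrowth hφ hχL
      have h1 : Tendsto (fun n => pairing K (μ n) (F n) χ) U (𝓝 (pairing K ν f χ)) := by
        have h2 := (hlim f hf).sub (hclim.smul (hlim g hgL))
        rw [zero_smul, sub_zero] at h2
        exact h2.congr fun n => (hK.pairing_sub_mul hα (hμd n) hf hgL hχL (c n)).symm
      have h3 : Tendsto (fun n : ℕ => N * (1 / ((n : ℝ) + 1)) + C₁ * R₀ ^ α * J *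
          (shellConst (s + α) σ' * (Λ' * R ^ (σ' - (s + α))))) U
          (𝓝 (N * 0 + C₁ * R₀ ^ α * J *
          (shellConst (s + α) σ' * (Λ' * R ^ (σ' - (s + α)))))) :=
        ((tendsto_one_div_add_atTop_nhds_zero_nat.mono_left hU).const_mul N).add_const _
      rw [mul_zero, zero_add] at h3
      refine le_of_tendsto_of_tendsto h1.norm h3 ?_
      have hlargen : ∀ᶠ n : ℕ in U, R₀ ≤ (n : ℝ) + 1 :=
        hU ((tendsto_natCast_atTop_atTop.atTop_add tendsto_const_nhds).eventually_ge_atTop R₀)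
      filter_upwards [hc1, hlargen] with n hn1 hn2
      obtain ⟨R', hR', hμR'⟩ := hbdd n
      have h4 := hC₁ (μ n) (F n) R₀ R R' σ' Λ' hR₀pos hR2 hΛ' hσ' (hμd n) hR' hμR' (hFL n)
        (fun y hy => (hFsupp n y hy).le) (hFmean n) fun r hr => hlarge n r (hR1.trans hr)
      have h5 : C₁ * R₀ ^ α * (∫ y, ‖F n y‖ ∂(μ n)) *
          (shellConst (s + α) σ' * (Λ' * R ^ (σ' - (s + α)))) ≤
          C₁ * R₀ ^ α * J * (shellConst (s + α) σ' * (Λ' * R ^ (σ' - (s + α)))) := by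
        gcongr
        exact hFJ n hn1
      have h6 := hpair n hn1 hn2
      have h7 := norm_sub_norm_le (pairing K (μ n) (F n) χ) (pairing K (μ n) (F n) fun _ => 1)
      rw [norm_sub_rev] at h7
      linarith
    · refine hC₂ ν f _ R₀ R σ' Λ' hR₀pos hR2 hΛ' hσ' (hf.integrable ν)
        (fun y hy => (hfsupp y hy).le) hmean (fun x => ?_) (fun x hx => ?_)
        fun r hr => hνlarge r (hR1.trans hr)
      · simp only [hχ]
        rw [← Complex.ofReal_one, ← Complex.ofReal_sub, Complex.norm_real, Real.norm_eq_abs, abs_le]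
        have h1 := cutoff_nonneg R x
        have h2 := cutoff_le_one R x
        constructor <;> linarith
      · rw [hχ1 x hx, sub_self]
  have hlim : Tendsto (fun R : ℝ => (C₁ * R₀ ^ α * J + C₂ * R₀ ^ α * I) *
      (shellConst (s + α) σ' * (Λ' * R ^ (σ' - (s + α))))) atTop (𝓝 0) := by
    have h1 := tendsto_rpow_neg_atTop (show 0 < s + α - σ' by linarith)
    rw [neg_sub] at h1
    have h2 := ((h1.const_mul Λ').const_mul (shellConst (s + α) σ')).const_mul
      (C₁ * R₀ ^ α * J + C₂ * R₀ ^ α * I)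
    simpa using h2
  rw [← norm_le_zero_iff]
  refine ge_of_tendsto hlim ?_
  filter_upwards [eventually_ge_atTop (max 1 (2 * R₀))] with R hR
  exact hkey R hR

end Compactness

/-! ### The compactness argument -/

section UnitBall

variable {d m : ℕ} {s α : ℝ} {K : E d → V m}

/-- Growth at small scales of a measure controlled by its density in the unit ball. -/
lemma measure_ball_le_of_hypRatio_le {μ : Measure (E d)} [IsFiniteMeasure μ] {C ε e : ℝ}
    (hC : 0 ≤ C) (he1 : e ≤ 1) (hε : ε ≤ e) (he : 0 ≤ e)
    (h : ∀ y t, 0 < t → μ.real (Metric.ball y t) ≤ C * hypRatio (0 : E d) 1 y t ^ ε * t ^ s)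
    {R : ℝ} (hR : 0 < R) {x : E d} (hx : x ∈ Metric.ball (0 : E d) R) {r : ℝ} (hr : 0 < r)
    (hr1 : r ≤ 1) :
    μ (Metric.ball x r) ≤ ENNReal.ofReal (C * (R + 2) ^ 2 * r ^ (s - e)) := by
  rw [← ofReal_measureReal measure_ball_lt_top.ne]
  apply ENNReal.ofReal_le_ofReal
  refine (h x r hr).trans ?_
  have h1 := one_le_hypRatio (0 : E d) x one_pos hr
  rw [Metric.mem_ball, dist_comm] at hx
  have h2 : hypRatio (0 : E d) 1 x r ≤ (R + 2) ^ 2 * r⁻¹ := by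
    unfold hypRatio
    rw [one_mul, div_eq_mul_inv]
    have h0 : dist 0 x + 1 + r ≤ R + 2 := by linarith
    gcongr
  have hR2 : 1 ≤ (R + 2) ^ 2 := one_le_pow₀ (by linarith)
  have h3 : hypRatio (0 : E d) 1 x r ^ ε ≤ (R + 2) ^ 2 * r ^ (-e) := by
    calc _ ≤ hypRatio (0 : E d) 1 x r ^ e := Real.rpow_le_rpow_of_exponent_le h1 hε
      _ ≤ ((R + 2) ^ 2 * r⁻¹) ^ e := by gcongr
      _ = ((R + 2) ^ 2) ^ e * r ^ (-e) := by
          rw [Real.mul_rpow (by positivity) (by positivity), Real.inv_rpow hr.le,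
            Real.rpow_neg hr.le]
      _ ≤ _ := by
          gcongr
          exact (Real.rpow_le_rpow_of_exponent_le hR2 he1).trans_eq (Real.rpow_one _)
  calc _ ≤ C * ((R + 2) ^ 2 * r ^ (-e)) * r ^ s := by gcongr
    _ = _ := by
        rw [sub_eq_neg_add, Real.rpow_add hr]
        ring

/-- Growth at large scales of a measure controlled by its density in the unit ball. -/
lemma measure_ball_zero_le_of_hypRatio_le {μ : Measure (E d)} [IsFiniteMeasure μ] {C ε e : ℝ}
    (hC : 0 ≤ C) (he1 : e ≤ 1) (hε : ε ≤ e) (he : 0 ≤ e)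
    (h : ∀ y t, 0 < t → μ.real (Metric.ball y t) ≤ C * hypRatio (0 : E d) 1 y t ^ ε * t ^ s)
    {r : ℝ} (hr : 1 ≤ r) :
    μ (Metric.ball 0 r) ≤ ENNReal.ofReal (C * 4 * r ^ (s + e)) := by
  have hr0 : 0 < r := by linarith
  rw [← ofReal_measureReal measure_ball_lt_top.ne]
  apply ENNReal.ofReal_le_ofReal
  refine (h 0 r hr0).trans ?_
  have h1 := one_le_hypRatio (0 : E d) 0 one_pos hr0
  have h2 : hypRatio (0 : E d) 1 0 r ≤ 4 * r := by
    unfold hypRatio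
    rw [dist_self, div_le_iff₀ (by positivity)]
    nlinarith
  have h3 : hypRatio (0 : E d) 1 0 r ^ ε ≤ 4 * r ^ e := by
    calc _ ≤ hypRatio (0 : E d) 1 0 r ^ e := Real.rpow_le_rpow_of_exponent_le h1 hε
      _ ≤ (4 * r) ^ e := by gcongr
      _ = 4 ^ e * r ^ e := Real.mul_rpow (by norm_num) hr0.le
      _ ≤ _ := by
          gcongr
          exact (Real.rpow_le_rpow_of_exponent_le (by norm_num) he1).trans_eq (Real.rpow_one _)
  calc _ ≤ C * (4 * r ^ e) * r ^ s := by gcongr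
    _ = _ := by
        rw [Real.rpow_add hr0]
        ring

/-- If there are no nice reflectionless measures, then a measure whose densities are controlled by
its density in the unit ball has a large pairing with some normalized bump of mean zero. Otherwise,
a sequence of counterexamples with exponents tending to zero would have a nice reflectionless vague
limit. -/
lemma IsCZKernel.exists_le_norm_pairing_unit (hK : IsCZKernel s α K) (hs : 0 < s) (hα : 0 < α)
    (hα1 : α ≤ 1) (hrigid : ∀ ν : Measure (E d), IsNice s ν → IsReflectionless s α K ν → ν = 0)
    {C : ℝ} (hC : 0 < C) : ∃ ε A Δ : ℝ, 0 < ε ∧ ε ≤ 1 ∧ 1 ≤ A ∧ 0 < Δ ∧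
      ∀ (μ : Measure (E d)) [IsFiniteMeasure μ], IsDiffuse s μ →
        (∃ R, 0 < R ∧ μ (Metric.ball 0 R)ᶜ = 0) → 1 ≤ μ.real (Metric.ball 0 1) →
        (∀ y t, 0 < t → μ.real (Metric.ball y t) ≤ C * hypRatio (0 : E d) 1 y t ^ ε * t ^ s) →
        ∃ f, IsBump μ 0 1 A f ∧ Δ ≤ ‖pairing K μ f (fun _ => 1)‖ := by
  by_contra! hcon
  -- exponents at most `e` keep the growth exponents `s - e` and `s + e` of the measures in the range
  -- `(s - 1, s + α)`, where the pairings converge and the tails at infinity are uniformly small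
  set e : ℝ := min (1 / 2) (min (s / 2) (α / 2)) with he
  have he0 : 0 < e := by positivity
  have he12 : e ≤ 1 / 2 := min_le_left _ _
  have hes : e ≤ s / 2 := (min_le_right _ _).trans (min_le_left _ _)
  have heα : e ≤ α / 2 := (min_le_right _ _).trans (min_le_right _ _)
  have hn1 : ∀ n : ℕ, (1 : ℝ) ≤ n + 1 := fun n => by
    have : (0 : ℝ) ≤ n := by positivity
    linarith
  have hεe : ∀ n : ℕ, e / ((n : ℝ) + 1) ≤ e := fun n => div_le_self he0.le (hn1 n)
  choose μ hμfin hμd hμR hμ1 hμC hμf using fun n : ℕ => hcon (e / ((n : ℝ) + 1)) ((n : ℝ) + 1)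
    (1 / ((n : ℝ) + 1)) (by positivity) ((hεe n).trans (by linarith)) (hn1 n) (by positivity)
  let U : Ultrafilter ℕ := Filter.hyperfilter ℕ
  have hU : (U : Filter ℕ) ≤ atTop := by
    rw [← Nat.cofinite_eq_atTop]
    exact Filter.hyperfilter_le_cofinite
  have hlarge : ∀ n r, 1 ≤ r →
      (μ n) (Metric.ball 0 r) ≤ ENNReal.ofReal (C * 4 * r ^ (s + e)) := fun n r hr =>
    measure_ball_zero_le_of_hypRatio_le hC.le (by linarith) (hεe n) he0.le (hμC n) hr
  set M : ℝ → ℝ := fun R => C * 4 * (max R 1) ^ (s + e) with hMdef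
  have hM : ∀ R n, (μ n).real (Metric.ball 0 R) ≤ M R := by
    intro R n
    apply ENNReal.toReal_le_of_le_ofReal
    · have : 0 ≤ max R 1 := zero_le_one.trans (le_max_right _ _)
      positivity
    · exact (measure_mono (Metric.ball_subset_ball (le_max_left _ _))).trans
        (hlarge n _ (le_max_right _ _))
  obtain ⟨ν, hνloc, hν⟩ := exists_isVagueLimit U hM
  have hεlim : Tendsto (fun n : ℕ => e / ((n : ℝ) + 1)) U (𝓝 0) := by
    have := (tendsto_one_div_add_atTop_nhds_zero_nat (𝕜 := ℝ)).const_mul e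
    rw [mul_zero] at this
    exact (this.congr fun n => by rw [mul_one_div]).mono_left hU
  -- in the limit the powers of the hyperbolic ratio disappear
  have hnice : IsNiceWith s (C * 2 ^ s) ν := by
    intro y t ht
    have hpos := hypRatio_pos (0 : E d) y one_pos (show 0 < 2 * t by positivity)
    have h1 : Tendsto (fun n : ℕ => C * hypRatio (0 : E d) 1 y (2 * t) ^ (e / ((n : ℝ) + 1)) *
        (2 * t) ^ s) U (𝓝 (C * hypRatio (0 : E d) 1 y (2 * t) ^ (0 : ℝ) * (2 * t) ^ s)) :=
      (((Real.continuousAt_const_rpow hpos.ne').tendsto.comp hεlim).const_mul C).mul_const _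
    rw [Real.rpow_zero, mul_one, Real.mul_rpow zero_le_two ht.le, ← mul_assoc] at h1
    refine hν.measure_ball_le ht (fun n => ?_) h1
    refine (hμC n y _ (by positivity)).trans_eq ?_
    rw [Real.mul_rpow zero_le_two ht.le]
  have hΛ : 0 < C * 2 ^ s := by positivity
  have hνd := hnice.isDiffuse hs hΛ.le
  have hνr := hnice.hasRestrictedGrowth hα hΛ.le
  refine hν.ne_zero one_pos hμ1 (hrigid ν ⟨_, hΛ, hnice⟩ ⟨hνloc, hνd, hνr,
    fun f ψ hf hmean hψ hψ1 => ?_⟩)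
  refine hK.extPairing_eq_zero_of_isVagueLimit hs hα hα1 hU hν hμd hνd hνr hM
    (σ := s - e) (Λ := fun R => C * (R + 2) ^ 2) (fun R => by positivity) (by linarith)
    (by linarith) (fun n R hR x hx r hr hr1 => measure_ball_le_of_hypRatio_le hC.le (by linarith)
      (hεe n) he0.le (hμC n) hR hx hr hr1) (σ' := s + e) (Λ' := C * (4 + 2 ^ s)) (by positivity)
    (by linarith) (fun n r hr => (hlarge n r hr).trans (ENNReal.ofReal_le_ofReal ?_))
    (fun r hr => (hnice 0 r (by linarith)).trans (ENNReal.ofReal_le_ofReal ?_)) hμR hμ1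
    (fun n f hf => (hμf n f hf).le) hf hmean hψ hψ1
  · have : (0 : ℝ) ≤ 2 ^ s := by positivity
    have : 0 ≤ r := by linarith
    gcongr
    linarith
  · have h1 : r ^ s ≤ r ^ (s + e) := Real.rpow_le_rpow_of_exponent_le hr (by linarith)
    have : 0 ≤ r := by linarith
    gcongr
    linarith

end UnitBall

/-! ### Rescaling -/

section Rescaling

variable {d m : ℕ} {s α : ℝ} {K : E d → V m}

/-- The dilation that maps the ball `B(x, r)` to the unit ball. -/
noncomputable def toUnitBall {d : ℕ} (x : E d) {r : ℝ} (hr : 0 < r) : E d ≃ₜ E d :=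
  (Homeomorph.addRight (-x)).trans (Homeomorph.smulOfNeZero r⁻¹ (inv_ne_zero hr.ne'))

lemma toUnitBall_apply (x : E d) {r : ℝ} (hr : 0 < r) (y : E d) :
    toUnitBall x hr y = r⁻¹ • (y - x) := by
  simp [toUnitBall, sub_eq_add_neg]

lemma toUnitBall_sub (x : E d) {r : ℝ} (hr : 0 < r) (y z : E d) :
    toUnitBall x hr y - toUnitBall x hr z = r⁻¹ • (y - z) := by
  rw [toUnitBall_apply, toUnitBall_apply, ← smul_sub, sub_sub_sub_cancel_right]

lemma dist_toUnitBall (x : E d) {r : ℝ} (hr : 0 < r) (y z : E d) :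
    dist (toUnitBall x hr y) (toUnitBall x hr z) = dist y z / r := by
  rw [dist_eq_norm, toUnitBall_sub, norm_smul, norm_inv, Real.norm_of_nonneg hr.le, dist_eq_norm,
    inv_mul_eq_div]

lemma toUnitBall_preimage_ball (x : E d) {r : ℝ} (hr : 0 < r) (y : E d) (t : ℝ) :
    toUnitBall x hr ⁻¹' Metric.ball y t = Metric.ball (x + r • y) (r * t) := by
  have e : toUnitBall x hr (x + r • y) = y := by
    rw [toUnitBall_apply, add_sub_cancel_left, inv_smul_smul₀ hr.ne']
  ext z
  rw [mem_preimage, Metric.mem_ball, Metric.mem_ball]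
  nth_rw 1 [← e]
  rw [dist_toUnitBall, div_lt_iff₀ hr, mul_comm t r]

lemma pairing_smul_measure (K : E d → V m) (μ : Measure (E d)) [SFinite μ] (c : ℝ≥0∞)
    (f φ : E d → ℂ) :
    pairing K (c • μ) f φ = c.toReal ^ 2 • pairing K μ f φ := by
  have : SFinite (c • μ) := inferInstance
  rw [pairing_eq, pairing_eq, Measure.prod_smul_left, Measure.prod_smul_right,
    integral_smul_measure, integral_smul_measure, smul_smul, sq]

lemma IsCZKernel.pairing_map_toUnitBall (hK : IsCZKernel s α K) (μ : Measure (E d)) [SFinite μ]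
    (x : E d) {r : ℝ} (hr : 0 < r) (f φ : E d → ℂ) :
    pairing K (μ.map (toUnitBall x hr)) f φ =
      r ^ s • pairing K μ (f ∘ toUnitBall x hr) (φ ∘ toUnitBall x hr) := by
  have hS := (toUnitBall x hr).measurableEmbedding
  rw [pairing_eq, pairing_eq, Measure.map_prod_map _ _ hS.measurable hS.measurable,
    (hS.prodMap hS).integral_map, ← integral_smul]
  refine integral_congr_ae (Eventually.of_forall fun z => ?_)
  simp only [Prod.map_fst, Prod.map_snd]
  by_cases hz : z.1 = z.2
  · have h1 : pairDensity f φ (Prod.map (toUnitBall x hr) (toUnitBall x hr) z) = 0 := by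
      rw [← Prod.mk.eta (p := z), hz, Prod.map_apply, pairDensity_diag]
    have h2 : pairDensity (f ∘ toUnitBall x hr) (φ ∘ toUnitBall x hr) z = 0 := h1
    rw [h1, h2, zero_smul, zero_smul, smul_zero]
  · rw [toUnitBall_sub, hK.homogeneous _ _ (inv_pos.2 hr) (sub_ne_zero.2 hz),
      Real.inv_rpow hr.le, Real.rpow_neg hr.le, inv_inv, smul_comm]
    rfl

/-- The scale invariant form of `IsCZKernel.exists_le_norm_pairing_unit`. -/
lemma IsCZKernel.exists_le_norm_pairing (hK : IsCZKernel s α K) (hs : 0 < s) (hα : 0 < α)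
    (hα1 : α ≤ 1) (hrigid : ∀ ν : Measure (E d), IsNice s ν → IsReflectionless s α K ν → ν = 0)
    {C : ℝ} (hC : 0 < C) : ∃ ε A Δ : ℝ, 0 < ε ∧ ε ≤ 1 ∧ 1 ≤ A ∧ 0 < Δ ∧
      ∀ (μ : Measure (E d)) [IsFiniteMeasure μ], IsNice s μ →
        (∃ R, 0 < R ∧ μ (Metric.ball 0 R)ᶜ = 0) → ∀ (x : E d) (r : ℝ), 0 < r →
        0 < μ.real (Metric.ball x r) →
        (∀ y t, 0 < t → μ.real (Metric.ball y t) ≤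
          C * hypRatio x r y t ^ ε * (μ.real (Metric.ball x r) / r ^ s) * t ^ s) →
        ∃ f, IsBump μ x r A f ∧
          Δ * (μ.real (Metric.ball x r) ^ 2 / r ^ s) ≤ ‖pairing K μ f (fun _ => 1)‖ := by
  obtain ⟨ε, A, Δ, hε, hε1, hA, hΔ, hmain⟩ :=
    hK.exists_le_norm_pairing_unit hs hα hα1 hrigid hC
  refine ⟨ε, A, Δ, hε, hε1, hA, hΔ, fun μ _ hnice hR x r hr hw hgrowth => ?_⟩
  obtain ⟨Λ, hΛ, hnice⟩ := hnice
  obtain ⟨R, hR0, hR⟩ := hR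
  set w : ℝ := μ.real (Metric.ball x r) with hwdef
  set S := toUnitBall x hr with hS
  have hSm := S.measurableEmbedding
  set c : ℝ≥0∞ := ENNReal.ofReal w⁻¹ with hc
  have hctop : c ≠ ⊤ := ENNReal.ofReal_ne_top
  have hcr : c.toReal = w⁻¹ := ENNReal.toReal_ofReal (by positivity)
  set ν : Measure (E d) := c • μ.map S with hν
  have hfin : IsFiniteMeasure (μ.map S) := inferInstance
  have hνfin : IsFiniteMeasure ν := Measure.smul_finite _ hctop
  have hball : ∀ y t, ν (Metric.ball y t) = c * μ (Metric.ball (x + r • y) (r * t)) := by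
    intro y t
    rw [hν, Measure.smul_apply, hSm.map_apply, hS, toUnitBall_preimage_ball, smul_eq_mul]
  have hballr : ∀ y t, ν.real (Metric.ball y t) =
      w⁻¹ * μ.real (Metric.ball (x + r • y) (r * t)) := by
    intro y t
    rw [measureReal_def, hball, ENNReal.toReal_mul, hcr, measureReal_def]
  have hνnice : IsNiceWith s (w⁻¹ * (Λ * r ^ s)) ν := by
    intro y t ht
    rw [hball, mul_assoc, ENNReal.ofReal_mul (by positivity), mul_assoc, ← Real.mul_rpow hr.le ht.le]
    gcongr
    exact hnice _ _ (by positivity)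
  obtain ⟨h, hb, hp⟩ := hmain ν (hνnice.isDiffuse hs (by positivity))
    ⟨(R + ‖x‖) / r, by positivity, by
      rw [hν, Measure.smul_apply, hSm.map_apply, preimage_compl, hS, toUnitBall_preimage_ball,
        smul_zero, add_zero, mul_div_cancel₀ _ hr.ne', smul_eq_mul,
        measure_mono_null (compl_subset_compl.2 (Metric.ball_subset_ball' ?_)) hR, mul_zero]
      simp⟩
    (by
      rw [hballr, smul_zero, add_zero, mul_one, inv_mul_cancel₀ hw.ne'])
    (fun y t ht => by
      have e : hypRatio x r (x + r • y) (r * t) = hypRatio 0 1 y t := by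
        unfold hypRatio
        rw [dist_self_add_right, dist_zero_left, norm_smul, Real.norm_of_nonneg hr.le]
        field_simp
      rw [hballr]
      calc _ ≤ w⁻¹ * (C * hypRatio x r (x + r • y) (r * t) ^ ε * (w / r ^ s) * (r * t) ^ s) := by
            gcongr
            exact hgrowth _ _ (by positivity)
        _ = _ := by
            rw [e, Real.mul_rpow hr.le ht.le]
            have : r ^ s ≠ 0 := by positivity
            field_simp)
  have hint : ∫ y, h (S y) ∂μ = 0 := by
    have h1 := hb.integral_eq_zero
    rw [hν, integral_smul_measure, hSm.integral_map, hcr] at h1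
    exact (smul_eq_zero.1 h1).resolve_left (by positivity)
  have hlip : ∀ y z, ‖h (S y) - h (S z)‖ ≤ dist y z / r := by
    intro y z
    refine (hb.norm_sub_le _ _).trans_eq ?_
    rw [div_one, hS, dist_toUnitBall]
  have hmem : ∀ y, h (S y) ≠ 0 → y ∈ Metric.ball x (A * r) := by
    intro y hy
    have h1 : y ∈ S ⁻¹' Metric.ball 0 (A * 1) := hb.mem_ball _ hy
    rwa [hS, toUnitBall_preimage_ball, smul_zero, add_zero, mul_one, mul_comm] at h1
  refine ⟨h ∘ S, ⟨isLipZero_of_bounds (L := r⁻¹) (R := A * r + ‖x‖) (fun y z => ?_) fun y hy => ?_,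
    hlip, fun y => hb.norm_le _, hmem, hint⟩, ?_⟩
  · rw [inv_mul_eq_div]
    exact hlip y z
  · refine Metric.ball_subset_ball' ?_ (hmem y hy)
    rw [dist_zero_right]
  · rw [hν, pairing_smul_measure, hcr, hS, hK.pairing_map_toUnitBall, norm_smul, norm_smul,
      Real.norm_of_nonneg (by positivity), Real.norm_of_nonneg (by positivity)] at hp
    have hrs : 0 < r ^ s := by positivity
    rw [← mul_div_assoc, div_le_iff₀ hrs]
    calc Δ * w ^ 2 ≤ (w⁻¹ ^ 2 * (r ^ s * ‖pairing K μ (h ∘ S) fun _ => 1‖)) * w ^ 2 := by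
          gcongr
          exact hp
      _ = _ := by field_simp

end Rescaling

/-! ### The Wolff potential estimate -/

section Cube

variable {d : ℕ}

lemma IsCube.measurableSet {Q : Set (E d)} (hQ : IsCube Q) : MeasurableSet Q := by
  obtain ⟨a, ℓ, I, -, hI, rfl⟩ := hQ
  have hIm : ∀ i, MeasurableSet (I i) := by
    intro i
    have h1 : (I i \ Ioo (a i) (a i + ℓ)).Finite := by
      refine (Set.toFinite {a i, a i + ℓ}).subset fun x hx => ?_
      have h2 := (hI i).2 hx.1
      by_contra h3
      simp only [mem_insert_iff, mem_singleton_iff, not_or] at h3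
      exact hx.2 ⟨lt_of_le_of_ne h2.1 (Ne.symm h3.1), lt_of_le_of_ne h2.2 h3.2⟩
    rw [← union_sdiff_cancel (hI i).1]
    exact measurableSet_Ioo.union h1.measurableSet
  simp only [ofPred_forall]
  refine MeasurableSet.iInter fun i => ?_
  have : Measurable fun x : E d => x i := by fun_prop
  exact this (hIm i)

lemma IsCube.exists_subset_ball {Q : Set (E d)} (hQ : IsCube Q) :
    ∃ R, 0 < R ∧ Q ⊆ Metric.ball (0 : E d) R := by
  obtain ⟨a, ℓ, I, hℓ, hI, rfl⟩ := hQ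
  refine ⟨d * (‖a‖ + ℓ) + 1, by positivity, fun x hx => ?_⟩
  rw [Metric.mem_ball, dist_zero_right]
  have h1 := euclidean_norm_le x (‖a‖ + ℓ) fun i => by
    have h2 := (hI i).2 (hx i)
    have h3 := abs_le.1 (show |a i| ≤ ‖a‖ from PiLp.norm_apply_le a i)
    rw [abs_le]
    constructor <;> linarith [h2.1, h2.2]
  linarith

end Cube

section Main

variable {d m : ℕ} {s α : ℝ} {K : E d → V m}

lemma IsNiceWith.dens_le {Λ : ℝ} (hΛ : 0 ≤ Λ) {μ : Measure (E d)} (h : IsNiceWith s Λ μ)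
    (j : LatticeIndex d) : dens s μ j ≤ Λ := by
  have hr := rad_pos j
  unfold dens
  rw [div_le_iff₀ (by positivity)]
  exact ENNReal.toReal_le_of_le_ofReal (by positivity) (h _ _ hr)

/-- The sum over the dominant balls is controlled by the total mass, by Bessel's inequality for the
bumps with large pairings at these balls. -/
lemma IsCZKernel.exists_tsum_isDominant_le (hK : IsCZKernel s α K) (hs : 0 < s) (hα : 0 < α)
    (hα1 : α ≤ 1)
    (hrigid : ∀ ν : Measure (E d), IsNice s ν → IsReflectionless s α K ν → ν = 0) :
    ∃ ε, 0 < ε ∧ ∀ p Λ B : ℝ, 2 ≤ p → 0 < Λ → 0 ≤ B → ∃ C : ℝ, 0 ≤ C ∧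
      ∀ (μ : Measure (E d)) [IsFiniteMeasure μ], IsNiceWith s Λ μ → PairingBound K μ B →
        (∃ R, 0 < R ∧ μ (Metric.ball 0 R)ᶜ = 0) →
        ∑' i : LatticeIndex d, {i | IsDominant s ε μ i}.indicator
          (fun i => ENNReal.ofReal (dens s μ i ^ p * mass μ i)) i ≤ ENNReal.ofReal C * μ univ := by
  classical
  obtain ⟨ε, A, Δ, hε, hε1, hA, hΔ, hlarge⟩ := hK.exists_le_norm_pairing hs hα hα1 hrigid
    (C := (2 * (d + 1)) ^ s * (16 * (d + 1))) (by positivity)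
  obtain ⟨C, hC0, hC⟩ := hK.exists_sum_pairing_sq_le (A := A) hs hα hA
  refine ⟨ε, hε, fun p Λ B hp hΛ hB => ⟨Λ ^ (p - 2) * (Δ ^ 2)⁻¹ * (C * B ^ 2), by positivity,
    fun μ _ hnice hbd hR => ?_⟩⟩
  have hbump : ∀ j : LatticeIndex d, ∃ f, IsDominant s ε μ j →
      IsBump μ (node j) (rad j) A f ∧
        Δ * (mass μ j ^ 2 / rad j ^ s) ≤ ‖pairing K μ f (fun _ => 1)‖ := by
    intro j
    by_cases hj : IsDominant s ε μ j
    · obtain ⟨f, hf⟩ := hlarge μ ⟨Λ, hΛ, hnice⟩ hR (node j) (rad j) (rad_pos j) hj.1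
        fun y t ht => hj.measureReal_ball_le hs hε hε1 y ht
      exact ⟨f, fun _ => hf⟩
    · exact ⟨0, fun h => absurd h hj⟩
  choose f hf using hbump
  have hterm : ∀ j, IsDominant s ε μ j → dens s μ j ^ p * mass μ j ≤
      Λ ^ (p - 2) * (Δ ^ 2)⁻¹ * (‖pairing K μ (f j) (fun _ => 1)‖ ^ 2 / mass μ j) := by
    intro j hj
    have hm := hj.1
    have hr := rad_pos j
    have hrs : 0 < rad j ^ s := by positivity
    have hd : 0 < dens s μ j := div_pos hm hrs
    have h1 : Δ * (dens s μ j * mass μ j) ≤ ‖pairing K μ (f j) (fun _ => 1)‖ := by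
      refine le_trans (le_of_eq ?_) (hf j hj).2
      unfold dens
      ring
    have h2 : dens s μ j ^ p = dens s μ j ^ (p - 2) * dens s μ j ^ 2 := by
      rw [← Real.rpow_natCast, ← Real.rpow_add hd]
      norm_num
    have h3 : dens s μ j ^ (p - 2) ≤ Λ ^ (p - 2) :=
      Real.rpow_le_rpow hd.le (hnice.dens_le hΛ.le j) (by linarith)
    calc _ = dens s μ j ^ (p - 2) * (Δ ^ 2)⁻¹ *
          ((Δ * (dens s μ j * mass μ j)) ^ 2 / mass μ j) := by
          rw [h2]
          field_simp
      _ ≤ _ := by gcongr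
  obtain ⟨R, hR0, hR⟩ := hR
  rw [ENNReal.tsum_eq_iSup_sum]
  refine iSup_le fun F => ?_
  have h1 := hC μ B R ε hε hε1 hB hR0 hR (hnice.isDiffuse hs hΛ.le) hbd
    (F.filter (IsDominant s ε μ)) f (fun j hj => (Finset.mem_filter.1 hj).2)
    fun j hj => (hf j (Finset.mem_filter.1 hj).2).1
  have h2 : ∑ j ∈ F, {i | IsDominant s ε μ i}.indicator
      (fun i => ENNReal.ofReal (dens s μ i ^ p * mass μ i)) j =
      ∑ j ∈ F.filter (IsDominant s ε μ), ENNReal.ofReal (dens s μ j ^ p * mass μ j) := by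
    rw [Finset.sum_filter]
    rfl
  rw [h2, ← ENNReal.ofReal_sum_of_nonneg fun j _ =>
    mul_nonneg (Real.rpow_nonneg (dens_nonneg s μ j) p) (mass_nonneg μ j),
    ← ofReal_measureReal (measure_ne_top μ univ), ← ENNReal.ofReal_mul (by positivity)]
  apply ENNReal.ofReal_le_ofReal
  calc _ ≤ ∑ j ∈ F.filter (IsDominant s ε μ), Λ ^ (p - 2) * (Δ ^ 2)⁻¹ *
        (‖pairing K μ (f j) (fun _ => 1)‖ ^ 2 / mass μ j) :=
        Finset.sum_le_sum fun j hj => hterm j (Finset.mem_filter.1 hj).2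
    _ = Λ ^ (p - 2) * (Δ ^ 2)⁻¹ * ∑ j ∈ F.filter (IsDominant s ε μ),
        (‖pairing K μ (f j) (fun _ => 1)‖ ^ 2 / mass μ j) := (Finset.mul_sum _ _ _).symm
    _ ≤ Λ ^ (p - 2) * (Δ ^ 2)⁻¹ * (C * B ^ 2 * μ.real univ) := by gcongr
    _ = _ := by ring

end Main

end CZO


theorem proposition3p2 (d m : ℕ) (s α : ℝ) (hs : 0 < s) (hsd : s < d) (hα : 0 < α) (hα1 : α ≤ 1)
    (K : CZO.E d → CZO.V m) (hK : CZO.IsCZKernel s α K)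
    (hrigid : ∀ ν : Measure (CZO.E d),
      CZO.IsNice s ν → CZO.IsReflectionless s α K ν → ν = 0) :
    ∃ p : ℝ, 0 < p ∧ ∀ Λ B : ℝ, 0 < Λ → ∃ C : ℝ, 0 < C ∧
      ∀ μ : Measure (CZO.E d), CZO.IsNiceWith s Λ μ → CZO.IsBoundedCZO s α K μ →
        ‖CZO.czOperator K μ‖ ≤ B →
          ∀ Q : Set (CZO.E d), CZO.IsCube Q →
            ∫⁻ x in Q, CZO.wolffPotential s p (μ.restrict Q) x ∂μ ≤ ENNReal.ofReal C * μ Q := by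
  obtain ⟨ε, hε, hdom⟩ := hK.exists_tsum_isDominant_le hs hα hα1 hrigid
  -- large enough for the reduction to dominant balls, and at least the exponent `2` of Bessel's
  -- inequality
  set p : ℝ := (s + (2 * d + 1)) / ε + 2 with hp
  have hp2 : 2 ≤ p := le_add_of_nonneg_left (by positivity)
  have hp0 : 0 < p := by linarith
  have hpε : s + (2 * d + 1) ≤ ε * (p + 1) := by
    have : ε * (p + 1) = s + (2 * d + 1) + 3 * ε := by
      rw [hp]
      field_simp
      ring
    linarith
  obtain ⟨C₁, hC₁⟩ := CZO.tsum_dens_le_tsum_isDominant (d := d) hs hε hp0 hpε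
  refine ⟨p, hp0, fun Λ B hΛ => ?_⟩
  obtain ⟨C₂, hC₂0, hC₂⟩ := hdom p Λ (max B 0) hp2 hΛ (le_max_right _ _)
  refine ⟨((2 * (d + 1)) ^ s) ^ p * (C₁ * C₂) + 1, by positivity, fun μ hnice hbdd hB Q hQ => ?_⟩
  have := hnice.isLocallyFiniteMeasure
  obtain ⟨R, hR, hQR⟩ := hQ.exists_subset_ball
  have hQfin : μ Q < ⊤ := (measure_mono hQR).trans_lt measure_ball_lt_top
  have hfin : IsFiniteMeasure (μ.restrict Q) := ⟨by rwa [Measure.restrict_apply_univ]⟩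
  have hniceQ := hnice.restrict Q
  have hbd := (hK.pairingBound hs hα hΛ.le hnice hbdd (hB.trans (le_max_left B 0))).restrict hK hα
    (hnice.isDiffuse hs hΛ.le) hQ.measurableSet hQfin.ne
  have hQnull : μ.restrict Q (Metric.ball 0 R)ᶜ = 0 := by
    rw [Measure.restrict_apply Metric.isOpen_ball.measurableSet.compl]
    convert measure_empty (μ := μ)
    exact (disjoint_compl_left_iff_subset.2 hQR).inter_eq
  calc _ ≤ ENNReal.ofReal (((2 * (d + 1)) ^ s) ^ p) * ∑' j : CZO.LatticeIndex d,
        ENNReal.ofReal (CZO.dens s (μ.restrict Q) j ^ p * CZO.mass (μ.restrict Q) j) :=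
        CZO.lintegral_wolffPotential_le hs hp0 (μ.restrict Q)
    _ ≤ ENNReal.ofReal (((2 * (d + 1)) ^ s) ^ p) *
        (C₁ * (ENNReal.ofReal C₂ * μ.restrict Q univ)) := by
        gcongr
        refine (hC₁ _ Λ (hniceQ.dens_le hΛ.le)).trans ?_
        gcongr
        exact hC₂ _ hniceQ hbd ⟨R, hR, hQnull⟩
    _ = ENNReal.ofReal (((2 * (d + 1)) ^ s) ^ p * (C₁ * C₂)) * μ Q := by
        rw [Measure.restrict_apply_univ, ENNReal.ofReal_mul (by positivity),
          ENNReal.ofReal_mul C₁.coe_nonneg, ENNReal.ofReal_coe_nnreal]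
        ring
    _ ≤ _ := by
        gcongr
        linarith
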